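/- **Notation.** For a permutation $\pi\in\mathfrak S_n$ let $\operatorname{maj}\pi=\sum_{1\le i<n,\ \pi_i>\pi_{i+1}} i$. Let $S(k,n)$ be the set of sequences $c_1c_2\ldots c_n$ of integers with $0\le c_i\le i-1$ and $\sum_i c_i=k$. In *co-lex order*, $c$ precedes $d$ if $c_i<d_i$ at the largest $i$ with $c_i\neq d_i$. Put $\operatorname{tri}(k)=\min\{s\ge 1: s(s-1)/2\ge k\}$. Permutations are multiplied by $(\sigma\cdot\tau)(i)=\sigma(\tau(i))$. $[\![u,t]\!]\in\mathfrak S_n$ is the permutation obtained by $t$ right circular shifts of the length-$u$ prefix of the identity, and $$\psi(t_1\ldots t_n)=[\![n,t_n]\!]\cdot[\![n-1,t_{n-1}]\!]\cdots[\![1,t_1]\!].$$ **Gen1_Gray$(k,r,dir)$** (global array $c$): if $k=0$, output $c$. Otherwise: if $c[r]=r-1$ then $r:=r-1$; $\ell:=\operatorname{tri}(k)$; $e:=k-\frac{(\ell-1)(\ell-2)}2$. If $dir=0$: call Gen1_Gray$(k-e,\ell,0)$ with $c[\ell]$ increased by $e$; then for $i=\ell+1,\ldots,r$ call Gen1_Gray$(k-1,i,d)$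 with $c[i]$ increased by 1, where $d$ starts with $(r-\ell)\bmod 2$ and alternates. If $dir=1$: for $i=r,r-1,\ldots,\ell+1$ call Gen1_Gray$(k-1,i,d)$ with $c[i]$ increased by 1, where $d$ starts with $0$ and alternates; then call Gen1_Gray$(k-e,\ell,1)$ with $c[\ell]$ increased by $e$. (After each call $c$ is restored.) $\mathcal S(k,n)$ is the ordered list output by Gen1_Gray$(k,n,0)$ started from $c=0\ldots0$. **Gen2_Gray$(k,r,dir,p,u)$**: the same procedure with two more parameters. If $k=0$: output$(p,u)$. Otherwise, first do "if $c[r]=r-1$ then $r:=r-1$"; then, if $p-r\ge 3$ and $k=\frac{r(r-1)}2$, output$(p,u)$ and stop; otherwise make the recursive calls of Gen1_Gray, with these last two arguments: for $dir=0$, the call at $\ell$ gets $(p,u)$, and the call at $i>\ell$ gets $(i,\ k-1+c[i])$ (with $c[i]$ already increased); for $dir=1$, a call at position $i$ ($i=r,\ldots,\ell$) gets $(p,u)$ if $i=r$ and $(i+1,\ c[i+1]+k)$ otherwise. **transp$(v,f,x)$** (global arrays $s,\sigma$): $j:=\operatorname{tri}(x)$; with $\phi_j(i)=j-s_j-i$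 if $1\le i\le j-(s_j+1)$, $\phi_j(i)=2j-s_j-i$ if $j-(s_j+1)<i\le j$, and $\phi_j(i)=i$ if $i>j$: exchange the entries of $\sigma$ in positions $\phi_j(f+1)$ and $\phi_j(s[f])$ (if $v=1$) or $\phi_j(f+1)$ and $\phi_j(s[f]+1)$ (if $v\ne1$); then $s[f]:=s[f]-v$; $s[f+1]:=s[f+1]+v$. **Update_Perm$(p,u)$**: if $p=0$ do nothing. Otherwise $x:=u-c[p]-c[p-1]$; if $p-2\ge1$ and $s[p-2]=c[p-2]$ then $f:=p-1$, else $f:=p-2$ and $x:=x-c[f]$; $a_1:=s[f]-c[f]$, $a_2:=s[f+1]-c[f+1]$, $a_3:=s[f+2]-c[f+2]$ ($a_3:=0$ if $f+2>n$); $v:=1$ if $a_1>0$, else $v:=-1$. According to $(a_1,a_2,a_3)$ execute * $\pm(1,-1,0)$: transp$(v,f,x)$; * $\pm(2,-2,0)$: transp$(v,f,x)$ twice; * $\pm(1,-2,1)$: transp$(v,f,x)$; transp$(-v,f+1,x+s[f])$; * $\pm(1,-3,2)$: transp$(v,f,x)$; transp$(-v,f+1,x+s[f])$ twice; * $\pm(1,1,-2)$: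 transp$(v,f+1,x+s[f])$; transp$(v,f,x)$; transp$(v,f+1,x+s[f])$; * $(1,0,-1)$: transp$(1,f,x)$; transp$(1,f+1,x+s[f])$; * $(-1,0,1)$: transp$(-1,f+1,x+s[f])$; transp$(-1,f,x)$. **Theorem.** Let $0\le k\le n(n-1)/2$. 1. $\psi$ maps $S(k,n)$ bijectively onto the set of permutations in $\mathfrak S_n$ with major index $k$, and $\mathcal S(k,n)$ lists every element of $S(k,n)$ exactly once. The image of the list $\mathcal S(k,n)$ under $\psi$ lists every permutation in $\mathfrak S_n$ with major index $k$ exactly once, and any two consecutive permutations $\sigma,\tau$ of it satisfy $\tau=\sigma\cdot g_1\cdots g_m$ with transpositions $g_1,\ldots,g_m$, $m\le3$. 2. Initialize $c$ by $0\ldots0$, $s$ by the smallest sequence of $S(k,n)$ in co-lex order, $\sigma$ by $\psi(s)$, and a table by the values $\operatorname{tri}(0),\ldots,\operatorname{tri}(k)$. Then run Gen2_Gray$(k,n,0,0,0)$, where each output$(p,u)$ runs Update_Perm$(p,u)$ and then outputs the current $\sigma$. The run terminates, and the successive outputs are exactly the list $\psi(\mathcal S(k,n))$ in order. It takes constant amortized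 time: there is an absolute constant $C$ such that, if $N$ is the number of permutations in $\mathfrak S_n$ with major index $k$, the number of elementary steps of the run (unit-cost integer arithmetic, comparisons, assignments, array accesses and procedure calls; initialization and the printing of $\sigma$ are not counted) is at most $C\cdot N$ whenever $k<n(n-1)/2$, and at most $C\cdot(N+n)$ in all cases, including the single-permutation case $k=n(n-1)/2$. -/

import Mathlib

namespace MajGray

/-! ## Major index, subexcedant sequences and the bijection with permutations -/

/-- The major index `∑ i` over the (1-based) descents `i < n` of `π`.
Positions and values of `Fin n` are 0-based, so the 1-based position of `i` is `i + 1`. -/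
def maj {n : ℕ} (π : Equiv.Perm (Fin n)) : ℕ :=
  ∑ i : Fin n, if h : (i : ℕ) + 1 < n then
    (if π ⟨(i : ℕ) + 1, h⟩ < π i then (i : ℕ) + 1 else 0) else 0

/-- Subexcedant sequences of length `n` and weight `k` (the entry at the 1-based position `i` is
at most `i - 1`). -/
def S (k n : ℕ) : Set (Fin n → ℕ) :=
  {c | (∀ i : Fin n, c i ≤ (i : ℕ)) ∧ ∑ i, c i = k}

/-- `k` right circular shifts of the prefix of length `i + 1` of the identity.
One such shift is `(i+1) 1 2 … i`, the inverse of Mathlib's `Fin.cycleRange i`. Permutations act on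
indices, `(σ * τ) i = σ (τ i)`, as in Mathlib. -/
def prefixRot {n : ℕ} (i : Fin n) (k : ℕ) : Equiv.Perm (Fin n) :=
  (Fin.cycleRange i)⁻¹ ^ k

/-- `ψ(t₁ … tₙ) = ⟦n,tₙ⟧ ⋅ ⟦n-1,tₙ₋₁⟧ ⋅ … ⋅ ⟦1,t₁⟧`. -/
def psi {n : ℕ} (t : Fin n → ℕ) : Equiv.Perm (Fin n) :=
  ((List.finRange n).reverse.map fun i => prefixRot i (t i)).prod

/-- `a` strictly precedes `b` in co-lex order. -/
def ColexLT {n : ℕ} (a b : Fin n → ℕ) : Prop :=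
  ∃ i, a i < b i ∧ ∀ j, i < j → a j = b j

/-- `a` is the smallest sequence of `S k n` in co-lex order. -/
def IsColexLeast (k n : ℕ) (a : Fin n → ℕ) : Prop :=
  a ∈ S k n ∧ ∀ b ∈ S k n, b ≠ a → ColexLT a b

/-- `τ` is obtained from `σ` by at most `m` transpositions. -/
def DifferByAtMost {n : ℕ} (m : ℕ) (σ τ : Equiv.Perm (Fin n)) : Prop :=
  ∃ L : List (Equiv.Perm (Fin n)), L.length ≤ m ∧ (∀ g ∈ L, g.IsSwap) ∧ τ = σ * L.prod

/-! ## The list generated by `Gen1_Gray` -/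

theorem exists_tri (k : ℕ) : ∃ s : ℕ, 1 ≤ s ∧ k ≤ s * (s - 1) / 2 := by
  refine ⟨k + 1, by omega, ?_⟩
  rw [Nat.le_div_iff_mul_le (by norm_num)]
  rcases Nat.eq_zero_or_pos k with h | h
  · subst h; simp
  · simp only [Nat.add_sub_cancel]
    nlinarith

/-- `min {s ≥ 1 | s (s - 1) / 2 ≥ k}`. -/
def tri (k : ℕ) : ℕ := Nat.find (exists_tri k)

theorem tri_sub_lt {k : ℕ} (hk : k ≠ 0) :
    k - (k - (tri k - 1) * (tri k - 2) / 2) < k := by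
  have h1 : 1 ≤ tri k := (Nat.find_spec (exists_tri k)).1
  have h2 : k ≤ tri k * (tri k - 1) / 2 := (Nat.find_spec (exists_tri k)).2
  rcases Nat.eq_or_lt_of_le h1 with h | h
  · rw [← h] at h2; simp at h2; omega
  · have h3 := Nat.find_min (exists_tri k) (m := tri k - 1) (by unfold tri at h ⊢; omega)
    have h4 : ¬ (1 ≤ tri k - 1 ∧ k ≤ (tri k - 1) * (tri k - 2) / 2) := h3
    omega

/-- `Gen1_Gray(k, r, dir)` on the current array `c` (indexed by `1, …, n`): the list of the arrays
that it outputs, in order. Each recursive call gets the modified array; restoring the array after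
the call is implicit. In the first loop (`i` from `l + 1` to `r`) the direction starts with
`(r - l) mod 2` and alternates; in the second (`i` from `r` down to `l + 1`) it starts with `0` and
alternates. -/
def gen1Gray (k r dir : ℕ) (c : ℕ → ℕ) : List (ℕ → ℕ) :=
  if _hk : k = 0 then [c]
  else
    let r' := if c r = r - 1 then r - 1 else r
    let l := tri k
    let e := k - (l - 1) * (l - 2) / 2
    if dir = 0 then
      gen1Gray (k - e) l 0 (Function.update c l (c l + e)) ++
      (List.range (r' - l)).flatMap fun j =>
        gen1Gray (k - 1) (l + 1 + j) ((r' - l + j) % 2)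
          (Function.update c (l + 1 + j) (c (l + 1 + j) + 1))
    else
      ((List.range (r' - l)).flatMap fun j =>
        gen1Gray (k - 1) (r' - j) (j % 2)
          (Function.update c (r' - j) (c (r' - j) + 1))) ++
      gen1Gray (k - e) l 1 (Function.update c l (c l + e))
termination_by k
decreasing_by
  all_goals first
    | exact tri_sub_lt _hk
    | omega

/-- The ordered list generated by `Gen1_Gray(k, n, 0)` from the all-zero array. -/
def grayList (k n : ℕ) : List (Fin n → ℕ) :=
  (gen1Gray k n 0 fun _ => 0).map fun c i => c ((i : ℕ) + 1)

/-- The image of the list `grayList k n` under `psi`. -/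
def permList (k n : ℕ) : List (Equiv.Perm (Fin n)) :=
  (grayList k n).map psi

/-! ## A small imperative language with unit-cost elementary operations

Integer scalars, global integer arrays, recursive procedures with call-by-value parameters and
local scalar variables. Every node of an evaluated expression, every assignment, array write, test
and procedure call costs one step. -/

/-- Global arrays. `tri` holds the precomputed values of `k ↦ min {s | s (s - 1) / 2 ≥ k}`. -/
inductive Arr
  | c | s | sigma | tri
  deriving DecidableEq

/-- Names of local scalar variables and parameters. -/
inductive Var
  | k | r | dir | p | u | l | e | i | q | v | x | f | a1 | a2 | a3 | j | y | z | w
  deriving DecidableEq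

inductive Op
  | add | sub | mul | div | mod | le | eq

/-- `le` and `eq` return `1` for true and `0` for false. -/
def Op.eval : Op → ℤ → ℤ → ℤ
  | add, a, b => a + b
  | sub, a, b => a - b
  | mul, a, b => a * b
  | div, a, b => a / b
  | mod, a, b => a % b
  | le, a, b => if a ≤ b then 1 else 0
  | eq, a, b => if a = b then 1 else 0

inductive Expr
  | lit (z : ℤ)
  | var (x : Var)
  | size
  | read (a : Arr) (i : Expr)
  | bin (o : Op) (e₁ e₂ : Expr)
  | cond (b e₁ e₂ : Expr)

/-- Local variables of one procedure activation. -/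
abbrev Frame := Var → ℤ

/-- Global memory: the constant `n`, the arrays, and the trace of the objects output so far (each a
snapshot of the array `sigma`). -/
structure Mem where
  n : ℤ
  arr : Arr → ℤ → ℤ
  out : List (ℤ → ℤ)

def Mem.write (m : Mem) (a : Arr) (i z : ℤ) : Mem :=
  { m with arr := Function.update m.arr a (Function.update (m.arr a) i z) }

def Mem.emit (m : Mem) : Mem :=
  { m with out := m.out ++ [m.arr Arr.sigma] }

namespace Expr

def eval (fr : Frame) (m : Mem) : Expr → ℤ
  | lit z => z
  | var x => fr x
  | size => m.n
  | read a i => m.arr a (eval fr m i)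
  | bin o e₁ e₂ => o.eval (eval fr m e₁) (eval fr m e₂)
  | cond b e₁ e₂ => if eval fr m b ≠ 0 then eval fr m e₁ else eval fr m e₂

/-- Number of steps of the evaluation of an expression; only the selected branch of `cond` is
evaluated. -/
def cost (fr : Frame) (m : Mem) : Expr → ℕ
  | lit _ => 1
  | var _ => 1
  | size => 1
  | read _ i => cost fr m i + 1
  | bin _ e₁ e₂ => cost fr m e₁ + cost fr m e₂ + 1
  | cond b e₁ e₂ =>
      cost fr m b + 1 + (if eval fr m b ≠ 0 then cost fr m e₁ else cost fr m e₂)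

instance (n : ℕ) : OfNat Expr n := ⟨lit (n : ℤ)⟩
instance : Coe Var Expr := ⟨var⟩
instance : Add Expr := ⟨bin Op.add⟩
instance : Sub Expr := ⟨bin Op.sub⟩
instance : Mul Expr := ⟨bin Op.mul⟩
instance : Div Expr := ⟨bin Op.div⟩
instance : Mod Expr := ⟨bin Op.mod⟩

def le (a b : Expr) : Expr := bin Op.le a b
def eq (a b : Expr) : Expr := bin Op.eq a b
def and (a b : Expr) : Expr := cond a b 0
def or (a b : Expr) : Expr := cond a 1 b

end Expr

/-- Names of procedures. -/
inductive Proc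
  | gen2Gray | updatePerm | transp

inductive Stmt
  | skip
  | assign (x : Var) (e : Expr)
  | store (a : Arr) (i e : Expr)
  | seq (s₁ s₂ : Stmt)
  | ite (b : Expr) (s₁ s₂ : Stmt)
  | loop (b : Expr) (s : Stmt)
  | call (P : Proc) (args : List Expr)
  | emit

namespace Stmt

/-- Sequential composition of a list of statements. -/
def block : List Stmt → Stmt
  | [] => skip
  | [s] => s
  | s :: t => seq s (block t)

/-- `for x := a to b do s`. -/
def forUp (x : Var) (a b : Expr) (s : Stmt) : Stmt :=
  seq (assign x a) (loop (Expr.le x b) (seq s (assign x (Expr.var x + 1))))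

/-- `for x := a downto b do s`. -/
def forDown (x : Var) (a b : Expr) (s : Stmt) : Stmt :=
  seq (assign x a) (loop (Expr.le b x) (seq s (assign x (Expr.var x - 1))))

end Stmt

/-! ## The three procedures -/

section Programs

open Stmt Expr

/-- The body of `Gen2_Gray(k, r, dir, p, u)`. The test for a quasi-terminal node is made with the
adjusted value of `r`. Where an object is completed, `Update_Perm(p, u)` is run and the current
permutation is output. -/
def gen2GrayBody : Stmt :=
  let k : Expr := Var.k
  let r : Expr := Var.r
  let dir : Expr := Var.dir
  let p : Expr := Var.p
  let u : Expr := Var.u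
  let l : Expr := Var.l
  let e : Expr := Var.e
  let i : Expr := Var.i
  let q : Expr := Var.q
  let v : Expr := Var.v
  let c : Expr → Expr := read Arr.c
  let output : Stmt := block [call Proc.updatePerm [p, u], emit]
  ite (eq k 0)
    output
    (block [
      ite (eq (c r) (r - 1)) (assign Var.r (r - 1)) skip,
      ite (and (le 3 (p - r)) (eq k (r * (r - 1) / 2)))
        output
        (block [
          assign Var.l (read Arr.tri k),
          assign Var.e (k - (l - 1) * (l - 2) / 2),
          ite (eq dir 0)
            (block [
              store Arr.c l (c l + e),
              call Proc.gen2Gray [k - e, l, 0, p, u],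
              store Arr.c l (c l - e),
              assign Var.dir ((r - l) % 2),
              forUp Var.i (l + 1) r (block [
                store Arr.c i (c i + 1),
                call Proc.gen2Gray [k - 1, i, dir, i, k - 1 + c i],
                assign Var.dir ((dir + 1) % 2),
                store Arr.c i (c i - 1)])])
            (block [
              assign Var.dir 0,
              forDown Var.i r (l + 1) (block [
                ite (eq i r)
                  (block [assign Var.q p, assign Var.v u])
                  (block [assign Var.q (i + 1), assign Var.v (c (i + 1) + k)]),
                store Arr.c i (c i + 1),
                call Proc.gen2Gray [k - 1, i, dir, q, v],
                assign Var.dir ((dir + 1) % 2),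
                store Arr.c i (c i - 1)]),
              ite (eq l r)
                (block [assign Var.q p, assign Var.v u])
                (block [assign Var.q (l + 1), assign Var.v (c (l + 1) + k)]),
              store Arr.c l (c l + e),
              call Proc.gen2Gray [k - e, l, 1, q, v],
              store Arr.c l (c l - e)])])])

/-- The body of `transp(v, f, x)`: `sigma := sigma ⋅ ⟨φ_j(f+1), φ_j(s[f])⟩` (with `s[f] + 1` instead
of `s[f]` if `v ≠ 1`), that is, the entries of `sigma` in these two positions are exchanged; then
`s[f]` decreases and `s[f+1]` increases by `v`. -/
def transpBody : Stmt :=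
  let v : Expr := Var.v
  let f : Expr := Var.f
  let x : Expr := Var.x
  let j : Expr := Var.j
  let y : Expr := Var.y
  let z : Expr := Var.z
  let w : Expr := Var.w
  let s : Expr → Expr := read Arr.s
  let sigma : Expr → Expr := read Arr.sigma
  let phi : Expr → Expr := fun t =>
    cond (and (le 1 t) (le t (j - (s j + 1)))) (j - s j - t)
      (cond (le t j) (2 * j - s j - t) t)
  block [
    assign Var.j (read Arr.tri x),
    assign Var.y (phi (f + 1)),
    ite (eq v 1)
      (assign Var.z (phi (s f)))
      (assign Var.z (phi (s f + 1))),
    assign Var.w (sigma y),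
    store Arr.sigma y (sigma z),
    store Arr.sigma z w,
    store Arr.s f (s f - v),
    store Arr.s (f + 1) (s (f + 1) + v)]

/-- The body of `Update_Perm(p, u)`. For `p = 0` (the first object of the list, which is the initial
content of `sigma`) there is nothing to do. -/
def updatePermBody : Stmt :=
  let p : Expr := Var.p
  let u : Expr := Var.u
  let x : Expr := Var.x
  let f : Expr := Var.f
  let v : Expr := Var.v
  let c : Expr → Expr := read Arr.c
  let s : Expr → Expr := read Arr.s
  let is : ℤ → ℤ → ℤ → Expr := fun b₁ b₂ b₃ =>
    and (eq Var.a1 (lit b₁)) (and (eq Var.a2 (lit b₂)) (eq Var.a3 (lit b₃)))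
  let pm : ℤ → ℤ → ℤ → Expr := fun b₁ b₂ b₃ => or (is b₁ b₂ b₃) (is (-b₁) (-b₂) (-b₃))
  let transp : Expr → Expr → Expr → Stmt := fun t₁ t₂ t₃ => call Proc.transp [t₁, t₂, t₃]
  ite (eq p 0)
    skip
    (block [
      assign Var.x (u - c p - c (p - 1)),
      ite (and (le 1 (p - 2)) (eq (s (p - 2)) (c (p - 2))))
        (assign Var.f (p - 1))
        (block [assign Var.f (p - 2), assign Var.x (x - c f)]),
      assign Var.a1 (s f - c f),
      assign Var.a2 (s (f + 1) - c (f + 1)),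
      ite (le (size + 1) (f + 2))
        (assign Var.a3 0)
        (assign Var.a3 (s (f + 2) - c (f + 2))),
      ite (le 1 Var.a1) (assign Var.v 1) (assign Var.v (lit (-1))),
      ite (pm 1 (-1) 0) (transp v f x)
      (ite (pm 2 (-2) 0) (block [transp v f x, transp v f x])
      (ite (pm 1 (-2) 1) (block [transp v f x, transp (0 - v) (f + 1) (x + s f)])
      (ite (pm 1 (-3) 2) (block [transp v f x, transp (0 - v) (f + 1) (x + s f),
          transp (0 - v) (f + 1) (x + s f)])
      (ite (pm 1 1 (-2)) (block [transp v (f + 1) (x + s f), transp v f x,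
          transp v (f + 1) (x + s f)])
      (ite (is 1 0 (-1)) (block [transp 1 f x, transp 1 (f + 1) (x + s f)])
      (ite (is (-1) 0 1) (block [transp (lit (-1)) (f + 1) (x + s f), transp (lit (-1)) f x])
      skip))))))])

end Programs

def Proc.params : Proc → List Var
  | gen2Gray => [Var.k, Var.r, Var.dir, Var.p, Var.u]
  | updatePerm => [Var.p, Var.u]
  | transp => [Var.v, Var.f, Var.x]

def Proc.body : Proc → Stmt
  | gen2Gray => gen2GrayBody
  | updatePerm => updatePermBody
  | transp => transpBody

/-- The frame of a new activation: parameters are bound to the arguments, other locals are `0`. -/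
def bindParams : List Var → List ℤ → Frame
  | x :: xs, z :: zs => Function.update (bindParams xs zs) x z
  | _, _ => fun _ => 0

/-- Big-step semantics: `Exec s fr m fr' m' t` says that `s`, started with local variables `fr` and
memory `m`, terminates with local variables `fr'` and memory `m'` after `t` steps. -/
inductive Exec : Stmt → Frame → Mem → Frame → Mem → ℕ → Prop
  | skip (fr : Frame) (m : Mem) : Exec Stmt.skip fr m fr m 1
  | assign (x : Var) (e : Expr) (fr : Frame) (m : Mem) :
      Exec (Stmt.assign x e) fr m (Function.update fr x (e.eval fr m)) m (e.cost fr m + 1)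
  | store (a : Arr) (i e : Expr) (fr : Frame) (m : Mem) :
      Exec (Stmt.store a i e) fr m fr (m.write a (i.eval fr m) (e.eval fr m))
        (i.cost fr m + e.cost fr m + 1)
  | seq {s₁ s₂ : Stmt} {fr₀ fr₁ fr₂ : Frame} {m₀ m₁ m₂ : Mem} {t₁ t₂ : ℕ} :
      Exec s₁ fr₀ m₀ fr₁ m₁ t₁ → Exec s₂ fr₁ m₁ fr₂ m₂ t₂ →
      Exec (Stmt.seq s₁ s₂) fr₀ m₀ fr₂ m₂ (t₁ + t₂)
  | iteTrue {b : Expr} {s₁ s₂ : Stmt} {fr fr' : Frame} {m m' : Mem} {t : ℕ} :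
      b.eval fr m ≠ 0 → Exec s₁ fr m fr' m' t →
      Exec (Stmt.ite b s₁ s₂) fr m fr' m' (b.cost fr m + 1 + t)
  | iteFalse {b : Expr} {s₁ s₂ : Stmt} {fr fr' : Frame} {m m' : Mem} {t : ℕ} :
      b.eval fr m = 0 → Exec s₂ fr m fr' m' t →
      Exec (Stmt.ite b s₁ s₂) fr m fr' m' (b.cost fr m + 1 + t)
  | loopStep {b : Expr} {s : Stmt} {fr₀ fr₁ fr₂ : Frame} {m₀ m₁ m₂ : Mem} {t₁ t₂ : ℕ} :
      b.eval fr₀ m₀ ≠ 0 → Exec s fr₀ m₀ fr₁ m₁ t₁ →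
      Exec (Stmt.loop b s) fr₁ m₁ fr₂ m₂ t₂ →
      Exec (Stmt.loop b s) fr₀ m₀ fr₂ m₂ (b.cost fr₀ m₀ + 1 + t₁ + t₂)
  | loopEnd {b : Expr} {s : Stmt} {fr : Frame} {m : Mem} :
      b.eval fr m = 0 → Exec (Stmt.loop b s) fr m fr m (b.cost fr m + 1)
  | call {P : Proc} {args : List Expr} {fr fr' : Frame} {m m' : Mem} {t : ℕ} :
      Exec P.body (bindParams P.params (args.map fun e => e.eval fr m)) m fr' m' t →
      Exec (Stmt.call P args) fr m fr m' ((args.map fun e => e.cost fr m).sum + 1 + t)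
  | emit (fr : Frame) (m : Mem) : Exec Stmt.emit fr m fr m.emit 1

/-! ## Initial memory and output -/

/-- A sequence as an array with index range `1, …, n`. -/
def seqArr {n : ℕ} (a : Fin n → ℕ) : ℤ → ℤ := fun z =>
  if h : 1 ≤ z ∧ z ≤ (n : ℤ) then (a ⟨z.toNat - 1, by omega⟩ : ℤ) else 0

/-- The one-line notation `π(1) … π(n)`, with values `1, …, n`, as an array. -/
def permArr {n : ℕ} (π : Equiv.Perm (Fin n)) : ℤ → ℤ := seqArr fun i => (π i : ℕ) + 1

/-- Memory after the preprocessing: `c` is zero, `s` holds the sequence `a`, `sigma` holds the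
permutation with code `a`, and the table of `tri` is filled in for arguments up to `k`. -/
def initMem (n k : ℕ) (a : Fin n → ℕ) : Mem where
  n := n
  arr
    | Arr.c => fun _ => 0
    | Arr.s => seqArr a
    | Arr.sigma => permArr (psi a)
    | Arr.tri => fun z => if 0 ≤ z ∧ z ≤ (k : ℤ) then (tri z.toNat : ℤ) else 0
  out := []

/-- The main call `Gen2_Gray(k, n, 0, 0, 0)`. -/
def mainCall (n k : ℕ) : Stmt :=
  Stmt.call Proc.gen2Gray
    [Expr.lit (k : ℤ), Expr.lit (n : ℤ), Expr.lit 0, Expr.lit 0, Expr.lit 0]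

end MajGray

/-!
# Generating the permutations with a given major index by few transpositions

*The code.* The product defining `psi` is built up from the right by rotations of longer and longer
prefixes. One more right circular shift of the values of a prefix increases the major index by one
(`maj_cycleRange_inv_mul`), so that the major index of `psi t` is the sum of `t`. The leftmost
factor can be read off from the product, so `psi` is injective on subexcedant sequences; as there
are `n!` of these, it is a bijection (`psi_bijOn`).

*The list.* The recursive calls form a tree. Below a node with parameters `k`, `r` and array `c` the
algorithm lists the subexcedant sequences that arise by distributing the weight `k` over the first
`r` positions of `c`, each once (`mem_gen1Gray`, `nodup_gen1Gray`): the child at a position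
`i > tri k` has those whose last change is at `i`, the child at `tri k` has all others. The two
directions give reverse lists (`reverse_gen1Gray`), and the first and the last sequence are explicit
(`firstSeq`, `lastSeq`). Comparing them for neighbouring children shows that consecutive sequences
differ at two or three adjacent positions, in one of a few patterns (`Adj`, `isChain_gen1Gray`).

*The transpositions.* Suppose that the entries before position `f` form the co-lex smallest sequence
of their weight. Then moving one unit between the positions `f` and `f + 1` multiplies the
permutation by a transposition (`Move.psi_eq`); the partial product over the prefix is an involution
given by `phi`, which locates the two entries to be exchanged. Every pattern is a composition of at
most three such moves (`AdjTwo.steps`, `AdjThree.steps`).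

*The program.* `Runs` states that a statement terminates within a number of steps in a state with a
given property. `Update_Perm` only needs the entries of the new sequence from position `p - 2` on,
since before it the old and the new sequence agree; so a node of maximal weight with `p` at least
`r + 3` can stop at once (`runs_updatePerm`). The invariant of `Gen2_Gray` is that `s` is the last
sequence output, and that `p` and `u` describe its difference from the next one (`Start`).

*The running time.* A call with `N` outputs takes at most
`5000 * N + 400 * (reach + 3 - p) - 2950 - credit` steps (`Correct`). A node with several children
is paid for by the amounts `2950` that the children save. A node with an only child is paid for by
the credit of the child; in a chain of nodes of maximal weight there is no credit left, but the
position decreases, and when it is three below `p` the chain stops. Only for the initial `p = 0` is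
the second term not bounded by a constant. There `reach` is `tri k`, which is at most three times the
number of outputs unless `k` is maximal (`tri_le_length`), and at most `n + 1` in all cases.
-/

set_option linter.constructorNameAsVariable false

namespace MajGray

open Finset (range sum_range_succ)
open Equiv (Perm swap)

/-! ### Triangular numbers and smallest sequences -/

/-- The triangular number `0 + 1 + ⋯ + (r - 1)`, the largest weight of a subexcedant sequence of
length `r`. -/
def triangle (r : ℕ) : ℕ := r * (r - 1) / 2

@[simp] theorem triangle_zero : triangle 0 = 0 := rfl

@[simp] theorem triangle_one : triangle 1 = 0 := rfl

theorem triangle_succ (r : ℕ) : triangle (r + 1) = triangle r + r := by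
  unfold triangle
  rcases r with _ | r
  · rfl
  · simp only [Nat.add_sub_cancel]
    rw [show (r + 1 + 1) * (r + 1) = (r + 1) * r + (r + 1) * 2 by ring,
      Nat.add_mul_div_right _ _ (by norm_num)]

theorem triangle_eq_pred {r : ℕ} (h : 1 ≤ r) : triangle r = triangle (r - 1) + (r - 1) := by
  obtain ⟨s, rfl⟩ : ∃ s, r = s + 1 := ⟨r - 1, by omega⟩
  simpa using triangle_succ s

theorem triangle_mono : Monotone triangle :=
  monotone_nat_of_le_succ fun r => by rw [triangle_succ]; omega

theorem one_le_tri (k : ℕ) : 1 ≤ tri k := (Nat.find_spec (exists_tri k)).1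

theorem le_triangle_tri (k : ℕ) : k ≤ triangle (tri k) := (Nat.find_spec (exists_tri k)).2

theorem tri_le {k r : ℕ} (h1 : 1 ≤ r) (h2 : k ≤ triangle r) : tri k ≤ r :=
  Nat.find_min' (exists_tri k) ⟨h1, h2⟩

theorem two_le_tri {k : ℕ} (hk : 1 ≤ k) : 2 ≤ tri k := by
  have h1 := one_le_tri k
  have h2 := le_triangle_tri k
  by_contra h
  rw [show tri k = 1 by omega] at h2
  simp at h2
  omega

theorem triangle_tri_pred_lt {k : ℕ} (hk : 1 ≤ k) : triangle (tri k - 1) < k := by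
  have h := two_le_tri hk
  by_contra h'
  have := tri_le (k := k) (r := tri k - 1) (by omega) (by omega)
  omega

@[simp] theorem tri_zero : tri 0 = 1 := le_antisymm (tri_le le_rfl (by simp)) (one_le_tri 0)

/-- The entry at position `i` of the co-lex smallest subexcedant sequence of weight `x`:
the entries are maximal up to some position, then comes a remainder, then zeros. -/
def minSeq (x i : ℕ) : ℕ := min (i - 1) (x - triangle (i - 1))

theorem minSeq_le (x i : ℕ) : minSeq x i ≤ i - 1 := min_le_left _ _

theorem minSeq_of_le {x i : ℕ} (h : triangle i ≤ x) : minSeq x i = i - 1 := by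
  unfold minSeq
  rcases Nat.eq_zero_or_pos i with rfl | hi
  · simp
  · rw [triangle_eq_pred hi] at h; omega

theorem minSeq_of_ge {x i : ℕ} (h : x ≤ triangle i) :
    minSeq x i = x - triangle (i - 1) := by
  unfold minSeq
  rcases Nat.eq_zero_or_pos i with rfl | hi
  · simp at h ⊢; omega
  · rw [triangle_eq_pred hi] at h; omega

theorem minSeq_eq_zero {x i : ℕ} (h : x ≤ triangle (i - 1)) : minSeq x i = 0 := by
  unfold minSeq; omega

theorem sum_minSeq (x r : ℕ) : ∑ i ∈ Finset.range (r + 1), minSeq x i = min x (triangle r) := by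
  induction r with
  | zero => simp [minSeq]
  | succ r ih =>
    rw [Finset.sum_range_succ, ih, triangle_succ, minSeq]
    simp only [Nat.add_sub_cancel]
    omega

theorem sum_le_triangle {d : ℕ → ℕ} {r : ℕ} (h : ∀ i ≤ r, d i ≤ i - 1) :
    ∑ i ∈ Finset.range (r + 1), d i ≤ triangle r := by
  induction r with
  | zero => simpa using h 0 le_rfl
  | succ r ih =>
    rw [Finset.sum_range_succ, triangle_succ]
    have := ih fun i hi => h i (by omega)
    have := h (r + 1) le_rfl
    omega

/-- A subexcedant sequence of maximal weight has all its entries maximal. -/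
theorem eq_of_sum_eq_triangle {d : ℕ → ℕ} {r : ℕ} (h : ∀ i ≤ r, d i ≤ i - 1)
    (hs : ∑ i ∈ Finset.range (r + 1), d i = triangle r) : ∀ i ≤ r, d i = i - 1 := by
  induction r with
  | zero => intro i hi; have := h i hi; omega
  | succ r ih =>
    rw [Finset.sum_range_succ, triangle_succ] at hs
    have h1 := sum_le_triangle (d := d) (r := r) fun i hi => h i (by omega)
    have h2 := h (r + 1) le_rfl
    intro i hi
    rcases Nat.lt_or_ge r i with h3 | h3
    · rw [show i = r + 1 by omega]; omega
    · exact ih (fun i hi => h i (by omega)) (by omega) i h3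

/-! ### Sums over an array with one entry increased -/

/-- The array `c` with the entry at position `i` increased by `x`. -/
def bump (c : ℕ → ℕ) (i x : ℕ) : ℕ → ℕ := Function.update c i (c i + x)

@[simp] theorem bump_self (c : ℕ → ℕ) (i x : ℕ) : bump c i x i = c i + x := by simp [bump]

@[simp] theorem bump_of_ne {c : ℕ → ℕ} {i j x : ℕ} (h : j ≠ i) : bump c i x j = c j := by
  simp [bump, h]

theorem bump_bump (c : ℕ → ℕ) (i x y : ℕ) : bump (bump c i x) i y = bump c i (x + y) := by
  simp [bump, add_assoc]

theorem sum_bump {n i : ℕ} (c : ℕ → ℕ) (x : ℕ) (h : i ≤ n) :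
    ∑ j ∈ range (n + 1), bump c i x j = ∑ j ∈ range (n + 1), c j + x := by
  have hi : i ∈ range (n + 1) := by simp; omega
  rw [← Finset.add_sum_erase _ _ hi, ← Finset.add_sum_erase (range (n + 1)) c hi, bump_self,
    Finset.sum_congr rfl fun j hj => bump_of_ne (c := c) (x := x) (Finset.ne_of_mem_erase hj)]
  omega

theorem sum_add_sum_of_eq_above {n i : ℕ} {c d : ℕ → ℕ} (h : i ≤ n) (hcd : ∀ j, i < j → d j = c j) :
    ∑ j ∈ range (n + 1), d j + ∑ j ∈ range (i + 1), c j =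
      ∑ j ∈ range (n + 1), c j + ∑ j ∈ range (i + 1), d j := by
  induction n, h using Nat.le_induction with
  | base => omega
  | succ n hn ih =>
    rw [sum_range_succ _ (n + 1), sum_range_succ _ (n + 1), hcd (n + 1) (by omega)]
    omega

theorem sum_eq_last {c : ℕ → ℕ} {r : ℕ} (h : ∀ i < r, c i = 0) :
    ∑ i ∈ range (r + 1), c i = c r := by
  rw [sum_range_succ, Finset.sum_eq_zero fun i hi => h i (by simpa using hi), zero_add]

/-! ### The recursion tree of the generating algorithm -/

/-- The remainder `e` of the algorithm: the entry of the smallest sequence of weight `k` at its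
last nonzero position `tri k`. -/
def rem (k : ℕ) : ℕ := k - (tri k - 1) * (tri k - 2) / 2

theorem rem_eq (k : ℕ) : rem k = k - triangle (tri k - 1) := rfl

/-- The outputs of `m` rounds of the ascending loop of the algorithm, from position `i` and
direction `d`. -/
def upLoop (k : ℕ) (c : ℕ → ℕ) : ℕ → ℕ → ℕ → List (ℕ → ℕ)
  | 0, _, _ => []
  | m + 1, i, d => gen1Gray (k - 1) i d (bump c i 1) ++ upLoop k c m (i + 1) ((d + 1) % 2)

/-- The outputs of `m` rounds of the descending loop of the algorithm, from position `i` and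
direction `d`. -/
def downLoop (k : ℕ) (c : ℕ → ℕ) : ℕ → ℕ → ℕ → List (ℕ → ℕ)
  | 0, _, _ => []
  | m + 1, i, d => gen1Gray (k - 1) i d (bump c i 1) ++ downLoop k c m (i - 1) ((d + 1) % 2)

theorem upLoop_eq (k : ℕ) (c : ℕ → ℕ) (m i d : ℕ) (hd : d < 2) :
    upLoop k c m i d =
      (List.range m).flatMap fun j =>
        gen1Gray (k - 1) (i + j) ((d + j) % 2) (bump c (i + j) 1) := by
  induction m generalizing i d with
  | zero => rfl
  | succ m ih =>
    rw [upLoop, ih _ _ (Nat.mod_lt _ (by norm_num)), List.range_succ_eq_map, List.flatMap_cons,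
      List.flatMap_map]
    congr 1
    · rw [Nat.add_zero, Nat.add_zero, Nat.mod_eq_of_lt hd]
    apply List.flatMap_congr
    intro j _
    rw [show i + 1 + j = i + j.succ by omega,
      show ((d + 1) % 2 + j) % 2 = (d + j.succ) % 2 by omega]

theorem downLoop_eq (k : ℕ) (c : ℕ → ℕ) (m i d : ℕ) (hd : d < 2) :
    downLoop k c m i d =
      (List.range m).flatMap fun j =>
        gen1Gray (k - 1) (i - j) ((d + j) % 2) (bump c (i - j) 1) := by
  induction m generalizing i d with
  | zero => rfl
  | succ m ih =>
    rw [downLoop, ih _ _ (Nat.mod_lt _ (by norm_num)), List.range_succ_eq_map, List.flatMap_cons,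
      List.flatMap_map]
    congr 1
    · rw [Nat.add_zero, Nat.sub_zero, Nat.mod_eq_of_lt hd]
    apply List.flatMap_congr
    intro j _
    rw [show i - 1 - j = i - j.succ by omega,
      show ((d + 1) % 2 + j) % 2 = (d + j.succ) % 2 by omega]

/-- A state of the algorithm in which a call with weight `k` and position `r` makes sense: the
weight `k` can be distributed over the positions `1, …, r`, where only `r` may already be occupied.
The entry `c 0` plays no role; since `0 - 1 = 0`, subexcedance forces it to be `0`. -/
structure Node (n k r : ℕ) (c : ℕ → ℕ) : Prop where
  le_size : r ≤ n
  zero_below : ∀ i < r, c i = 0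
  subexcedant : ∀ i, c i ≤ i - 1
  weight_le : k + c r ≤ triangle r

/-- An inner node of the recursion tree, with `r` already adjusted: position `r` is not full. -/
structure Inner (n k r : ℕ) (c : ℕ → ℕ) : Prop extends Node n k r c where
  pos : 1 ≤ k
  lt : c r + 1 < r

/-- The adjusted value of the parameter `r`: a full position `r` is skipped. -/
def adjust (r : ℕ) (c : ℕ → ℕ) : ℕ := if c r = r - 1 then r - 1 else r

theorem Inner.tri_le {n k r : ℕ} {c : ℕ → ℕ} (h : Inner n k r c) : tri k ≤ r :=
  MajGray.tri_le (by have := h.lt; omega) (by have := h.weight_le; omega)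

theorem Inner.two_le {n k r : ℕ} {c : ℕ → ℕ} (h : Inner n k r c) : 2 ≤ r := by
  have := h.lt; omega

theorem Inner.adjust_eq {n k r : ℕ} {c : ℕ → ℕ} (h : Inner n k r c) : adjust r c = r := by
  have := h.lt
  rw [adjust, if_neg (by omega)]

theorem Node.inner_adjust {n k r : ℕ} {c : ℕ → ℕ} (h : Node n k r c) (hk : 1 ≤ k) :
    Inner n k (adjust r c) c := by
  unfold adjust
  have hw := h.weight_le
  have hs := h.subexcedant r
  have hr : 2 ≤ r := by
    by_contra hr
    have := triangle_mono (show r ≤ 1 by omega)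
    simp at this
    omega
  split_ifs with hc
  · have hT : k ≤ triangle (r - 1) := by rw [triangle_eq_pred (by omega)] at hw; omega
    have h0 : c (r - 1) = 0 := h.zero_below _ (by omega)
    have := MajGray.tri_le (by omega) hT
    have := two_le_tri hk
    refine ⟨⟨by have := h.le_size; omega, fun i hi => h.zero_below i (by omega), h.subexcedant,
      by omega⟩, hk, by omega⟩
  · exact ⟨h, hk, by omega⟩

theorem Inner.weight_split {n k r : ℕ} {c : ℕ → ℕ} (h : Inner n k r c) :
    triangle (tri k - 1) + rem k = k ∧ 1 ≤ rem k ∧ rem k ≤ tri k - 1 ∧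
      k - rem k = triangle (tri k - 1) := by
  have h1 := triangle_tri_pred_lt h.pos
  have h2 := le_triangle_tri k
  rw [triangle_eq_pred (one_le_tri k)] at h2
  rw [rem_eq]
  omega

/-- The child at position `tri k` is a node. -/
theorem Inner.node_low {n k r : ℕ} {c : ℕ → ℕ} (h : Inner n k r c) :
    Node n (k - rem k) (tri k) (bump c (tri k) (rem k)) := by
  obtain ⟨h1, h2, h3, h4⟩ := h.weight_split
  have h5 := h.tri_le
  have h6 := h.le_size
  have h7 := h.weight_le
  have h8 : k + c (tri k) ≤ triangle (tri k) := by
    rcases h5.eq_or_lt with h9 | h9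
    · rw [h9]; exact h7
    · rw [h.zero_below _ h9]; exact le_triangle_tri k
  refine ⟨by omega, fun i hi => ?_, fun i => ?_, ?_⟩
  · rw [bump_of_ne (by omega)]; exact h.zero_below i (by omega)
  · by_cases hi : i = tri k
    · subst hi
      rw [bump_self]
      rw [triangle_eq_pred (one_le_tri k)] at h8
      omega
    · rw [bump_of_ne hi]; exact h.subexcedant i
  · rw [bump_self]; omega

/-- The children at the positions `i > tri k` are nodes. -/
theorem Inner.node_high {n k r i : ℕ} {c : ℕ → ℕ} (h : Inner n k r c) (hi : tri k < i)
    (hir : i ≤ r) : Node n (k - 1) i (bump c i 1) := by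
  have h1 := h.le_size
  have h2 := h.weight_le
  have h3 := h.pos
  have h4 := two_le_tri h3
  have h5 := h.lt
  have h6 : k + c i ≤ triangle i := by
    rcases hir.eq_or_lt with h9 | h9
    · rw [h9]; exact h2
    · rw [h.zero_below _ h9]
      exact (le_triangle_tri k).trans (triangle_mono hi.le)
  refine ⟨by omega, fun j hj => ?_, fun j => ?_, ?_⟩
  · rw [bump_of_ne (by omega)]; exact h.zero_below j (by omega)
  · by_cases hj : j = i
    · subst hj
      rw [bump_self]
      rcases hir.eq_or_lt with h9 | h9
      · subst h9; omega
      · rw [h.zero_below _ h9]; omega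
    · rw [bump_of_ne hj]; exact h.subexcedant j
  · rw [bump_self]; omega

theorem gen1Gray_zero (r d : ℕ) (c : ℕ → ℕ) : gen1Gray 0 r d c = [c] := by
  rw [gen1Gray]; simp

theorem gen1Gray_up {k : ℕ} (hk : 1 ≤ k) (r : ℕ) (c : ℕ → ℕ) :
    gen1Gray k r 0 c =
      gen1Gray (k - rem k) (tri k) 0 (bump c (tri k) (rem k)) ++
        upLoop k c (adjust r c - tri k) (tri k + 1) ((adjust r c - tri k) % 2) := by
  rw [gen1Gray, dif_neg (by omega), upLoop_eq _ _ _ _ _ (Nat.mod_lt _ (by norm_num))]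
  simp [rem, adjust, bump]

theorem gen1Gray_down {k : ℕ} (hk : 1 ≤ k) (r : ℕ) (c : ℕ → ℕ) :
    gen1Gray k r 1 c =
      downLoop k c (adjust r c - tri k) (adjust r c) 0 ++
        gen1Gray (k - rem k) (tri k) 1 (bump c (tri k) (rem k)) := by
  rw [gen1Gray, dif_neg (by omega), downLoop_eq _ _ _ _ _ (by norm_num)]
  simp [rem, adjust, bump]

theorem Inner.gen1Gray_adjust {n k r d : ℕ} {c : ℕ → ℕ} (h : Inner n k (adjust r c) c)
    (hd : d < 2) : gen1Gray k r d c = gen1Gray k (adjust r c) d c := by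
  obtain rfl | rfl : d = 0 ∨ d = 1 := by omega
  · rw [gen1Gray_up h.pos, gen1Gray_up h.pos (adjust r c), h.adjust_eq]
  · rw [gen1Gray_down h.pos, gen1Gray_down h.pos (adjust r c), h.adjust_eq]

/-- Induction along the recursion tree. -/
theorem Node.induction {n : ℕ} {P : ℕ → ℕ → (ℕ → ℕ) → Prop}
    (leaf : ∀ r c, Node n 0 r c → P 0 r c)
    (adj : ∀ k r c, Node n k r c → Inner n k (adjust r c) c → P k (adjust r c) c → P k r c)
    (inner : ∀ k r c, Inner n k r c →
      P (k - rem k) (tri k) (bump c (tri k) (rem k)) →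
      (∀ i, tri k < i → i ≤ r → P (k - 1) i (bump c i 1)) → P k r c)
    {k r : ℕ} {c : ℕ → ℕ} (h : Node n k r c) : P k r c := by
  induction k using Nat.strong_induction_on generalizing r c with
  | _ k ih =>
    rcases Nat.eq_zero_or_pos k with rfl | hk
    · exact leaf r c h
    · have h' := h.inner_adjust hk
      refine adj k r c h h' (inner k _ c h' (ih _ ?_ h'.node_low) fun i hi hir =>
        ih _ (by omega) (h'.node_high hi hir))
      have := h'.weight_split
      omega

/-! ### The two directions give reverse lists -/

theorem upLoop_succ_last (k : ℕ) (c : ℕ → ℕ) (m i d : ℕ) (hd : d < 2) :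
    upLoop k c (m + 1) i d =
      upLoop k c m i d ++ gen1Gray (k - 1) (i + m) ((d + m) % 2) (bump c (i + m) 1) := by
  rw [upLoop_eq _ _ _ _ _ hd, upLoop_eq _ _ _ _ _ hd, List.range_succ, List.flatMap_append]
  simp

theorem reverse_upLoop {k : ℕ} {c : ℕ → ℕ}
    (h : ∀ r d c, d < 2 → (gen1Gray (k - 1) r d c).reverse = gen1Gray (k - 1) r (1 - d) c)
    (m i d : ℕ) (hd : d < 2) :
    (upLoop k c m i d).reverse = downLoop k c m (i + m - 1) ((d + m) % 2) := by
  induction m generalizing d with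
  | zero => rfl
  | succ m ih =>
    rw [upLoop_succ_last _ _ _ _ _ hd, List.reverse_append, ih _ hd,
      h _ _ _ (Nat.mod_lt _ (by norm_num)), downLoop]
    rw [show i + (m + 1) - 1 = i + m by omega, show 1 - (d + m) % 2 = (d + (m + 1)) % 2 by omega,
      show ((d + (m + 1)) % 2 + 1) % 2 = (d + m) % 2 by omega]

theorem reverse_gen1Gray (k r d : ℕ) (c : ℕ → ℕ) (hd : d < 2) :
    (gen1Gray k r d c).reverse = gen1Gray k r (1 - d) c := by
  induction k using Nat.strong_induction_on generalizing r d c with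
  | _ k ih =>
    rcases Nat.eq_zero_or_pos k with rfl | hk
    · simp [gen1Gray_zero]
    · have hr : k - rem k < k := tri_sub_lt (by omega)
      have key : (gen1Gray k r 0 c).reverse = gen1Gray k r 1 c := by
        rw [gen1Gray_up hk, gen1Gray_down hk, List.reverse_append, ih _ hr _ _ _ (by norm_num),
          reverse_upLoop (fun r d c hd => ih (k - 1) (by omega) r d c hd) _ _ _
            (Nat.mod_lt _ (by norm_num))]
        rcases Nat.eq_zero_or_pos (adjust r c - tri k) with h0 | h0
        · rw [h0]; rfl
        · rw [show tri k + 1 + (adjust r c - tri k) - 1 = adjust r c by omega,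
            show ((adjust r c - tri k) % 2 + (adjust r c - tri k)) % 2 = 0 by omega]
      obtain rfl | rfl : d = 0 ∨ d = 1 := by omega
      · exact key
      · rw [← key, List.reverse_reverse]

/-! ### The sequences in the list -/

/-- The sequences generated below a node of the recursion tree: those obtained by distributing the
weight `k` over the positions `1, …, r` of `c`. -/
structure Below (n k r : ℕ) (c d : ℕ → ℕ) : Prop where
  eq_above : ∀ i, r < i → d i = c i
  subexcedant : ∀ i, d i ≤ i - 1
  ge : c r ≤ d r
  sum_eq : ∑ i ∈ range (n + 1), d i = k + ∑ i ∈ range (n + 1), c i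

theorem Below.sum_le {n k r : ℕ} {c d : ℕ → ℕ} (h : Below n k r c d) (hN : Node n k r c) :
    ∑ i ∈ range (r + 1), d i = k + c r := by
  have h1 := sum_add_sum_of_eq_above hN.le_size h.eq_above
  have h2 := h.sum_eq
  have h3 := sum_eq_last hN.zero_below
  omega

theorem mem_upLoop {k : ℕ} {c x : ℕ → ℕ} {m i d : ℕ} (hd : d < 2) :
    x ∈ upLoop k c m i d ↔
      ∃ j < m, x ∈ gen1Gray (k - 1) (i + j) ((d + j) % 2) (bump c (i + j) 1) := by
  rw [upLoop_eq _ _ _ _ _ hd]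
  simp

/-- The sequences below a node are those below its children: they are distinguished by the last
position that is changed, all positions up to `tri k` being covered by the first child. -/
theorem Inner.below_iff {n k r : ℕ} {c d : ℕ → ℕ} (h : Inner n k r c) :
    Below n k r c d ↔ Below n (k - rem k) (tri k) (bump c (tri k) (rem k)) d ∨
      ∃ i, tri k < i ∧ i ≤ r ∧ Below n (k - 1) i (bump c i 1) d := by
  have hw := h.weight_split
  have htri := h.tri_le
  have hrn := h.le_size
  have hk := h.pos
  constructor
  · intro hd
    by_cases hex : ∃ i, tri k < i ∧ d i ≠ c i
    · -- the child is determined by the last position that is changed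
      right
      have hbd : ∀ i, tri k < i ∧ d i ≠ c i → i ≤ r := fun i hi => by
        by_contra hr
        exact hi.2 (hd.eq_above i (by omega))
      classical
      have hspec := Nat.findGreatest_spec (P := fun i => tri k < i ∧ d i ≠ c i)
        (hbd _ hex.choose_spec) hex.choose_spec
      set i := Nat.findGreatest (fun i => tri k < i ∧ d i ≠ c i) r with hi
      have hir := hbd i hspec
      have hci : c i < d i := by
        refine lt_of_le_of_ne ?_ (Ne.symm hspec.2)
        rcases hir.eq_or_lt with h9 | h9
        · rw [h9]; exact hd.ge
        · rw [h.zero_below i h9]; omega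
      refine ⟨i, hspec.1, hir, ⟨fun j hj => ?_, hd.subexcedant, by rw [bump_self]; omega, ?_⟩⟩
      · rw [bump_of_ne (by omega)]
        by_contra hne
        have hP : tri k < j ∧ d j ≠ c j := ⟨by omega, hne⟩
        have := Nat.le_findGreatest (P := fun i => tri k < i ∧ d i ≠ c i) (hbd j hP) hP
        omega
      · rw [sum_bump _ _ (by omega), hd.sum_eq]; omega
    · left
      push Not at hex
      have h1 := sum_add_sum_of_eq_above (n := n) (by omega) hex
      have h2 := hd.sum_eq
      have h3 := sum_eq_last (c := c) (r := tri k) fun i hi => h.zero_below i (by omega)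
      have h4 := sum_le_triangle (d := d) (r := tri k - 1) fun i _ => hd.subexcedant i
      have h5 := one_le_tri k
      rw [Nat.sub_add_cancel h5] at h4
      rw [sum_range_succ d (tri k)] at h1
      refine ⟨fun i hi => ?_, hd.subexcedant, ?_, ?_⟩
      · rw [bump_of_ne (by omega)]; exact hex i hi
      · rw [bump_self]; omega
      · rw [sum_bump _ _ (by omega), hd.sum_eq]; omega
  · rintro (hd | ⟨i, hi, hir, hd⟩)
    · have h1 := hd.sum_eq
      have h2 := hd.ge
      rw [sum_bump _ _ (by omega)] at h1
      refine ⟨fun i hi => ?_, hd.subexcedant, ?_, by omega⟩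
      · rw [hd.eq_above i (by omega), bump_of_ne (by omega)]
      · rcases htri.eq_or_lt with h9 | h9
        · rw [h9, bump_self] at h2; omega
        · rw [hd.eq_above r h9, bump_of_ne (by omega)]
    · have h1 := hd.sum_eq
      have h2 := hd.ge
      rw [sum_bump _ _ (by omega)] at h1
      refine ⟨fun j hj => ?_, hd.subexcedant, ?_, by omega⟩
      · rw [hd.eq_above j (by omega), bump_of_ne (by omega)]
      · rcases hir.eq_or_lt with h9 | h9
        · rw [h9, bump_self] at h2; omega
        · rw [hd.eq_above r h9, bump_of_ne (by omega)]

theorem Node.below_adjust {n k r : ℕ} {c d : ℕ → ℕ} (h : Node n k r c) :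
    Below n k (adjust r c) c d ↔ Below n k r c d := by
  unfold adjust
  split_ifs with hc
  · have hz := h.zero_below
    constructor
    · intro hd
      refine ⟨fun i hi => hd.eq_above i (by omega), hd.subexcedant, ?_, hd.sum_eq⟩
      rcases Nat.eq_zero_or_pos r with rfl | hr
      · exact hd.ge
      · rw [hd.eq_above r (by omega)]
    · intro hd
      refine ⟨fun i hi => ?_, hd.subexcedant, ?_, hd.sum_eq⟩
      · rcases Nat.lt_or_ge r i with h1 | h1
        · exact hd.eq_above i h1
        · obtain rfl : i = r := by omega
          have := hd.ge
          have := hd.subexcedant i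
          omega
      · rcases Nat.eq_zero_or_pos r with rfl | hr
        · exact hd.ge
        · rw [hz (r - 1) (by omega)]; omega
  · rfl

/-- The list generated at a node consists of the sequences below it. -/
theorem mem_gen1Gray {n k r d : ℕ} {c x : ℕ → ℕ} (h : Node n k r c) (hd : d < 2) :
    x ∈ gen1Gray k r d c ↔ Below n k r c x := by
  suffices H : ∀ d < 2, ∀ x, x ∈ gen1Gray k r d c ↔ Below n k r c x from H d hd x
  clear hd x d
  revert h
  intro h
  refine h.induction (P := fun k r c => ∀ d < 2, ∀ x, x ∈ gen1Gray k r d c ↔ Below n k r c x)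
    ?_ ?_ ?_
  · intro r c h d _ x
    rw [gen1Gray_zero, List.mem_singleton]
    constructor
    · rintro rfl
      exact ⟨fun i _ => rfl, h.subexcedant, le_rfl, by omega⟩
    · intro hx
      have h1 := hx.sum_le h
      have h2 := hx.ge
      rw [sum_range_succ] at h1
      have h3 : ∑ i ∈ range r, x i = 0 := by omega
      funext i
      rcases lt_trichotomy i r with hi | rfl | hi
      · rw [h.zero_below i hi]
        exact (Finset.sum_eq_zero_iff.1 h3) i (by simpa using hi)
      · omega
      · exact hx.eq_above i hi
  · intro k r c h h' ih d hd x
    rw [h'.gen1Gray_adjust hd, ih d hd, h.below_adjust]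
  · intro k r c h ih1 ih2
    have key : ∀ x, x ∈ gen1Gray k r 0 c ↔ Below n k r c x := by
      intro x
      rw [gen1Gray_up h.pos, h.adjust_eq, List.mem_append, ih1 0 (by norm_num),
        mem_upLoop (Nat.mod_lt _ (by norm_num)), h.below_iff]
      refine or_congr Iff.rfl ⟨?_, ?_⟩
      · rintro ⟨j, hj, hx⟩
        exact ⟨tri k + 1 + j, by omega, by omega,
          (ih2 _ (by omega) (by omega) _ (Nat.mod_lt _ (by norm_num)) x).1 hx⟩
      · rintro ⟨i, hi, hir, hx⟩
        refine ⟨i - (tri k + 1), by omega, ?_⟩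
        rw [show tri k + 1 + (i - (tri k + 1)) = i by omega]
        exact (ih2 _ (by omega) (by omega) _ (Nat.mod_lt _ (by norm_num)) x).2 hx
    intro d hd x
    obtain rfl | rfl : d = 0 ∨ d = 1 := by omega
    · exact key x
    · rw [← key x, ← reverse_gen1Gray k r 0 c (by norm_num), List.mem_reverse]

theorem nodup_upLoop {n k r : ℕ} {c : ℕ → ℕ} (h : Inner n k r c)
    (ih : ∀ i, tri k < i → i ≤ r → ∀ d < 2, (gen1Gray (k - 1) i d (bump c i 1)).Nodup)
    (m i d : ℕ) (hd : d < 2) (hi : tri k < i) (him : i + m ≤ r + 1) :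
    (upLoop k c m i d).Nodup := by
  induction m with
  | zero => exact List.nodup_nil
  | succ m ihm =>
    rw [upLoop_succ_last _ _ _ _ _ hd, List.nodup_append']
    refine ⟨ihm (by omega), ih _ (by omega) (by omega) _ (Nat.mod_lt _ (by norm_num)), ?_⟩
    intro x hx hx'
    obtain ⟨j, hj, hx⟩ := (mem_upLoop hd).1 hx
    rw [mem_gen1Gray (h.node_high (by omega) (by omega)) (Nat.mod_lt _ (by norm_num))] at hx hx'
    have h1 := hx.eq_above (i + m) (by omega)
    have h2 := hx'.ge
    rw [bump_of_ne (by omega)] at h1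
    rw [bump_self] at h2
    omega

theorem nodup_gen1Gray {n k r d : ℕ} {c : ℕ → ℕ} (h : Node n k r c) (hd : d < 2) :
    (gen1Gray k r d c).Nodup := by
  suffices H : ∀ d < 2, (gen1Gray k r d c).Nodup from H d hd
  refine h.induction (P := fun k r c => ∀ d < 2, (gen1Gray k r d c).Nodup) ?_ ?_ ?_
  · intro r c _ d _
    rw [gen1Gray_zero]
    exact List.nodup_singleton _
  · intro k r c h h' ih d hd
    rw [h'.gen1Gray_adjust hd]
    exact ih d hd
  · intro k r c h ih1 ih2
    have key : (gen1Gray k r 0 c).Nodup := by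
      have hmod : (r - tri k) % 2 < 2 := Nat.mod_lt _ (by norm_num)
      have := h.tri_le
      rw [gen1Gray_up h.pos, h.adjust_eq, List.nodup_append']
      refine ⟨ih1 0 (by norm_num), nodup_upLoop h ih2 _ _ _ hmod (by omega) (by omega), ?_⟩
      intro x hx hx'
      obtain ⟨j, hj, hx'⟩ := (mem_upLoop hmod).1 hx'
      rw [mem_gen1Gray h.node_low (by norm_num)] at hx
      rw [mem_gen1Gray (h.node_high (by omega) (by omega)) (Nat.mod_lt _ (by norm_num))] at hx'
      have h1 := hx.eq_above (tri k + 1 + j) (by omega)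
      have h2 := hx'.ge
      rw [bump_of_ne (by omega)] at h1
      rw [bump_self] at h2
      omega
    intro d hd
    obtain rfl | rfl : d = 0 ∨ d = 1 := by omega
    · exact key
    · rw [← reverse_gen1Gray k r 0 c (by norm_num), List.nodup_reverse]
      exact key

/-! ### First and last sequence below a node -/

/-- The first sequence that direction `0` generates below a node: the weight `k` is distributed as
far to the left as possible. -/
def firstSeq (k r : ℕ) (c : ℕ → ℕ) (i : ℕ) : ℕ :=
  if i < r then minSeq k i else if i = r then c r + (k - triangle (r - 1)) else c i

/-- The last sequence that direction `0` generates below a node. At position `r` it exceeds the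
first one by `1`, unless there is only one sequence. -/
def lastSeq (k r : ℕ) (c : ℕ → ℕ) : ℕ → ℕ :=
  let r' := adjust r c
  if k = 0 then c
  else if k + c r' = triangle r' then firstSeq k r' c
  else
    let k' := min k (triangle (r' - 1)) - 1
    firstSeq k' r' (bump c r' (k - k'))

theorem minSeq_triangle {l i : ℕ} (h : i < l) : minSeq (triangle (l - 1)) i = i - 1 :=
  minSeq_of_le (triangle_mono (by omega))

theorem Inner.minSeq_below {n k r i : ℕ} {c : ℕ → ℕ} (h : Inner n k r c) (hi : i < tri k) :
    minSeq k i = i - 1 := by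
  have := h.weight_split
  exact minSeq_of_le ((triangle_mono (show i ≤ tri k - 1 by omega)).trans (by omega))

theorem minSeq_tri (k : ℕ) : minSeq k (tri k) = rem k :=
  minSeq_of_ge (le_triangle_tri k)

theorem minSeq_above_tri {k i : ℕ} (hi : tri k < i) : minSeq k i = 0 :=
  minSeq_eq_zero ((le_triangle_tri k).trans (triangle_mono (by omega)))

theorem Node.firstSeq_zero {n r : ℕ} {c : ℕ → ℕ} (h : Node n 0 r c) : firstSeq 0 r c = c := by
  funext i
  unfold firstSeq
  split_ifs with h1 h2
  · rw [h.zero_below i h1, minSeq_eq_zero (Nat.zero_le _)]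
  · subst h2; omega
  · rfl

theorem Node.firstSeq_adjust {n k r : ℕ} {c : ℕ → ℕ} (h : Node n k r c)
    (h' : Inner n k (adjust r c) c) : firstSeq k (adjust r c) c = firstSeq k r c := by
  have h1 := h'.two_le
  have h2 := h'.weight_le
  revert h1 h2
  unfold adjust
  split_ifs with hc
  · intro h1 h2
    have hz := h.zero_below (r - 1) (by omega)
    rw [hz] at h2
    funext i
    unfold firstSeq
    rcases lt_trichotomy i (r - 1) with hi | hi | hi
    · rw [if_pos hi, if_pos (by omega)]
    · rw [if_neg (by omega), if_pos hi, if_pos (by omega), hz, hi, minSeq_of_ge (by omega)]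
      omega
    · rw [if_neg (by omega), if_neg (by omega), if_neg (by omega)]
      split_ifs with h3
      · subst h3; omega
      · rfl
  · intros; rfl

theorem Inner.firstSeq_low {n k r : ℕ} {c : ℕ → ℕ} (h : Inner n k r c) :
    firstSeq (k - rem k) (tri k) (bump c (tri k) (rem k)) = firstSeq k r c := by
  obtain ⟨h1, h2, h3, h4⟩ := h.weight_split
  have h5 := h.tri_le
  have h6 : k ≤ triangle (tri k) := le_triangle_tri k
  funext i
  unfold firstSeq
  rw [h4]
  rcases lt_trichotomy i (tri k) with hi | hi | hi
  · rw [if_pos hi, if_pos (by omega), minSeq_triangle hi, h.minSeq_below hi]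
  · subst hi
    rw [if_neg (by omega), if_pos rfl, bump_self]
    rcases h5.eq_or_lt with h7 | h7
    · rw [if_neg (by omega), if_pos h7, ← h7]; omega
    · rw [if_pos h7, minSeq_tri, h.zero_below _ h7]; omega
  · rw [if_neg (by omega), if_neg (by omega), bump_of_ne (by omega)]
    split_ifs with h7 h8
    · rw [minSeq_above_tri hi, h.zero_below i h7]
    · have := triangle_mono (show tri k ≤ r - 1 by omega)
      rw [h8]; omega
    · rfl

theorem head?_gen1Gray_zero {n k r : ℕ} {c : ℕ → ℕ} (h : Node n k r c) :
    (gen1Gray k r 0 c).head? = some (firstSeq k r c) := by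
  refine h.induction (P := fun k r c => (gen1Gray k r 0 c).head? = some (firstSeq k r c)) ?_ ?_ ?_
  · intro r c h
    rw [gen1Gray_zero, h.firstSeq_zero]; rfl
  · intro k r c h h' ih
    rw [h'.gen1Gray_adjust (by norm_num), ih, h.firstSeq_adjust h']
  · intro k r c h ih _
    rw [gen1Gray_up h.pos, List.head?_append, ih, h.firstSeq_low]; rfl

theorem getLast?_gen1Gray_one {n k r : ℕ} {c : ℕ → ℕ} (h : Node n k r c) :
    (gen1Gray k r 1 c).getLast? = some (firstSeq k r c) := by
  rw [← reverse_gen1Gray k r 0 c (by norm_num), List.getLast?_reverse, head?_gen1Gray_zero h]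

/-- A node whose weight is maximal has a single sequence below it. -/
theorem Node.eq_firstSeq_of_full {n k r : ℕ} {c x : ℕ → ℕ} (h : Node n k r c)
    (hk : k + c r = triangle r) (hx : Below n k r c x) : x = firstSeq k r c := by
  have key : ∀ y, Below n k r c y → ∀ i, y i = if i ≤ r then i - 1 else c i := by
    intro y hy i
    split_ifs with hi
    · exact eq_of_sum_eq_triangle (fun i _ => hy.subexcedant i) (by rw [hy.sum_le h, hk]) i hi
    · exact hy.eq_above i (by omega)
  have h1 : Below n k r c (firstSeq k r c) := by
    rw [← mem_gen1Gray h (d := 0) (by norm_num)]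
    exact List.mem_of_mem_head? (head?_gen1Gray_zero h)
  funext i
  rw [key x hx i, key _ h1 i]

theorem Node.gen1Gray_of_full {n k r d : ℕ} {c : ℕ → ℕ} (h : Node n k r c) (hd : d < 2)
    (hk : k + c r = triangle r) : gen1Gray k r d c = [firstSeq k r c] := by
  suffices H : gen1Gray k r 0 c = [firstSeq k r c] by
    obtain rfl | rfl : d = 0 ∨ d = 1 := by omega
    · exact H
    · rw [← reverse_gen1Gray k r 0 c (by norm_num), H]; rfl
  have h1 := head?_gen1Gray_zero h
  have h2 := nodup_gen1Gray h (d := 0) (by norm_num)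
  have h3 : ∀ x ∈ gen1Gray k r 0 c, x = firstSeq k r c := fun x hx =>
    h.eq_firstSeq_of_full hk ((mem_gen1Gray h (by norm_num)).1 hx)
  generalize gen1Gray k r 0 c = L at *
  rcases L with _ | ⟨x, _ | ⟨y, L⟩⟩
  · simp at h1
  · rw [h3 x (by simp)]
  · have hx := h3 x (by simp)
    have hy := h3 y (by simp)
    simp [hx, hy] at h2

theorem Node.lastSeq_adjust {n k r : ℕ} {c : ℕ → ℕ} (h' : Inner n k (adjust r c) c) :
    lastSeq k (adjust r c) c = lastSeq k r c := by
  unfold lastSeq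
  rw [h'.adjust_eq]

theorem Inner.lastSeq_eq {n k r : ℕ} {c : ℕ → ℕ} (h : Inner n k r c)
    (hk : k + c r ≠ triangle r) : lastSeq k r c =
      firstSeq (min k (triangle (r - 1)) - 1) r
        (bump c r (k - (min k (triangle (r - 1)) - 1))) := by
  have := h.pos
  unfold lastSeq
  rw [h.adjust_eq, if_neg (by omega), if_neg hk]

theorem Inner.not_full {n k r : ℕ} {c : ℕ → ℕ} (h : Inner n k r c) (hk : k ≤ triangle (r - 1)) :
    k + c r ≠ triangle r := by
  have h1 := h.lt
  rw [triangle_eq_pred (by omega)]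
  omega

theorem Inner.lastSeq_of_le {n k r : ℕ} {c : ℕ → ℕ} (h : Inner n k r c)
    (hk : k ≤ triangle (r - 1)) : lastSeq k r c = firstSeq (k - 1) r (bump c r 1) := by
  have := h.pos
  rw [h.lastSeq_eq (h.not_full hk), min_eq_left hk, show k - (k - 1) = 1 by omega]

theorem Node.lastSeq_of_full {n k r : ℕ} {c : ℕ → ℕ} (h : Node n k r c)
    (hk : k + c r = triangle r) : lastSeq k r c = firstSeq k r c := by
  rcases Nat.eq_zero_or_pos k with rfl | hpos
  · rw [h.firstSeq_zero]; simp [lastSeq]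
  · have h' := h.inner_adjust hpos
    have h2 : k + c (adjust r c) = triangle (adjust r c) := by
      have h1 := h'.weight_le
      have h3 := h'.two_le
      revert h1 h3
      unfold adjust
      split_ifs with hc
      · intro h1 h3
        rw [triangle_eq_pred (r := r) (by omega)] at hk
        rw [h.zero_below (r - 1) (by omega)] at h1 ⊢
        omega
      · intros; exact hk
    unfold lastSeq
    rw [if_neg (by omega), if_pos h2, h.firstSeq_adjust h']

theorem Inner.getLast?_of_le {n k r : ℕ} {c : ℕ → ℕ} (h : Inner n k r c)
    (hk : tri k < r) : (gen1Gray k r 0 c).getLast? = some (lastSeq k r c) := by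
  have hT : k ≤ triangle (r - 1) := (le_triangle_tri k).trans (triangle_mono (by omega))
  obtain ⟨m, hm⟩ : ∃ m, r - tri k = m + 1 := ⟨r - tri k - 1, by omega⟩
  rw [gen1Gray_up h.pos, h.adjust_eq, hm, upLoop_succ_last _ _ _ _ _ (Nat.mod_lt _ (by norm_num)),
    show ((m + 1) % 2 + m) % 2 = 1 by omega, show tri k + 1 + m = r by omega,
    List.getLast?_append, List.getLast?_append, getLast?_gen1Gray_one (h.node_high hk le_rfl),
    h.lastSeq_of_le hT]
  rfl

theorem getLast?_gen1Gray_zero {n k r : ℕ} {c : ℕ → ℕ} (h : Node n k r c) :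
    (gen1Gray k r 0 c).getLast? = some (lastSeq k r c) := by
  rcases Nat.eq_zero_or_pos k with rfl | hpos
  · rw [gen1Gray_zero]; simp [lastSeq]
  have h' := h.inner_adjust hpos
  rw [h'.gen1Gray_adjust (by norm_num), ← Node.lastSeq_adjust h']
  revert h'
  generalize adjust r c = r
  clear h
  intro h
  rcases h.tri_le.lt_or_eq with ht | ht
  · exact h.getLast?_of_le ht
  by_cases hf : k + c r = triangle r
  · rw [h.gen1Gray_of_full (by norm_num) hf, h.lastSeq_of_full hf]; rfl
  -- the only child has its smallest position below `r`, which is the case treated above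
  have hlow := h.node_low
  obtain ⟨h1, h2, h3, h4⟩ := h.weight_split
  have hw := h.weight_le
  rw [ht] at h1 h3 h4
  rw [gen1Gray_up h.pos, h.adjust_eq, ht, Nat.sub_self, h4]
  rw [ht, h4] at hlow
  have h5 := triangle_eq_pred (show 1 ≤ r by have := h.two_le; omega)
  have h6 := h.lt
  have hpos : 1 ≤ triangle (r - 1) := by
    by_contra h7
    have h8 : triangle (r - 1 - 1) + (r - 1 - 1) = triangle (r - 1) :=
      (triangle_eq_pred (by have := h.two_le; omega)).symm
    omega
  have hin : Inner n (triangle (r - 1)) r (bump c r (rem k)) :=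
    ⟨hlow, hpos, by rw [bump_self]; omega⟩
  have hlt : tri (triangle (r - 1)) < r := by
    have := MajGray.tri_le (k := triangle (r - 1)) (r := r - 1) (by omega) le_rfl
    omega
  rw [upLoop, List.append_nil, hin.getLast?_of_le hlt, hin.lastSeq_of_le le_rfl, h.lastSeq_eq hf,
    min_eq_right (by omega), bump_bump, show rem k + 1 = k - (triangle (r - 1) - 1) by omega]

/-- The first sequence generated below a node in direction `d`; the last one is that of the
direction `1 - d`. -/
def headSeq (d k r : ℕ) (c : ℕ → ℕ) : ℕ → ℕ := if d = 0 then firstSeq k r c else lastSeq k r c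

theorem head?_gen1Gray {n k r d : ℕ} {c : ℕ → ℕ} (h : Node n k r c) (hd : d < 2) :
    (gen1Gray k r d c).head? = some (headSeq d k r c) := by
  obtain rfl | rfl : d = 0 ∨ d = 1 := by omega
  · exact head?_gen1Gray_zero h
  · rw [← reverse_gen1Gray k r 0 c (by norm_num), List.head?_reverse, getLast?_gen1Gray_zero h]
    rfl

theorem getLast?_gen1Gray {n k r d : ℕ} {c : ℕ → ℕ} (h : Node n k r c) (hd : d < 2) :
    (gen1Gray k r d c).getLast? = some (headSeq (1 - d) k r c) := by
  obtain rfl | rfl : d = 0 ∨ d = 1 := by omega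
  · exact getLast?_gen1Gray_zero h
  · exact getLast?_gen1Gray_one h

theorem headSeq_below {n k r d : ℕ} {c : ℕ → ℕ} (h : Node n k r c) (hd : d < 2) :
    Below n k r c (headSeq d k r c) := by
  rw [← mem_gen1Gray h hd]
  exact List.mem_of_mem_head? (head?_gen1Gray h hd)

theorem Node.headSeq_adjust {n k r d : ℕ} {c : ℕ → ℕ} (h : Node n k r c)
    (h' : Inner n k (adjust r c) c) : headSeq d k (adjust r c) c = headSeq d k r c := by
  unfold headSeq
  rw [h.firstSeq_adjust h', Node.lastSeq_adjust h']

/-! ### Consecutive sequences -/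

/-- `a` and `b` differ at the positions `f` and `f + 1` only, the differences `a - b` being
`(1, -1)` or `(2, -2)`; before position `f` both are smallest possible in co-lex order. -/
structure AdjTwo (n f : ℕ) (a b : ℕ → ℕ) : Prop where
  two_le : 2 ≤ f
  lt : f + 1 ≤ n
  prefix_eq : ∃ x ≤ triangle (f - 1), ∀ i < f, a i = minSeq x i
  eq_off : ∀ i, i ≠ f → i ≠ f + 1 → a i = b i
  diff : a f = b f + 1 ∧ b (f + 1) = a (f + 1) + 1 ∨ a f = b f + 2 ∧ b (f + 1) = a (f + 1) + 2

/-- `a` and `b` differ at the positions `f`, `f + 1`, `f + 2` only, the differences `a - b` being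
`(1, -2, 1)`, `(1, -3, 2)` or `(1, 0, -1)`; the entries of `a` up to position `f` are the largest
possible. -/
structure AdjThree (n f : ℕ) (a b : ℕ → ℕ) : Prop where
  two_le : 2 ≤ f
  lt : f + 2 ≤ n
  prefix_eq : ∀ i ≤ f, a i = i - 1
  eq_off : ∀ i, i ≠ f → i ≠ f + 1 → i ≠ f + 2 → a i = b i
  diff_first : b f = f - 2
  diff : b (f + 1) = a (f + 1) + 2 ∧ a (f + 2) = b (f + 2) + 1 ∨
    b (f + 1) = a (f + 1) + 3 ∧ a (f + 2) = b (f + 2) + 2 ∨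
    b (f + 1) = a (f + 1) ∧ b (f + 2) = a (f + 2) + 1

/-- The relation between consecutive sequences of the generated list; `p` is the last position
where they differ. -/
def Adj (n p : ℕ) (a b : ℕ → ℕ) : Prop :=
  ∃ f, p = f + 1 ∧ (AdjTwo n f a b ∨ AdjTwo n f b a) ∨
    p = f + 2 ∧ (AdjThree n f a b ∨ AdjThree n f b a)

theorem Adj.symm {n p : ℕ} {a b : ℕ → ℕ} (h : Adj n p a b) : Adj n p b a := by
  obtain ⟨f, h | h⟩ := h
  · exact ⟨f, Or.inl ⟨h.1, h.2.symm⟩⟩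
  · exact ⟨f, Or.inr ⟨h.1, h.2.symm⟩⟩

theorem firstSeq_of_lt {k r i : ℕ} (c : ℕ → ℕ) (h : i < r) : firstSeq k r c i = minSeq k i :=
  if_pos h

theorem firstSeq_self (k r : ℕ) (c : ℕ → ℕ) :
    firstSeq k r c r = c r + (k - triangle (r - 1)) := by simp [firstSeq]

theorem firstSeq_of_gt {k r i : ℕ} (c : ℕ → ℕ) (h : r < i) : firstSeq k r c i = c i := by
  rw [firstSeq, if_neg (by omega), if_neg (by omega)]

/-- Two sequences arising at neighbouring positions `i` and `i + 1` from the same distribution of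
a weight `x` over smaller positions. -/
theorem adjTwo_firstSeq {n x i : ℕ} {c c' : ℕ → ℕ} (hi : 2 ≤ i) (hin : i + 1 ≤ n)
    (hx : x ≤ triangle (i - 1)) {a b : ℕ → ℕ} (ha : ∀ j < i, a j = minSeq x j)
    (hb : ∀ j < i, b j = minSeq x j) (ha' : ∀ j, i + 1 < j → a j = c j)
    (hb' : ∀ j, i + 1 < j → b j = c' j) (hc : ∀ j, i + 1 < j → c j = c' j)
    (h : a i = b i + 1 ∧ b (i + 1) = a (i + 1) + 1 ∨ a i = b i + 2 ∧ b (i + 1) = a (i + 1) + 2) :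
    AdjTwo n i a b := by
  refine ⟨hi, hin, ⟨x, hx, ha⟩, fun j h1 h2 => ?_, h⟩
  rcases lt_trichotomy j i with h3 | h3 | h3
  · rw [ha j h3, hb j h3]
  · omega
  · rw [ha' j (by omega), hb' j (by omega), hc j (by omega)]

/-- The first sequences of the neighbouring children at the positions `i` and `i + 1`. -/
theorem Inner.adj_high_first {n k r i : ℕ} {c : ℕ → ℕ} (h : Inner n k r c) (hi : tri k < i)
    (hir : i + 1 ≤ r) :
    AdjTwo n i (firstSeq (k - 1) i (bump c i 1)) (firstSeq (k - 1) (i + 1) (bump c (i + 1) 1)) := by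
  have h1 := h.le_size
  have h2 := two_le_tri h.pos
  have h3 : k ≤ triangle (i - 1) := (le_triangle_tri k).trans (triangle_mono (by omega))
  have h4 : triangle (i - 1) ≤ triangle i := triangle_mono (by omega)
  refine adjTwo_firstSeq (x := k - 1) (c := c) (c' := c) (by omega) (by omega) (by omega)
    (fun j hj => ?_) (fun j hj => ?_) (fun j hj => ?_) (fun j hj => ?_) (fun _ _ => rfl) (Or.inl ?_)
  · rw [firstSeq_of_lt _ hj]
  · rw [firstSeq_of_lt _ (by omega)]
  · rw [firstSeq_of_gt _ (by omega), bump_of_ne (by omega)]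
  · rw [firstSeq_of_gt _ (by omega), bump_of_ne (by omega)]
  · rw [firstSeq_self, firstSeq_of_lt _ (by omega), firstSeq_self, firstSeq_of_gt _ (by omega),
      bump_self, bump_self, bump_of_ne (by omega), h.zero_below i (by omega),
      minSeq_eq_zero (by omega), Nat.add_sub_cancel]
    omega

/-- The last sequences of the neighbouring children at the positions `i` and `i + 1`. They differ by
two units at these positions, unless position `i + 1` is full after the first unit. -/
theorem Inner.adj_high_last {n k r i : ℕ} {c : ℕ → ℕ} (h : Inner n k r c) (hi : tri k < i)
    (hir : i + 1 ≤ r) :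
    AdjTwo n i (lastSeq (k - 1) i (bump c i 1)) (lastSeq (k - 1) (i + 1) (bump c (i + 1) 1)) := by
  have h1 := h.le_size
  have h2 := two_le_tri h.pos
  have h3 : k ≤ triangle (i - 1) := (le_triangle_tri k).trans (triangle_mono (by omega))
  have h4 : triangle (i - 1) ≤ triangle i := triangle_mono (by omega)
  have hz : ∀ j ≤ i, c j = 0 := fun j hj => h.zero_below j (by omega)
  rcases h.pos.eq_or_lt with hk | hk
  · subst hk
    have hl : ∀ r c, lastSeq (1 - 1) r c = c := fun r c => by simp [lastSeq]
    rw [hl, hl]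
    refine adjTwo_firstSeq (x := 0) (c := c) (c' := c) (by omega) (by omega) (by omega)
      (fun j hj => ?_) (fun j hj => ?_) (fun j hj => ?_) (fun j hj => ?_) (fun _ _ => rfl)
      (Or.inl ?_)
    · rw [bump_of_ne (by omega), minSeq_eq_zero (Nat.zero_le _), hz j hj.le]
    · rw [bump_of_ne (by omega), minSeq_eq_zero (Nat.zero_le _), hz j hj.le]
    · rw [bump_of_ne (by omega)]
    · rw [bump_of_ne (by omega)]
    · rw [bump_self, bump_self, bump_of_ne (by omega), bump_of_ne (by omega), hz i le_rfl]
      omega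
  · have hN := h.node_high hi (by omega)
    have hN' := h.node_high (i := i + 1) (by omega) hir
    have hI : Inner n (k - 1) i (bump c i 1) :=
      ⟨hN, by omega, by rw [bump_self, hz i le_rfl]; omega⟩
    rw [hI.lastSeq_of_le (by omega), bump_bump]
    have hI' := hN'.inner_adjust (by omega)
    rw [← Node.lastSeq_adjust hI']
    by_cases hc : bump c (i + 1) 1 (i + 1) = i + 1 - 1
    · have hadj : adjust (i + 1) (bump c (i + 1) 1) = i := by
        rw [adjust, if_pos hc, Nat.add_sub_cancel]
      rw [hadj] at hI' ⊢
      rw [hI'.lastSeq_of_le (by omega)]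
      refine adjTwo_firstSeq (x := k - 1 - 1) (c := c) (c' := c) (by omega) (by omega) (by omega)
        (fun j hj => ?_) (fun j hj => ?_) (fun j hj => ?_) (fun j hj => ?_) (fun _ _ => rfl)
        (Or.inl ?_)
      · rw [firstSeq_of_lt _ hj]
      · rw [firstSeq_of_lt _ (by omega)]
      · rw [firstSeq_of_gt _ (by omega), bump_of_ne (by omega)]
      · rw [firstSeq_of_gt _ (by omega), bump_of_ne (by omega), bump_of_ne (by omega)]
      · rw [firstSeq_self, firstSeq_self, firstSeq_of_gt _ (by omega), firstSeq_of_gt _ (by omega),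
          bump_self, bump_self, bump_of_ne (show i + 1 ≠ i by omega),
          bump_of_ne (show i + 1 ≠ i by omega), bump_of_ne (show i ≠ i + 1 by omega), bump_self,
          hz i le_rfl]
        omega
    · have hadj : adjust (i + 1) (bump c (i + 1) 1) = i + 1 := by
        rw [adjust, if_neg hc]
      rw [hadj] at hI' ⊢
      rw [hI'.lastSeq_of_le (by rw [Nat.add_sub_cancel]; omega), bump_bump]
      refine adjTwo_firstSeq (x := k - 1 - 1) (c := c) (c' := c) (by omega) (by omega) (by omega)
        (fun j hj => ?_) (fun j hj => ?_) (fun j hj => ?_) (fun j hj => ?_) (fun _ _ => rfl)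
        (Or.inr ?_)
      · rw [firstSeq_of_lt _ hj]
      · rw [firstSeq_of_lt _ (by omega)]
      · rw [firstSeq_of_gt _ (by omega), bump_of_ne (by omega)]
      · rw [firstSeq_of_gt _ (by omega), bump_of_ne (by omega)]
      · rw [firstSeq_self, firstSeq_of_lt _ (by omega), firstSeq_self, firstSeq_of_gt _ (by omega),
          bump_self, bump_self, bump_of_ne (by omega), hz i le_rfl, minSeq_eq_zero (by omega),
          Nat.add_sub_cancel]
        omega

/-- The children at `i` and `i + 1` are traversed in opposite directions, so that the sequences at
the transition between them are of the same kind, both the first or both the last ones. -/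
theorem Inner.adj_high {n k r i d : ℕ} {c : ℕ → ℕ} (h : Inner n k r c) (hi : tri k < i)
    (hir : i + 1 ≤ r) :
    Adj n (i + 1) (headSeq d (k - 1) i (bump c i 1))
      (headSeq d (k - 1) (i + 1) (bump c (i + 1) 1)) := by
  refine ⟨i, Or.inl ⟨rfl, Or.inl ?_⟩⟩
  unfold headSeq
  split_ifs
  · exact h.adj_high_first hi hir
  · exact h.adj_high_last hi hir

/-- `a` has the entries of the smallest sequence of weight `x` before position `l`, the entries
`v` and `w` at the positions `l` and `l + 1`, and the entries of `c` further on. -/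
structure Profile (c : ℕ → ℕ) (l x v w : ℕ) (a : ℕ → ℕ) : Prop where
  below : ∀ i < l, a i = minSeq x i
  fst : a l = v
  snd : a (l + 1) = w
  above : ∀ i, l + 1 < i → a i = c i

theorem Profile.adjTwo {n l x v w v' w' : ℕ} {c a b : ℕ → ℕ} (ha : Profile c l x v w a)
    (hb : Profile c l x v' w' b) (hl : 2 ≤ l) (hn : l + 1 ≤ n) (hx : x ≤ triangle (l - 1))
    (h : v = v' + 1 ∧ w' = w + 1 ∨ v = v' + 2 ∧ w' = w + 2) : AdjTwo n l a b :=
  adjTwo_firstSeq hl hn hx ha.below hb.below ha.above hb.above (fun _ _ => rfl)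
    (by rw [ha.fst, hb.fst, ha.snd, hb.snd]; exact h)

theorem Profile.adjThree {n l v w v' w' : ℕ} {c a b : ℕ → ℕ}
    (ha : Profile c l (triangle (l - 1)) v w a)
    (hb : Profile c l (triangle (l - 1) - 1) v' w' b) (hl : 3 ≤ l) (hn : l + 1 ≤ n)
    (h : v' = v + 2 ∧ w = w' + 1 ∨ v' = v + 3 ∧ w = w' + 2 ∨ v' = v ∧ w' = w + 1) :
    AdjThree n (l - 1) a b := by
  have hT : triangle (l - 1) = triangle (l - 1 - 1) + (l - 1 - 1) := triangle_eq_pred (by omega)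
  refine ⟨by omega, by omega, fun i hi => ?_, fun i h1 h2 h3 => ?_, ?_, ?_⟩
  · rw [ha.below i (by omega), minSeq_triangle (by omega)]
  · rcases Nat.lt_or_ge i l with h4 | h4
    · have := triangle_mono (show i ≤ l - 1 - 1 by omega)
      rw [ha.below i h4, hb.below i h4, minSeq_triangle (by omega), minSeq_of_le (by omega)]
    · rw [ha.above i (by omega), hb.above i (by omega)]
  · rw [hb.below _ (by omega), minSeq_of_ge (by omega)]; omega
  · rw [show l - 1 + 1 = l by omega, show l - 1 + 2 = l + 1 by omega, ha.fst, ha.snd, hb.fst,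
      hb.snd]
    exact h

/-- The last sequence of the child at `tri k`. -/
theorem Inner.profile_low {n k r : ℕ} {c : ℕ → ℕ} (h : Inner n k r c) (hr : tri k < r) :
    rem k = tri k - 1 ∧ Profile c (tri k) (triangle (tri k - 1)) (rem k) (c (tri k + 1))
        (lastSeq (k - rem k) (tri k) (bump c (tri k) (rem k))) ∨
      rem k < tri k - 1 ∧ 3 ≤ tri k ∧
        Profile c (tri k) (triangle (tri k - 1) - 1) (rem k + 1) (c (tri k + 1))
          (lastSeq (k - rem k) (tri k) (bump c (tri k) (rem k))) := by
  obtain ⟨h1, h2, h3, h4⟩ := h.weight_split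
  have hN := h.node_low
  have hz : c (tri k) = 0 := h.zero_below _ hr
  have hl := two_le_tri h.pos
  have hT : triangle (tri k) = triangle (tri k - 1) + (tri k - 1) := triangle_eq_pred (by omega)
  have hT' : triangle (tri k - 1) = triangle (tri k - 1 - 1) + (tri k - 1 - 1) :=
    triangle_eq_pred (by omega)
  rcases h3.eq_or_lt with h5 | h5
  · left
    refine ⟨h5, ?_⟩
    rw [hN.lastSeq_of_full (by rw [bump_self, hz]; omega), h.firstSeq_low]
    refine ⟨fun i hi => ?_, ?_, ?_, fun i hi => ?_⟩
    · rw [firstSeq_of_lt _ (by omega), h.minSeq_below hi, minSeq_triangle hi]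
    · rw [firstSeq_of_lt _ hr, minSeq_tri]
    all_goals
      rw [← h.firstSeq_low, firstSeq_of_gt _ (by omega), bump_of_ne (by omega)]
  · right
    refine ⟨h5, by omega, ?_⟩
    have hI : Inner n (k - rem k) (tri k) (bump c (tri k) (rem k)) :=
      ⟨hN, by omega, by rw [bump_self, hz]; omega⟩
    rw [hI.lastSeq_of_le (by omega), bump_bump, h4]
    refine ⟨fun i hi => ?_, ?_, ?_, fun i hi => ?_⟩
    · rw [firstSeq_of_lt _ hi]
    · rw [firstSeq_self, bump_self, hz]; omega
    all_goals rw [firstSeq_of_gt _ (by omega), bump_of_ne (by omega)]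

/-- The first sequence of the child at `tri k + 1`. -/
theorem Inner.profile_first {n k r : ℕ} {c : ℕ → ℕ} (h : Inner n k r c) :
    Profile c (tri k) (triangle (tri k - 1)) (rem k - 1) (c (tri k + 1) + 1)
      (firstSeq (k - 1) (tri k + 1) (bump c (tri k + 1) 1)) := by
  obtain ⟨h1, h2, h3, h4⟩ := h.weight_split
  have hl := two_le_tri h.pos
  have hk := le_triangle_tri k
  refine ⟨fun i hi => ?_, ?_, ?_, fun i hi => ?_⟩
  · have := triangle_mono (show i ≤ tri k - 1 by omega)
    rw [firstSeq_of_lt _ (by omega), minSeq_triangle hi, minSeq_of_le (by omega)]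
  · rw [firstSeq_of_lt _ (by omega), minSeq_of_ge (by omega)]; omega
  · rw [firstSeq_self, bump_self, Nat.add_sub_cancel]; omega
  · rw [firstSeq_of_gt _ (by omega), bump_of_ne (by omega)]

/-- The last sequence of the child at `tri k + 1`; the cases are that this position is full after
the first unit, or that the second unit for it is taken from position `tri k`, or from below. -/
theorem Inner.profile_last {n k r : ℕ} {c : ℕ → ℕ} (h : Inner n k r c) (hr : tri k < r)
    (hk2 : 2 ≤ k) :
    3 ≤ tri k ∧ Profile c (tri k) (triangle (tri k - 1) - 1) (rem k) (c (tri k + 1) + 1)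
        (lastSeq (k - 1) (tri k + 1) (bump c (tri k + 1) 1)) ∨
      2 ≤ rem k ∧ Profile c (tri k) (triangle (tri k - 1)) (rem k - 2) (c (tri k + 1) + 2)
        (lastSeq (k - 1) (tri k + 1) (bump c (tri k + 1) 1)) ∨
      rem k = 1 ∧ 3 ≤ tri k ∧ Profile c (tri k) (triangle (tri k - 1) - 1) 0 (c (tri k + 1) + 2)
        (lastSeq (k - 1) (tri k + 1) (bump c (tri k + 1) 1)) := by
  obtain ⟨h1, h2, h3, h4⟩ := h.weight_split
  have hl := two_le_tri h.pos
  have hk := le_triangle_tri k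
  have hz : c (tri k) = 0 := h.zero_below _ hr
  have hl3 : 3 ≤ tri k := by
    by_contra hlt
    have : tri k = 2 := by omega
    rw [this] at h1 h3
    simp at h1
    omega
  have hT : triangle (tri k) = triangle (tri k - 1) + (tri k - 1) := triangle_eq_pred (by omega)
  have hT' : triangle (tri k - 1) = triangle (tri k - 1 - 1) + (tri k - 1 - 1) :=
    triangle_eq_pred (by omega)
  have hN := h.node_high (i := tri k + 1) (by omega) hr
  have hI := hN.inner_adjust (by omega)
  rw [← Node.lastSeq_adjust hI]
  by_cases hc : bump c (tri k + 1) 1 (tri k + 1) = tri k + 1 - 1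
  · left
    refine ⟨hl3, ?_⟩
    have hadj : adjust (tri k + 1) (bump c (tri k + 1) 1) = tri k := by
      rw [adjust, if_pos hc, Nat.add_sub_cancel]
    rw [hadj] at hI ⊢
    have hb : bump c (tri k + 1) 1 (tri k) = 0 := by rw [bump_of_ne (by omega), hz]
    rw [hI.lastSeq_eq (by rw [hb]; omega), min_eq_right (by omega)]
    refine ⟨fun i hi => ?_, ?_, ?_, fun i hi => ?_⟩
    · rw [firstSeq_of_lt _ hi]
    · rw [firstSeq_self, bump_self, hb]; omega
    · rw [firstSeq_of_gt _ (by omega), bump_of_ne (by omega), bump_self]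
    · rw [firstSeq_of_gt _ (by omega), bump_of_ne (by omega), bump_of_ne (by omega)]
  · have hadj : adjust (tri k + 1) (bump c (tri k + 1) 1) = tri k + 1 := by
      rw [adjust, if_neg hc]
    rw [hadj] at hI ⊢
    rw [hI.lastSeq_of_le (by rw [Nat.add_sub_cancel]; omega), bump_bump]
    right
    by_cases hr2 : 2 ≤ rem k
    · left
      refine ⟨hr2, fun i hi => ?_, ?_, ?_, fun i hi => ?_⟩
      · have := triangle_mono (show i ≤ tri k - 1 by omega)
        rw [firstSeq_of_lt _ (by omega), minSeq_triangle hi, minSeq_of_le (by omega)]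
      · rw [firstSeq_of_lt _ (by omega), minSeq_of_ge (by omega)]; omega
      · rw [firstSeq_self, bump_self, Nat.add_sub_cancel]; omega
      · rw [firstSeq_of_gt _ (by omega), bump_of_ne (by omega)]
    · right
      refine ⟨by omega, hl3, fun i hi => ?_, ?_, ?_, fun i hi => ?_⟩
      · rw [firstSeq_of_lt _ (by omega), show k - 1 - 1 = triangle (tri k - 1) - 1 by omega]
      · rw [firstSeq_of_lt _ (by omega), minSeq_eq_zero (by omega)]
      · rw [firstSeq_self, bump_self, Nat.add_sub_cancel]; omega
      · rw [firstSeq_of_gt _ (by omega), bump_of_ne (by omega)]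

/-- The transition between the child at `tri k` and the next one. The profiles of the two sequences
decide whether two or three positions are affected. -/
theorem Inner.adj_low {n k r d : ℕ} {c : ℕ → ℕ} (h : Inner n k r c) (hr : tri k < r) :
    Adj n (tri k + 1) (lastSeq (k - rem k) (tri k) (bump c (tri k) (rem k)))
      (headSeq d (k - 1) (tri k + 1) (bump c (tri k + 1) 1)) := by
  obtain ⟨h1, h2, h3, h4⟩ := h.weight_split
  have hl := two_le_tri h.pos
  have hn : tri k + 1 ≤ n := by have := h.le_size; omega
  have hp : tri k + 1 = tri k - 1 + 2 := by omega
  -- the first sequence of the next child is as in direction `0`, or `k` is at least `2`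
  have hB : Profile c (tri k) (triangle (tri k - 1)) (rem k - 1) (c (tri k + 1) + 1)
      (headSeq d (k - 1) (tri k + 1) (bump c (tri k + 1) 1)) ∨ 2 ≤ k ∧
      headSeq d (k - 1) (tri k + 1) (bump c (tri k + 1) 1) =
        lastSeq (k - 1) (tri k + 1) (bump c (tri k + 1) 1) := by
    unfold headSeq
    split_ifs
    · exact Or.inl (h.profile_first)
    · rcases h.pos.eq_or_lt with hk | hk
      · left
        have hN := h.node_high (i := tri k + 1) (by omega) hr
        have := h.profile_first
        rw [show k - 1 = 0 by omega] at hN this ⊢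
        rw [hN.firstSeq_zero] at this
        simpa [lastSeq] using this
      · exact Or.inr ⟨hk, rfl⟩
  rcases h.profile_low hr with ⟨hrem, hA⟩ | ⟨hrem, hl3, hA⟩
  · rcases hB with hB | ⟨hk2, hB⟩
    · exact ⟨_, Or.inl ⟨rfl, Or.inl (hA.adjTwo hB hl hn le_rfl (by omega))⟩⟩
    · rw [hB]
      rcases h.profile_last hr hk2 with ⟨hl3, hB⟩ | ⟨hr2, hB⟩ | ⟨hr1, hl3, hB⟩
      · exact ⟨_, Or.inr ⟨hp, Or.inl (hA.adjThree hB hl3 hn (by omega))⟩⟩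
      · exact ⟨_, Or.inl ⟨rfl, Or.inl (hA.adjTwo hB hl hn le_rfl (by omega))⟩⟩
      · omega
  · rcases hB with hB | ⟨hk2, hB⟩
    · exact ⟨_, Or.inr ⟨hp, Or.inr (hB.adjThree hA hl3 hn (by omega))⟩⟩
    · rw [hB]
      rcases h.profile_last hr hk2 with ⟨hl3, hB⟩ | ⟨hr2, hB⟩ | ⟨hr1, hl3, hB⟩
      · exact ⟨_, Or.inl ⟨rfl, Or.inl (hA.adjTwo hB hl hn (by omega) (by omega))⟩⟩
      · exact ⟨_, Or.inr ⟨hp, Or.inr (hB.adjThree hA hl3 hn (by omega))⟩⟩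
      · exact ⟨_, Or.inl ⟨rfl, Or.inl (hA.adjTwo hB hl hn (by omega) (by omega))⟩⟩

theorem isChain_upLoop {n k r : ℕ} {c : ℕ → ℕ} (h : Inner n k r c)
    (ih : ∀ i, tri k < i → i ≤ r → ∀ d < 2,
      (gen1Gray (k - 1) i d (bump c i 1)).IsChain fun a b => ∃ p, Adj n p a b)
    (m i d : ℕ) (hd : d < 2) (hi : tri k < i) (him : i + m ≤ r + 1) :
    (upLoop k c m i d).IsChain fun a b => ∃ p, Adj n p a b := by
  induction m generalizing i d with
  | zero => exact List.isChain_nil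
  | succ m ihm =>
    have hd' : (d + 1) % 2 < 2 := Nat.mod_lt _ (by norm_num)
    rw [upLoop, List.isChain_append]
    refine ⟨ih i hi (by omega) d hd, ihm _ _ hd' (by omega) (by omega), ?_⟩
    rcases m with _ | m
    · intro x _ y hy
      simp [upLoop] at hy
    · rw [upLoop, List.head?_append, getLast?_gen1Gray (h.node_high hi (by omega)) hd,
        head?_gen1Gray (h.node_high (i := i + 1) (by omega) (by omega)) hd']
      intro x hx y hy
      simp only [Option.mem_def, Option.some.injEq, Option.some_or] at hx hy
      subst hx hy
      rw [show 1 - d = (d + 1) % 2 by omega]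
      exact ⟨_, h.adj_high hi (by omega)⟩

theorem isChain_gen1Gray {n k r d : ℕ} {c : ℕ → ℕ} (h : Node n k r c) (hd : d < 2) :
    (gen1Gray k r d c).IsChain fun a b => ∃ p, Adj n p a b := by
  suffices H : ∀ d < 2, (gen1Gray k r d c).IsChain fun a b => ∃ p, Adj n p a b from H d hd
  refine h.induction
    (P := fun k r c => ∀ d < 2, (gen1Gray k r d c).IsChain fun a b => ∃ p, Adj n p a b) ?_ ?_ ?_
  · intro r c _ d _
    rw [gen1Gray_zero]
    exact List.isChain_singleton _
  · intro k r c h h' ih d hd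
    rw [h'.gen1Gray_adjust hd]
    exact ih d hd
  · intro k r c h ih1 ih2
    have key : (gen1Gray k r 0 c).IsChain fun a b => ∃ p, Adj n p a b := by
      have hmod : (r - tri k) % 2 < 2 := Nat.mod_lt _ (by norm_num)
      have := h.tri_le
      rw [gen1Gray_up h.pos, h.adjust_eq, List.isChain_append]
      refine ⟨ih1 0 (by norm_num), isChain_upLoop h ih2 _ _ _ hmod (by omega) (by omega), ?_⟩
      rcases hm : r - tri k with _ | m
      · intro x _ y hy
        simp [upLoop] at hy
      · rw [upLoop, List.head?_append, getLast?_gen1Gray_zero h.node_low,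
          head?_gen1Gray (h.node_high (i := tri k + 1) (by omega) (by omega)) (by omega)]
        intro x hx y hy
        simp only [Option.mem_def, Option.some.injEq, Option.some_or] at hx hy
        subst hx hy
        exact ⟨_, h.adj_low (by omega)⟩
    intro d hd
    obtain rfl | rfl : d = 0 ∨ d = 1 := by omega
    · exact key
    · rw [← reverse_gen1Gray k r 0 c (by norm_num), List.isChain_reverse]
      exact key.imp fun a b ⟨p, hp⟩ => ⟨p, hp.symm⟩

/-! ### Rotations of prefixes -/

theorem cycleRange_inv_val {n : ℕ} (i x : Fin n) :
    (((Fin.cycleRange i)⁻¹ x : Fin n) : ℕ) =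
      if (x : ℕ) = 0 then (i : ℕ) else if x ≤ i then (x : ℕ) - 1 else x := by
  have key : ∀ y : Fin n, Fin.cycleRange i y = x → (Fin.cycleRange i)⁻¹ x = y := by
    rintro y rfl
    simp
  split_ifs with h0 h1
  · rw [key i]
    ext
    rw [Fin.coe_cycleRange_of_le le_rfl, if_pos rfl, h0]
  · have h2 : (⟨(x : ℕ) - 1, by omega⟩ : Fin n) < i := by
      rw [Fin.lt_def]; rw [Fin.le_def] at h1; simp; omega
    rw [key ⟨(x : ℕ) - 1, by omega⟩]
    ext
    rw [Fin.coe_cycleRange_of_lt h2]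
    simp; omega
  · rw [key x]
    exact Fin.cycleRange_of_gt (not_le.1 h1)

theorem prefixRot_zero {n : ℕ} (i : Fin n) : prefixRot i 0 = 1 := pow_zero _

theorem prefixRot_succ {n : ℕ} (i : Fin n) (k : ℕ) :
    prefixRot i (k + 1) = (Fin.cycleRange i)⁻¹ * prefixRot i k := pow_succ' _ _

theorem prefixRot_succ_left {n : ℕ} (i : Fin n) (k : ℕ) :
    prefixRot i (k + 1) = prefixRot i k * (Fin.cycleRange i)⁻¹ := pow_succ _ _

theorem prefixRot_val {n : ℕ} (i x : Fin n) (k : ℕ) (hk : k ≤ (i : ℕ) + 1) :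
    (prefixRot i k x : ℕ) = if (x : ℕ) ≤ i then (if k ≤ x then (x : ℕ) - k else x + (i + 1) - k)
      else x := by
  induction k with
  | zero => rw [prefixRot_zero]; simp
  | succ k ih =>
    rw [prefixRot_succ, Perm.mul_apply, cycleRange_inv_val]
    have ih := ih (by omega)
    simp only [Fin.le_def]
    rw [ih]
    split_ifs <;> omega

/-- The one-step identity behind an update of the permutation: a shift is moved from a prefix
to the next longer one by a transposition on the right. -/
theorem cycleRange_inv_mul_prefixRot {n i b : ℕ} (hi : i + 1 < n) (hb : b ≤ i) :
    (Fin.cycleRange ⟨i + 1, hi⟩)⁻¹ * prefixRot ⟨i, by omega⟩ b =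
      prefixRot ⟨i, by omega⟩ (b + 1) * swap ⟨i + 1, hi⟩ (⟨b, by omega⟩ : Fin n) := by
  ext x
  rw [Perm.mul_apply, Perm.mul_apply, cycleRange_inv_val, Equiv.swap_apply_def]
  simp only [Fin.le_def]
  rw [prefixRot_val _ _ _ (by simp; omega), prefixRot_val _ _ _ (by simp; omega)]
  simp only [Fin.ext_iff]
  have := x.2
  rcases lt_trichotomy (x : ℕ) (i + 1) with h | h | h
  · rcases lt_trichotomy (x : ℕ) b with h' | h' | h'
    · simp (disch := omega) only [if_pos, if_neg]; omega
    · simp (disch := omega) only [if_pos, if_neg]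
    · simp (disch := omega) only [if_pos, if_neg]; omega
  · simp (disch := omega) only [if_pos, if_neg]; omega
  · simp (disch := omega) only [if_pos, if_neg]

/-- The sequence stored in the entries `1, …, n` of an array. -/
def seqOf (n : ℕ) (a : ℕ → ℕ) : Fin n → ℕ := fun i => a (i + 1)

/-- The partial product `⟦m,aₘ⟧ ⋅ … ⋅ ⟦1,a₁⟧` in the definition of `psi`. -/
def psiUpTo (n : ℕ) (a : ℕ → ℕ) : ℕ → Perm (Fin n)
  | 0 => 1
  | m + 1 => (if h : m < n then prefixRot ⟨m, h⟩ (a (m + 1)) else 1) * psiUpTo n a m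

theorem psiUpTo_succ {n m : ℕ} (a : ℕ → ℕ) (h : m < n) :
    psiUpTo n a (m + 1) = prefixRot ⟨m, h⟩ (a (m + 1)) * psiUpTo n a m := by
  rw [psiUpTo, dif_pos h]

theorem psi_seqOf (n : ℕ) (a : ℕ → ℕ) : psi (seqOf n a) = psiUpTo n a n := by
  have h1 : ∀ m, ((List.range m).reverse.map fun m =>
      if h : m < n then prefixRot (⟨m, h⟩ : Fin n) (a (m + 1)) else 1).prod = psiUpTo n a m := by
    intro m
    induction m with
    | zero => rfl
    | succ m ih =>
      rw [List.range_succ, List.reverse_append, List.reverse_singleton, List.singleton_append,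
        List.map_cons, List.prod_cons, ih, psiUpTo]
  rw [← h1, ← List.map_coe_finRange_eq_range, ← List.map_reverse, List.map_map, psi]
  congr 1
  apply List.map_congr_left
  intro i _
  simp [seqOf]

theorem psiUpTo_apply_of_le {n m : ℕ} {a : ℕ → ℕ} (ha : ∀ i, a i ≤ i - 1) (x : Fin n)
    (hx : m ≤ x) : psiUpTo n a m x = x := by
  induction m with
  | zero => rfl
  | succ m ih =>
    have hm : m < n := by omega
    rw [psiUpTo_succ a hm, Perm.mul_apply, ih (by omega)]
    ext
    have := ha (m + 1)
    rw [prefixRot_val _ _ _ (by simp; omega), if_neg (by simp; omega)]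

/-! ### The major index of `psi t` -/

/-- One more right circular shift of the values of a prefix increases the major index by `1`: the
smallest value, at a position `q`, becomes the largest one, so that the descent before `q`
disappears and a descent after `q` arises. -/
theorem maj_cycleRange_inv_mul {n : ℕ} (i : Fin n) (τ : Perm (Fin n))
    (hfix : ∀ x, i < x → τ x = x) (hi : (τ i : ℕ) ≠ 0) :
    maj ((Fin.cycleRange i)⁻¹ * τ) = maj τ + 1 := by
  have hle : ∀ x, x ≤ i → τ x ≤ i := by
    intro x hx
    by_contra h
    have := τ.injective (hfix _ (not_le.1 h))
    rw [this] at h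
    exact h hx
  -- position `q` holds the smallest value, which becomes the largest one of the prefix
  obtain ⟨q, hq⟩ : ∃ q, τ q = ⟨0, i.pos⟩ := τ.surjective _
  have hq0 : (τ q : ℕ) = 0 := by rw [hq]
  have hqi : (q : ℕ) < i := by
    by_contra h
    rcases (not_lt.1 h).eq_or_lt with h | h
    · exact hi (by rw [show i = q from Fin.ext h]; exact hq0)
    · rw [hfix q h] at hq0; omega
  have hsum1 : ∑ j : Fin n, (if (j : ℕ) + 1 = q then (q : ℕ) else 0) = q := by
    rcases Nat.eq_zero_or_pos (q : ℕ) with h | h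
    · simp [h]
    · rw [Finset.sum_eq_single ⟨(q : ℕ) - 1, by omega⟩]
      · rw [if_pos]; simp; omega
      · intro j _ hj
        rw [if_neg]
        intro h'
        exact hj (Fin.ext (by simp; omega))
      · simp
  have hsum2 : ∑ j : Fin n, (if j = q then (q : ℕ) + 1 else 0) = q + 1 := by simp
  suffices H : maj ((Fin.cycleRange i)⁻¹ * τ) + q = maj τ + (q + 1) by omega
  conv_lhs => rw [← hsum1]
  conv_rhs => rw [← hsum2]
  unfold maj
  rw [← Finset.sum_add_distrib, ← Finset.sum_add_distrib]
  refine Finset.sum_congr rfl fun j _ => ?_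
  by_cases hj : (j : ℕ) + 1 < n
  · rw [dif_pos hj, dif_pos hj]
    set j' : Fin n := ⟨(j : ℕ) + 1, hj⟩ with hj'
    have hjv : (j' : ℕ) = j + 1 := rfl
    have hne : (τ j : ℕ) ≠ τ j' := fun h => by
      have := τ.injective (Fin.ext h)
      rw [Fin.ext_iff] at this
      omega
    have e1 : (τ j : ℕ) = 0 ↔ j = q := by
      rw [← hq0, ← Fin.ext_iff, τ.injective.eq_iff]
    have e2 : (τ j' : ℕ) = 0 ↔ (j : ℕ) + 1 = q := by
      rw [← hq0, ← Fin.ext_iff, τ.injective.eq_iff, Fin.ext_iff]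
    have l1 := hle j
    have l2 := hle j'
    simp only [Fin.le_def] at l1 l2
    simp only [Fin.lt_def, Perm.mul_apply, cycleRange_inv_val, Fin.le_def]
    rw [Fin.ext_iff] at e1
    simp only [Fin.ext_iff]
    split_ifs <;> omega
  · rw [dif_neg hj, dif_neg hj, if_neg (by omega), if_neg]
    intro h
    subst h
    omega

theorem maj_psiUpTo {n m : ℕ} {a : ℕ → ℕ} (ha : ∀ i, a i ≤ i - 1) (hm : m ≤ n) :
    maj (psiUpTo n a m) = ∑ i ∈ range (m + 1), a i := by
  induction m with
  | zero =>
    rw [show psiUpTo n a 0 = 1 from rfl, maj]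
    rw [Finset.sum_eq_zero]
    · have := ha 0
      simp; omega
    · intro i _
      by_cases h1 : (i : ℕ) + 1 < n
      · rw [dif_pos h1, if_neg]
        rw [Fin.lt_def]; simp
      · rw [dif_neg h1]
  | succ m ih =>
    rw [psiUpTo_succ a hm, sum_range_succ, ← ih (by omega)]
    have hfix : ∀ x : Fin n, m ≤ x → psiUpTo n a m x = x := fun x => psiUpTo_apply_of_le ha x
    have key : ∀ t ≤ m, maj (prefixRot ⟨m, hm⟩ t * psiUpTo n a m) = maj (psiUpTo n a m) + t := by
      intro t ht
      induction t with
      | zero => rw [prefixRot_zero]; simp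
      | succ t iht =>
        rw [prefixRot_succ, mul_assoc, maj_cycleRange_inv_mul, iht (by omega)]
        · rfl
        · intro x hx
          rw [Fin.lt_def] at hx
          simp only at hx
          rw [Perm.mul_apply, hfix x (by omega)]
          ext
          rw [prefixRot_val _ _ _ (by simp; omega), if_neg (by simp; omega)]
        · rw [Perm.mul_apply, hfix _ le_rfl, prefixRot_val _ _ _ (by simp; omega)]
          simp only [le_refl, if_true]
          rw [if_pos (by omega)]; omega
    have := ha (m + 1)
    exact key _ (by omega)

/-- The array with entries `1, …, n` given by a sequence. -/
def arrOf {n : ℕ} (t : Fin n → ℕ) : ℕ → ℕ := fun i =>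
  if h : 1 ≤ i ∧ i ≤ n then t ⟨i - 1, by omega⟩ else 0

theorem seqOf_arrOf {n : ℕ} (t : Fin n → ℕ) : seqOf n (arrOf t) = t := by
  funext i
  have := i.2
  simp only [seqOf, arrOf]
  rw [dif_pos (by omega)]
  rfl

theorem arrOf_le {n : ℕ} {t : Fin n → ℕ} (ht : ∀ i : Fin n, t i ≤ i) (i : ℕ) :
    arrOf t i ≤ i - 1 := by
  unfold arrOf
  split_ifs with h
  · exact ht _
  · omega

theorem sum_seqOf (n : ℕ) {a : ℕ → ℕ} (h0 : a 0 = 0) :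
    ∑ i, seqOf n a i = ∑ i ∈ range (n + 1), a i := by
  rw [Finset.sum_range_succ', h0, add_zero, ← Fin.sum_univ_eq_sum_range (fun i => a (i + 1))]
  rfl

theorem maj_psi_seqOf {n : ℕ} {a : ℕ → ℕ} (ha : ∀ i, a i ≤ i - 1) :
    maj (psi (seqOf n a)) = ∑ i, seqOf n a i := by
  rw [psi_seqOf, maj_psiUpTo ha le_rfl, sum_seqOf]
  have := ha 0
  omega

theorem maj_psi {n : ℕ} {t : Fin n → ℕ} (ht : ∀ i : Fin n, t i ≤ i) : maj (psi t) = ∑ i, t i := by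
  have := maj_psi_seqOf (n := n) (arrOf_le ht)
  rwa [seqOf_arrOf] at this

theorem psiUpTo_injective {n m : ℕ} {a b : ℕ → ℕ} (ha : ∀ i, a i ≤ i - 1) (hb : ∀ i, b i ≤ i - 1)
    (hm : m ≤ n) (h : psiUpTo n a m = psiUpTo n b m) : ∀ i ≤ m, a i = b i := by
  induction m with
  | zero => intro i hi; have := ha i; have := hb i; omega
  | succ m ih =>
    rw [psiUpTo_succ a hm, psiUpTo_succ b hm] at h
    have h1 := ha (m + 1)
    have h2 := hb (m + 1)
    have h3 : a (m + 1) = b (m + 1) := by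
      have := congrArg (fun σ : Perm (Fin n) => (σ ⟨m, hm⟩ : ℕ)) h
      simp only [Perm.mul_apply] at this
      rw [psiUpTo_apply_of_le ha ⟨m, hm⟩ le_rfl, psiUpTo_apply_of_le hb ⟨m, hm⟩ le_rfl,
        prefixRot_val _ _ _ (by simp; omega), prefixRot_val _ _ _ (by simp; omega)] at this
      simp only [le_refl, if_true] at this
      rw [if_pos (by omega), if_pos (by omega)] at this
      omega
    rw [h3] at h
    intro i hi
    rcases hi.eq_or_lt with rfl | hi
    · exact h3
    · exact ih (by omega) (mul_left_cancel h) i (by omega)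

theorem psi_injOn (n : ℕ) : Set.InjOn (psi (n := n)) {t | ∀ i : Fin n, t i ≤ i} := by
  intro s hs t ht h
  rw [← seqOf_arrOf s, ← seqOf_arrOf t, psi_seqOf, psi_seqOf] at h
  have := psiUpTo_injective (arrOf_le hs) (arrOf_le ht) le_rfl h
  rw [← seqOf_arrOf s, ← seqOf_arrOf t]
  funext i
  exact this _ i.2

/-- Every permutation has a code, since there are `n!` subexcedant sequences. -/
theorem psi_surj {n : ℕ} (π : Perm (Fin n)) : ∃ t : Fin n → ℕ, (∀ i, t i ≤ i) ∧ psi t = π := by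
  let F : (∀ i : Fin n, Fin ((i : ℕ) + 1)) → Perm (Fin n) := fun t => psi fun i => (t i : ℕ)
  have hinj : Function.Injective F := by
    intro s t h
    have := psi_injOn n (x₁ := fun i => (s i : ℕ)) (x₂ := fun i => (t i : ℕ))
      (fun i => Nat.lt_succ_iff.1 (s i).2) (fun i => Nat.lt_succ_iff.1 (t i).2) h
    funext i
    exact Fin.ext (congrFun this i)
  have hcard : Fintype.card (∀ i : Fin n, Fin ((i : ℕ) + 1)) = Fintype.card (Perm (Fin n)) := by
    rw [Fintype.card_perm, Fintype.card_pi, Fintype.card_fin]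
    simp only [Fintype.card_fin]
    rw [Fin.prod_univ_eq_prod_range (fun i => i + 1), Finset.prod_range_add_one_eq_factorial]
  obtain ⟨t, ht⟩ := ((Fintype.bijective_iff_injective_and_card F).2 ⟨hinj, hcard⟩).2 π
  exact ⟨fun i => t i, fun i => Nat.lt_succ_iff.1 (t i).2, ht⟩

theorem psi_bijOn (n k : ℕ) : Set.BijOn (psi (n := n)) (S k n) {π | maj π = k} := by
  refine ⟨fun t ht => ?_, (psi_injOn n).mono fun t ht => ht.1, fun π hπ => ?_⟩
  · exact (maj_psi ht.1).trans ht.2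
  · obtain ⟨t, ht, rfl⟩ := psi_surj π
    exact ⟨t, ⟨ht, (maj_psi ht).symm.trans hπ⟩, rfl⟩

/-! ### Updating a permutation by transpositions -/

/-- The map `φ_j` of the update procedure, for the value `s` of the entry at position `j`. -/
def phi (j s i : ℕ) : ℕ :=
  if 1 ≤ i ∧ i + (s + 1) ≤ j then j - s - i else if i ≤ j then 2 * j - s - i else i

/-- If all entries are maximal, the partial product reverses the prefix. -/
theorem psiUpTo_full {n m : ℕ} {a : ℕ → ℕ} (hm : m ≤ n) (ha : ∀ i ≤ m, a i = i - 1) (y : Fin n) :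
    (psiUpTo n a m y : ℕ) = if (y : ℕ) < m then m - 1 - y else y := by
  induction m with
  | zero => simp [psiUpTo]
  | succ m ih =>
    have ih := ih (by omega) fun i hi => ha i (by omega)
    rw [psiUpTo_succ a hm, Perm.mul_apply, ha _ le_rfl, prefixRot_val _ _ _ (by simp), ih]
    simp only [Nat.add_sub_cancel]
    split_ifs <;> omega

theorem psiUpTo_of_zero {n j m : ℕ} {a : ℕ → ℕ} (hj : j ≤ m) (hm : m ≤ n)
    (ha : ∀ i, j < i → i ≤ m → a i = 0) : psiUpTo n a m = psiUpTo n a j := by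
  induction m, hj using Nat.le_induction with
  | base => rfl
  | succ m hj ih =>
    rw [psiUpTo_succ a hm, ha _ (by omega) le_rfl, prefixRot_zero, one_mul,
      ih (by omega) fun i h1 h2 => ha i h1 (by omega)]

/-- On a prefix whose entries are smallest possible in co-lex order, the partial product is the
involution `phi`. -/
theorem psiUpTo_minSeq {n m x : ℕ} {a : ℕ → ℕ} (hm : m ≤ n) (hx : tri x ≤ m)
    (ha : ∀ i ≤ m, a i = minSeq x i) (y : Fin n) :
    (psiUpTo n a m y : ℕ) + 1 = phi (tri x) (a (tri x)) (y + 1) := by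
  have hj := one_le_tri x
  have hxj := le_triangle_tri x
  have hbelow : ∀ i ≤ tri x - 1, a i = i - 1 := by
    intro i hi
    rw [ha i (by omega)]
    rcases Nat.eq_zero_or_pos x with rfl | hx0
    · have : i = 0 := by simp at hi; exact hi
      subst this; simp [minSeq]
    · have := triangle_tri_pred_lt hx0
      exact minSeq_of_le ((triangle_mono hi).trans (by omega))
  rw [psiUpTo_of_zero hx hm fun i h1 h2 => by rw [ha i h2, minSeq_above_tri h1]]
  obtain ⟨j, hj'⟩ : ∃ j, tri x = j + 1 := ⟨tri x - 1, by omega⟩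
  have hs : a (tri x) ≤ j := by
    rw [ha _ hx]
    have := minSeq_le x (tri x)
    omega
  rw [hj'] at hs hbelow ⊢
  rw [psiUpTo_succ a (show j < n by omega), Perm.mul_apply, prefixRot_val _ _ _ (by simp; omega),
    psiUpTo_full (by omega) fun i hi => hbelow i (by omega)]
  unfold phi
  simp only
  split_ifs <;> omega

/-- `b` is obtained from `a` by moving one unit from position `f` to position `f + 1`, the entries
before position `f` forming the smallest sequence of weight `x`. -/
structure Move (n f x : ℕ) (a b : ℕ → ℕ) : Prop where
  two_le : 2 ≤ f
  lt : f + 1 ≤ n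
  le_triangle : x ≤ triangle (f - 1)
  prefix_eq : ∀ i < f, a i = minSeq x i
  eq_off : ∀ i, i ≠ f → i ≠ f + 1 → b i = a i
  fst : a f = b f + 1
  snd : b (f + 1) = a (f + 1) + 1
  le : a f ≤ f

theorem Move.tri_lt {n f x : ℕ} {a b : ℕ → ℕ} (h : Move n f x a b) : tri x < f := by
  have := tri_le (by have := h.two_le; omega) h.le_triangle
  have := h.two_le
  omega

theorem psiUpTo_congr {n m : ℕ} {a b : ℕ → ℕ} (h : ∀ i, 1 ≤ i → i ≤ m → a i = b i) :
    psiUpTo n a m = psiUpTo n b m := by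
  induction m with
  | zero => rfl
  | succ m ih =>
    rw [psiUpTo, psiUpTo, ih fun i h1 h2 => h i h1 (by omega), h (m + 1) (by omega) le_rfl]

/-- A move of one unit is a multiplication by a transposition. By `cycleRange_inv_mul_prefixRot`,
this transposition stands to the left of the partial product over the prefix; taking it to the right
conjugates it by this partial product, which is the involution `phi`. -/
theorem Move.psi_eq {n f x : ℕ} {a b : ℕ → ℕ} (h : Move n f x a b) :
    ∃ y z : Fin n, y ≠ z ∧ (y : ℕ) + 1 = phi (tri x) (a (tri x)) (f + 1) ∧
      (z : ℕ) + 1 = phi (tri x) (a (tri x)) (a f) ∧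
      psi (seqOf n b) = psi (seqOf n a) * swap y z := by
  have htri := h.tri_lt
  have h2 := h.two_le
  have hlt := h.lt
  have hle := h.le
  have hfst := h.fst
  obtain ⟨i, rfl⟩ : ∃ i, f = i + 1 := ⟨f - 1, by omega⟩
  have hi : i + 1 < n := by omega
  have hP := psiUpTo_minSeq (n := n) (m := i) (x := x) (a := a) (by omega) (by omega)
    fun j hj => h.prefix_eq j (by omega)
  set P := psiUpTo n a i with hPdef
  -- the partial product is an involution
  have hinv : ∀ v, P (P v) = v := by
    intro v
    have h3 := hP v
    have h4 := hP (P v)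
    have h5 := minSeq_le x (tri x)
    rw [← h.prefix_eq _ htri] at h5
    have h6 := one_le_tri x
    rw [h3] at h4
    ext
    unfold phi at h4
    split_ifs at h4 <;> omega
  set u : Fin n := ⟨i + 1, hi⟩ with hu
  set v : Fin n := ⟨b (i + 1), by omega⟩ with hv
  have hPinv : P⁻¹ = P := by
    ext w
    rw [Perm.inv_eq_iff_eq.2 (hinv w).symm]
  refine ⟨P u, P v, fun huv => ?_, ?_, ?_, ?_⟩
  · have := P.injective huv
    rw [hu, hv, Fin.mk.injEq] at this
    omega
  · rw [hP]
  · rw [hP, h.fst]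
  · have key : psiUpTo n b (i + 2) = psiUpTo n a (i + 2) * swap (P u) (P v) := by
      rw [psiUpTo_succ b (show i + 1 < n from hi), psiUpTo_succ b (show i < n by omega),
        psiUpTo_succ a (show i + 1 < n from hi), psiUpTo_succ a (show i < n by omega),
        psiUpTo_congr (a := b) (b := a) fun j _ hj => h.eq_off j (by omega) (by omega), h.snd,
        h.fst, prefixRot_succ_left, ← hPdef]
      have h3 : swap u v * P = P * swap (P u) (P v) := by
        rw [Equiv.swap_mul_eq_mul_swap, hPinv]
      simp only [mul_assoc]
      rw [← h3, ← mul_assoc (prefixRot _ _) (swap u v) P,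
        ← cycleRange_inv_mul_prefixRot hi (show b (i + 1) ≤ i by omega), mul_assoc]
    have key2 : ∀ m, i + 2 ≤ m → m ≤ n →
        psiUpTo n b m = psiUpTo n a m * swap (P u) (P v) := by
      intro m hm
      induction m, hm using Nat.le_induction with
      | base => intro _; exact key
      | succ m hm ih =>
        intro hmn
        rw [psiUpTo_succ a hmn, psiUpTo_succ b hmn, ih (by omega),
          h.eq_off _ (by omega) (by omega), mul_assoc]
    rw [psi_seqOf, psi_seqOf]
    exact key2 n (by omega) le_rfl

/-- The array obtained by moving one unit from position `f` to position `f + 1`. -/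
def moveUp (f : ℕ) (a : ℕ → ℕ) : ℕ → ℕ :=
  Function.update (Function.update a f (a f - 1)) (f + 1) (a (f + 1) + 1)

/-- The array obtained by moving one unit from position `f + 1` to position `f`. -/
def moveDown (f : ℕ) (a : ℕ → ℕ) : ℕ → ℕ :=
  Function.update (Function.update a f (a f + 1)) (f + 1) (a (f + 1) - 1)

theorem moveUp_fst (f : ℕ) (a : ℕ → ℕ) : moveUp f a f = a f - 1 := by simp [moveUp]

theorem moveUp_snd (f : ℕ) (a : ℕ → ℕ) : moveUp f a (f + 1) = a (f + 1) + 1 := by simp [moveUp]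

theorem moveUp_off {f i : ℕ} (a : ℕ → ℕ) (h1 : i ≠ f) (h2 : i ≠ f + 1) : moveUp f a i = a i := by
  simp [moveUp, h1, h2]

theorem moveDown_fst (f : ℕ) (a : ℕ → ℕ) : moveDown f a f = a f + 1 := by simp [moveDown]

theorem moveDown_snd (f : ℕ) (a : ℕ → ℕ) : moveDown f a (f + 1) = a (f + 1) - 1 := by
  simp [moveDown]

theorem moveDown_off {f i : ℕ} (a : ℕ → ℕ) (h1 : i ≠ f) (h2 : i ≠ f + 1) :
    moveDown f a i = a i := by
  simp [moveDown, h1, h2]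

/-- `Step n v f x a b` is a call `transp(v, f, x)` of the update procedure that turns `a` into
`b`. -/
def Step (n : ℕ) (v : ℤ) (f x : ℕ) (a b : ℕ → ℕ) : Prop :=
  v = 1 ∧ Move n f x a b ∨ v = -1 ∧ Move n f x b a

theorem Step.exists_isSwap {n : ℕ} {v : ℤ} {f x : ℕ} {a b : ℕ → ℕ} (h : Step n v f x a b) :
    ∃ g : Perm (Fin n), g.IsSwap ∧ psi (seqOf n b) = psi (seqOf n a) * g := by
  rcases h with ⟨_, h⟩ | ⟨_, h⟩
  all_goals
    obtain ⟨y, z, hyz, _, _, h⟩ := h.psi_eq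
    refine ⟨swap y z, ⟨y, z, hyz, rfl⟩, ?_⟩
    rw [h]
  rw [mul_assoc, Equiv.swap_mul_self, mul_one]

/-- The calls of `transp` that lead from `a` to a neighbour `b` with `p = f + 1`; `x` is the weight
before position `f`. -/
theorem AdjTwo.steps {n f : ℕ} {a b : ℕ → ℕ} (ha : ∀ i, a i ≤ i - 1)
    (h : AdjTwo n f a b) :
    (a f = b f + 1 ∧ b (f + 1) = a (f + 1) + 1 ∧
      ∃ x, x = ∑ i ∈ range f, a i ∧ Step n 1 f x a b ∧ Step n (-1) f x b a) ∨
    (a f = b f + 2 ∧ b (f + 1) = a (f + 1) + 2 ∧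
      ∃ x, x = ∑ i ∈ range f, a i ∧
        (Step n 1 f x a (moveUp f a) ∧ Step n 1 f x (moveUp f a) b) ∧
        Step n (-1) f x b (moveDown f b) ∧ Step n (-1) f x (moveDown f b) a) := by
  obtain ⟨x, hx, hpre⟩ := h.prefix_eq
  have h2 := h.two_le
  have haf := ha f
  have hlt := h.lt
  have hsum : x = ∑ i ∈ range f, a i := by
    obtain ⟨g, rfl⟩ : ∃ g, f = g + 1 := ⟨f - 1, by omega⟩
    rw [Finset.sum_congr rfl fun i hi => hpre i (Finset.mem_range.1 hi), sum_minSeq]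
    simp at hx
    omega
  rcases h.diff with ⟨h3, h4⟩ | ⟨h3, h4⟩
  · have hM : Move n f x a b :=
      ⟨h2, h.lt, hx, hpre, fun i h1 h2 => (h.eq_off i h1 h2).symm, h3, h4, by omega⟩
    exact Or.inl ⟨h3, h4, x, hsum, Or.inl ⟨rfl, hM⟩, Or.inr ⟨rfl, hM⟩⟩
  · right
    refine ⟨h3, h4, x, hsum, ⟨Or.inl ⟨rfl, ?_⟩, Or.inl ⟨rfl, ?_⟩⟩, Or.inr ⟨rfl, ?_⟩,
      Or.inr ⟨rfl, ?_⟩⟩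
    · exact ⟨h2, h.lt, hx, hpre, fun i h1 h2 => moveUp_off a h1 h2,
        by rw [moveUp_fst]; omega, by rw [moveUp_snd], by omega⟩
    · exact ⟨h2, h.lt, hx, fun i hi => by rw [moveUp_off a (by omega) (by omega), hpre i hi],
        fun i h1 h2 => by rw [moveUp_off a h1 h2, h.eq_off i h1 h2],
        by rw [moveUp_fst]; omega, by rw [moveUp_snd]; omega, by rw [moveUp_fst]; omega⟩
    · exact ⟨h2, h.lt, hx, fun i hi => by
          rw [moveDown_off b (by omega) (by omega), ← h.eq_off i (by omega) (by omega), hpre i hi],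
        fun i h1 h2 => by rw [moveDown_off b h1 h2],
        by rw [moveDown_fst], by rw [moveDown_snd]; omega, by rw [moveDown_fst]; omega⟩
    · exact ⟨h2, h.lt, hx, hpre, fun i h1 h2 => by
          rw [moveDown_off b h1 h2, h.eq_off i h1 h2],
        by rw [moveDown_fst]; omega, by rw [moveDown_snd]; omega, by omega⟩

theorem AdjThree.sum_eq {n f : ℕ} {a b : ℕ → ℕ} (h : AdjThree n f a b) :
    ∑ i ∈ range f, a i = triangle (f - 1) := by
  have h2 := h.two_le
  obtain ⟨g, rfl⟩ : ∃ g, f = g + 1 := ⟨f - 1, by omega⟩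
  rw [Finset.sum_congr rfl fun i hi => (h.prefix_eq i (by simp at hi; omega)).trans
    (minSeq_triangle (l := g + 1) (by simpa using hi)).symm, sum_minSeq]
  simp

/-- The first and last call of `transp` that act between neighbours with `p = f + 2` act on a
prefix of the form required by a move. -/
theorem AdjThree.prefix_move {n f : ℕ} {a b : ℕ → ℕ} (h : AdjThree n f a b) :
    (∀ i < f + 1, a i = minSeq (triangle f) i) ∧
      ∀ i < f + 1, b i = minSeq (triangle (f - 1) + (f - 2)) i := by
  have h2 := h.two_le
  constructor
  · intro i hi
    rw [h.prefix_eq i (by omega)]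
    exact (minSeq_triangle (l := f + 1) hi).symm
  · intro i hi
    rcases (Nat.lt_succ_iff.1 hi).eq_or_lt with rfl | hi
    · rw [h.diff_first, minSeq, Nat.add_sub_cancel_left]; omega
    · rw [← h.eq_off i (by omega) (by omega) (by omega), h.prefix_eq i (by omega)]
      exact (minSeq_of_le ((triangle_mono (show i ≤ f - 1 by omega)).trans (by omega))).symm

/-- The calls of `transp` that lead from `a` to a neighbour `b` with `p = f + 2`, and back. -/
theorem AdjThree.steps {n f : ℕ} {a b : ℕ → ℕ} (ha : ∀ i, a i ≤ i - 1) (hb : ∀ i, b i ≤ i - 1)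
    (h : AdjThree n f a b) :
    (b (f + 1) = a (f + 1) + 2 ∧ a (f + 2) = b (f + 2) + 1 ∧
      (Step n 1 f (triangle (f - 1)) a (moveUp f a) ∧
        Step n (-1) (f + 1) (triangle (f - 1) + (f - 2)) (moveUp f a) b) ∧
      Step n (-1) f (triangle (f - 1)) b (moveDown f b) ∧
        Step n 1 (f + 1) (triangle f) (moveDown f b) a) ∨
    (b (f + 1) = a (f + 1) + 3 ∧ a (f + 2) = b (f + 2) + 2 ∧
      (Step n 1 f (triangle (f - 1)) a (moveUp f a) ∧
        Step n (-1) (f + 1) (triangle (f - 1) + (f - 2)) (moveUp f a)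
          (moveDown (f + 1) (moveUp f a)) ∧
        Step n (-1) (f + 1) (triangle (f - 1) + (f - 2)) (moveDown (f + 1) (moveUp f a)) b) ∧
      Step n (-1) f (triangle (f - 1)) b (moveDown f b) ∧
        Step n 1 (f + 1) (triangle f) (moveDown f b) (moveUp (f + 1) (moveDown f b)) ∧
        Step n 1 (f + 1) (triangle f) (moveUp (f + 1) (moveDown f b)) a) ∨
    (b (f + 1) = a (f + 1) ∧ b (f + 2) = a (f + 2) + 1 ∧
      (Step n 1 f (triangle (f - 1)) a (moveUp f a) ∧
        Step n 1 (f + 1) (triangle (f - 1) + (f - 2)) (moveUp f a) b) ∧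
      Step n (-1) (f + 1) (triangle (f - 1) + (f - 2)) b (moveDown (f + 1) b) ∧
        Step n (-1) f (triangle (f - 1)) (moveDown (f + 1) b) a) := by
  have h2 := h.two_le
  have hlt := h.lt
  have haf : a f = f - 1 := h.prefix_eq f le_rfl
  have hbf := h.diff_first
  have ha1 := ha (f + 1)
  have hb1 := hb (f + 1)
  obtain ⟨hpa, hpb⟩ := h.prefix_move
  have hT : triangle (f + 1 - 1) = triangle (f - 1) + (f - 1) := by
    rw [Nat.add_sub_cancel]; exact triangle_eq_pred (by omega)
  have hT' : triangle f = triangle (f - 1) + (f - 1) := triangle_eq_pred (by omega)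
  -- the prefix before position `f` is full in both sequences
  have hpa' : ∀ i < f, a i = minSeq (triangle (f - 1)) i := fun i hi => by
    rw [minSeq_triangle hi, h.prefix_eq i hi.le]
  have hpb' : ∀ i < f, b i = minSeq (triangle (f - 1)) i := fun i hi => by
    rw [← h.eq_off i (by omega) (by omega) (by omega), hpa' i hi]
  have hoff := h.eq_off
  have hM1 : Move n f (triangle (f - 1)) a (moveUp f a) :=
    ⟨h2, by omega, le_rfl, hpa', fun i h1 h2 => moveUp_off a h1 h2, by rw [moveUp_fst]; omega,
      by rw [moveUp_snd], by omega⟩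
  -- the intermediate arrays agree with the final ones up to position `f`
  have hup : ∀ i < f + 1, moveUp f a i = b i := fun i hi => by
    rcases (Nat.lt_succ_iff.1 hi).eq_or_lt with rfl | hi
    · rw [moveUp_fst]; omega
    · rw [moveUp_off a (by omega) (by omega), hoff i (by omega) (by omega) (by omega)]
  have hdown : ∀ i < f + 1, moveDown f b i = a i := fun i hi => by
    rcases (Nat.lt_succ_iff.1 hi).eq_or_lt with rfl | hi
    · rw [moveDown_fst]; omega
    · rw [moveDown_off b (by omega) (by omega), hoff i (by omega) (by omega) (by omega)]
  have hup1 : moveUp f a (f + 1) = a (f + 1) + 1 := moveUp_snd f a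
  have hup2 : moveUp f a (f + 2) = a (f + 2) := moveUp_off a (by omega) (by omega)
  have hdown1 : moveDown f b (f + 1) = b (f + 1) - 1 := moveDown_snd f b
  have hdown2 : moveDown f b (f + 2) = b (f + 2) := moveDown_off b (by omega) (by omega)
  have hupoff : ∀ i, i ≠ f + 1 → i ≠ f + 2 → moveUp f a i = b i := fun i h1 h2 => by
    rcases Nat.lt_or_ge i (f + 1) with h3 | h3
    · exact hup i h3
    · rw [moveUp_off a (by omega) (by omega), hoff i (by omega) (by omega) (by omega)]
  have hdownoff : ∀ i, i ≠ f + 1 → i ≠ f + 2 → moveDown f b i = a i := fun i h1 h2 => by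
    rcases Nat.lt_or_ge i (f + 1) with h3 | h3
    · exact hdown i h3
    · rw [moveDown_off b (by omega) (by omega), hoff i (by omega) (by omega) (by omega)]
  have hM2 : 1 ≤ b (f + 1) → Move n f (triangle (f - 1)) (moveDown f b) b := fun h1 =>
    ⟨h2, by omega, le_rfl, fun i hi => by rw [hdown i (by omega), hpa' i hi],
      fun i h1 h2 => (moveDown_off b h1 h2).symm, moveDown_fst f b, by omega,
      by rw [moveDown_fst]; omega⟩
  rcases h.diff with ⟨h3, h4⟩ | ⟨h3, h4⟩ | ⟨h3, h4⟩
  · left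
    refine ⟨h3, h4, ⟨Or.inl ⟨rfl, hM1⟩, Or.inr ⟨rfl, ?_⟩⟩, Or.inr ⟨rfl, hM2 (by omega)⟩,
      Or.inl ⟨rfl, ?_⟩⟩
    · exact ⟨by omega, by omega, by omega, hpb, fun i h1 h2 => hupoff i h1 h2, by omega, by
        rw [show f + 1 + 1 = f + 2 by omega]; omega, by omega⟩
    · exact ⟨by omega, by omega, by omega, fun i hi => by rw [hdown i hi, hpa i hi],
        fun i h1 h2 => (hdownoff i h1 h2).symm, by omega, by
        rw [show f + 1 + 1 = f + 2 by omega]; omega, by omega⟩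
  · right; left
    refine ⟨h3, h4, ⟨Or.inl ⟨rfl, hM1⟩, Or.inr ⟨rfl, ?_⟩, Or.inr ⟨rfl, ?_⟩⟩,
      Or.inr ⟨rfl, hM2 (by omega)⟩, Or.inl ⟨rfl, ?_⟩, Or.inl ⟨rfl, ?_⟩⟩
    · refine ⟨by omega, by omega, by omega, fun i hi => ?_, fun i h1 h2 => ?_, ?_, ?_, ?_⟩
      · rw [moveDown_off _ (by omega) (by omega), hup i hi, hpb i hi]
      · rw [moveDown_off _ h1 h2]
      · rw [moveDown_fst]
      · rw [moveDown_snd, show f + 1 + 1 = f + 2 by omega]; omega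
      · rw [moveDown_fst]; omega
    · refine ⟨by omega, by omega, by omega, hpb, fun i h1 h2 => ?_, ?_, ?_, by omega⟩
      · rw [moveDown_off _ h1 h2, hupoff i h1 h2]
      · rw [moveDown_fst]; omega
      · rw [moveDown_snd, show f + 1 + 1 = f + 2 by omega]; omega
    · refine ⟨by omega, by omega, by omega, fun i hi => by rw [hdown i hi, hpa i hi],
        fun i h1 h2 => ?_, ?_, ?_, by omega⟩
      · rw [moveUp_off _ h1 h2]
      · rw [moveUp_fst]; omega
      · rw [moveUp_snd]
    · refine ⟨by omega, by omega, by omega, fun i hi => ?_, fun i h1 h2 => ?_, ?_, ?_, ?_⟩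
      · rw [moveUp_off _ (by omega) (by omega), hdown i hi, hpa i hi]
      · rw [moveUp_off _ h1 h2, hdownoff i h1 h2]
      · rw [moveUp_fst]; omega
      · rw [moveUp_snd, show f + 1 + 1 = f + 2 by omega]; omega
      · rw [moveUp_fst]; omega
  · right; right
    refine ⟨h3, h4, ⟨Or.inl ⟨rfl, hM1⟩, Or.inl ⟨rfl, ?_⟩⟩, Or.inr ⟨rfl, ?_⟩, Or.inr ⟨rfl, ?_⟩⟩
    · exact ⟨by omega, by omega, by omega, fun i hi => by rw [hup i hi, hpb i hi],
        fun i h1 h2 => (hupoff i h1 h2).symm, by omega, by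
        rw [show f + 1 + 1 = f + 2 by omega]; omega, by omega⟩
    · refine ⟨by omega, by omega, by omega, fun i hi => ?_, fun i h1 h2 => ?_, ?_, ?_, ?_⟩
      · rw [moveDown_off _ (by omega) (by omega), hpb i hi]
      · rw [moveDown_off _ h1 h2]
      · rw [moveDown_fst]
      · rw [moveDown_snd, show f + 1 + 1 = f + 2 by omega]; omega
      · rw [moveDown_fst]; omega
    · refine ⟨by omega, by omega, by omega, hpa', fun i h1 h2 => ?_, ?_, ?_, by omega⟩
      · by_cases h5 : i = f + 2
        · subst h5
          have := moveDown_snd (f + 1) b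
          rw [show f + 1 + 1 = f + 2 by omega] at this
          omega
        · rw [moveDown_off _ (by omega) (by omega), hoff i h1 h2 h5]
      · rw [moveDown_off _ (by omega) (by omega)]; omega
      · rw [moveDown_fst]; omega

theorem Adj.differByAtMost {n p : ℕ} {a b : ℕ → ℕ} (ha : ∀ i, a i ≤ i - 1)
    (hb : ∀ i, b i ≤ i - 1) (h : Adj n p a b) :
    DifferByAtMost 3 (psi (seqOf n a)) (psi (seqOf n b)) := by
  have one : ∀ {v f x} {a b : ℕ → ℕ}, Step n v f x a b →
      DifferByAtMost 3 (psi (seqOf n a)) (psi (seqOf n b)) := by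
    intro v f x a b h
    obtain ⟨g, hg, h⟩ := h.exists_isSwap
    exact ⟨[g], by simp, by simpa using hg, by simpa using h⟩
  have two : ∀ {v f x v' f' x'} {a b c : ℕ → ℕ}, Step n v f x a b ∧ Step n v' f' x' b c →
      DifferByAtMost 3 (psi (seqOf n a)) (psi (seqOf n c)) := by
    intro v f x v' f' x' a b c h
    obtain ⟨g, hg, h1⟩ := h.1.exists_isSwap
    obtain ⟨g', hg', h2⟩ := h.2.exists_isSwap
    exact ⟨[g, g'], by simp, by simp [hg, hg'], by rw [h2, h1]; simp [mul_assoc]⟩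
  have three : ∀ {v f x v' f' x' v'' f'' x''} {a b c d : ℕ → ℕ},
      Step n v f x a b ∧ Step n v' f' x' b c ∧ Step n v'' f'' x'' c d →
      DifferByAtMost 3 (psi (seqOf n a)) (psi (seqOf n d)) := by
    intro v f x v' f' x' v'' f'' x'' a b c d h
    obtain ⟨g, hg, h1⟩ := h.1.exists_isSwap
    obtain ⟨g', hg', h2⟩ := h.2.1.exists_isSwap
    obtain ⟨g'', hg'', h3⟩ := h.2.2.exists_isSwap
    exact ⟨[g, g', g''], by simp, by simp [hg, hg', hg''], by rw [h3, h2, h1]; simp [mul_assoc]⟩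
  obtain ⟨f, ⟨_, h | h⟩ | ⟨_, h | h⟩⟩ := h
  · obtain ⟨_, _, x, _, h⟩ | ⟨_, _, x, _, h⟩ := h.steps ha
    exacts [one h.1, two h.1]
  · obtain ⟨_, _, x, _, h⟩ | ⟨_, _, x, _, h⟩ := h.steps hb
    exacts [one h.2, two h.2]
  · obtain ⟨_, _, h⟩ | ⟨_, _, h⟩ | ⟨_, _, h⟩ := h.steps ha hb
    exacts [two h.1, three h.1, two h.1]
  · obtain ⟨_, _, h⟩ | ⟨_, _, h⟩ | ⟨_, _, h⟩ := h.steps hb ha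
    exacts [two h.2, three h.2, two h.2]

/-! ### The list of permutations -/

/-- The initial array of the algorithm. -/
def zeroArr : ℕ → ℕ := fun _ => 0

theorem node_root {n k : ℕ} (hk : k ≤ triangle n) : Node n k n zeroArr :=
  ⟨le_rfl, fun _ _ => rfl, fun _ => Nat.zero_le _, hk⟩

theorem grayList_eq (n k : ℕ) : grayList k n = (gen1Gray k n 0 zeroArr).map (seqOf n) := rfl

theorem Below.sum_root {n k : ℕ} {d : ℕ → ℕ} (h : Below n k n zeroArr d) :
    ∑ i ∈ range (n + 1), d i = k := by
  rw [h.sum_eq]; simp [zeroArr]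

theorem mem_grayList {n k : ℕ} (hk : k ≤ triangle n) (c : Fin n → ℕ) :
    c ∈ grayList k n ↔ c ∈ S k n := by
  rw [grayList_eq, List.mem_map]
  constructor
  · rintro ⟨d, hd, rfl⟩
    rw [mem_gen1Gray (node_root hk) (by norm_num)] at hd
    refine ⟨fun i => hd.subexcedant _, ?_⟩
    have := hd.subexcedant 0
    rw [sum_seqOf _ (by omega), hd.sum_root]
  · rintro ⟨h1, h2⟩
    refine ⟨arrOf c, ?_, seqOf_arrOf c⟩
    rw [mem_gen1Gray (node_root hk) (by norm_num)]
    have h0 : ∀ i, n < i → arrOf c i = 0 := fun i hi => dif_neg (by omega)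
    refine ⟨h0, arrOf_le h1, Nat.zero_le _, ?_⟩
    have := arrOf_le h1 0
    rw [← sum_seqOf _ (by omega), seqOf_arrOf, h2]
    simp [zeroArr]

theorem nodup_grayList {n k : ℕ} (hk : k ≤ triangle n) : (grayList k n).Nodup := by
  rw [grayList_eq]
  refine List.Nodup.map_on ?_ (nodup_gen1Gray (node_root hk) (by norm_num))
  intro a ha b hb hab
  rw [mem_gen1Gray (node_root hk) (by norm_num)] at ha hb
  funext i
  rcases Nat.lt_or_ge n i with hi | hi
  · rw [ha.eq_above i hi, hb.eq_above i hi]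
  rcases Nat.eq_zero_or_pos i with rfl | hpos
  · have := ha.subexcedant 0
    have := hb.subexcedant 0
    omega
  · have := congrFun hab ⟨i - 1, by omega⟩
    simpa [seqOf, Nat.sub_add_cancel hpos] using this

theorem nodup_permList {n k : ℕ} (hk : k ≤ triangle n) : (permList k n).Nodup := by
  refine List.Nodup.map_on ?_ (nodup_grayList hk)
  intro a ha b hb hab
  rw [mem_grayList hk] at ha hb
  exact psi_injOn n ha.1 hb.1 hab

theorem mem_permList {n k : ℕ} (hk : k ≤ triangle n) (π : Perm (Fin n)) :
    π ∈ permList k n ↔ maj π = k := by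
  rw [permList, List.mem_map]
  constructor
  · rintro ⟨c, hc, rfl⟩
    exact (psi_bijOn n k).mapsTo ((mem_grayList hk c).1 hc)
  · intro hπ
    obtain ⟨c, hc, rfl⟩ := (psi_bijOn n k).surjOn hπ
    exact ⟨c, (mem_grayList hk c).2 hc, rfl⟩

theorem permList_eq (n k : ℕ) :
    permList k n = (gen1Gray k n 0 zeroArr).map fun a => psi (seqOf n a) := by
  rw [permList, grayList_eq, List.map_map]; rfl

theorem isChain_permList {n k : ℕ} (hk : k ≤ triangle n) :
    (permList k n).IsChain (DifferByAtMost 3) := by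
  rw [permList_eq, List.isChain_map]
  refine List.IsChain.imp_of_mem_imp ?_ (isChain_gen1Gray (node_root hk) (by norm_num))
  rintro a b ha hb ⟨p, hp⟩
  rw [mem_gen1Gray (node_root hk) (by norm_num)] at ha hb
  exact hp.differByAtMost ha.subexcedant hb.subexcedant

theorem card_eq_length {n k : ℕ} (hk : k ≤ triangle n) :
    Nat.card {π : Perm (Fin n) // maj π = k} = (gen1Gray k n 0 zeroArr).length := by
  rw [Nat.subtype_card (permList k n).toFinset fun π => by rw [List.mem_toFinset, mem_permList hk],
    List.toFinset_card_of_nodup (nodup_permList hk), permList_eq, List.length_map]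

/-! ### The co-lex smallest sequence -/

theorem firstSeq_root {n k i : ℕ} (hk : k ≤ triangle n) (hi : i ≤ n) :
    firstSeq k n zeroArr i = minSeq k i := by
  rcases hi.eq_or_lt with rfl | hi
  · rw [firstSeq_self, minSeq_of_ge hk, zeroArr, Nat.zero_add]
  · exact firstSeq_of_lt _ hi

theorem isColexLeast_firstSeq {n k : ℕ} (hk : k ≤ triangle n) :
    IsColexLeast k n (seqOf n (firstSeq k n zeroArr)) := by
  have hF := headSeq_below (d := 0) (node_root hk) (by norm_num)
  rw [show headSeq 0 k n zeroArr = firstSeq k n zeroArr from rfl] at hF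
  refine ⟨?_, fun b hb hne => ?_⟩
  · rw [← mem_grayList hk, grayList_eq]
    exact List.mem_map_of_mem ((mem_gen1Gray (node_root hk) (by norm_num)).2 hF)
  -- compare at the last position where the two sequences differ
  obtain ⟨b, rfl⟩ : ∃ b', seqOf n b' = b := ⟨_, seqOf_arrOf b⟩
  obtain ⟨i, hi, hmax⟩ : ∃ i, b (i + 1) ≠ firstSeq k n zeroArr (i + 1) ∧ i < n ∧
      ∀ j, i < j → j < n → b (j + 1) = firstSeq k n zeroArr (j + 1) := by
    obtain ⟨i₀, hi₀⟩ := Function.ne_iff.1 hne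
    classical
    have hspec := Nat.findGreatest_spec
      (P := fun i => b (i + 1) ≠ firstSeq k n zeroArr (i + 1)) (n := n - 1)
      (m := (i₀ : ℕ)) (by have := i₀.2; omega) hi₀
    refine ⟨_, hspec, ?_, fun j h1 h2 => ?_⟩
    · have := Nat.findGreatest_le
        (P := fun i => b (i + 1) ≠ firstSeq k n zeroArr (i + 1)) (n - 1)
      have := i₀.2
      omega
    · by_contra h3
      have := Nat.le_findGreatest
        (P := fun i => b (i + 1) ≠ firstSeq k n zeroArr (i + 1)) (n := n - 1) (by omega) h3
      omega
  refine ⟨⟨i, hmax.1⟩, ?_, fun j hj => (hmax.2 j hj j.2).symm⟩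
  change firstSeq k n zeroArr (i + 1) < b (i + 1)
  by_contra hlt
  have hlt : b (i + 1) < firstSeq k n zeroArr (i + 1) := by omega
  have hb' : ∀ j ≤ n, 1 ≤ j → b j ≤ j - 1 := fun j h1 h2 => by
    have : seqOf n b ⟨j - 1, by omega⟩ ≤ j - 1 := hb.1 ⟨j - 1, by omega⟩
    simpa [seqOf, Nat.sub_add_cancel h2] using this
  -- compare the sums up to that position
  have hsum := hb.2
  have hsF := hF.sum_root
  set b₀ : ℕ → ℕ := fun j => if j = 0 then 0 else if j ≤ n then b j else
    firstSeq k n zeroArr j with hb₀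
  have hbb : ∀ j, 1 ≤ j → j ≤ n → b₀ j = b j := fun j h1 h2 => by
    rw [hb₀]; simp only
    rw [if_neg (by omega), if_pos h2]
  have hsum' : ∑ j ∈ range (n + 1), b₀ j = k := by
    rw [← sum_seqOf n (by simp [hb₀]), ← hsum]
    refine Finset.sum_congr rfl fun j _ => ?_
    have := j.2
    exact hbb (j + 1) (by omega) (by omega)
  have h1 := sum_add_sum_of_eq_above (n := n) (i := i + 1) (c := firstSeq k n zeroArr) (d := b₀)
    (by omega) fun j hj => by
      rcases Nat.lt_or_ge n j with h | h
      · rw [hb₀]; simp only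
        rw [if_neg (by omega), if_neg (by omega)]
      · rw [hbb j (by omega) h]
        have := hmax.2 (j - 1) (by omega) (by omega)
        rwa [Nat.sub_add_cancel (by omega)] at this
  have h2 : ∑ j ∈ range (i + 1), b₀ j ≤ triangle i := sum_le_triangle fun j hj => by
    rcases Nat.eq_zero_or_pos j with rfl | hpos
    · simp [hb₀]
    · rw [hbb j hpos (by omega)]; exact hb' j (by omega) hpos
  have h3 : ∑ j ∈ range (i + 1), firstSeq k n zeroArr j = min k (triangle i) := by
    rw [← sum_minSeq]
    exact Finset.sum_congr rfl fun j hj => firstSeq_root hk (by simp at hj; omega)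
  have h4 : triangle i < k := by
    by_contra h
    rw [firstSeq_root hk (by omega), minSeq_eq_zero (by simpa using h)] at hlt
    omega
  rw [sum_range_succ b₀ (i + 1), sum_range_succ (firstSeq k n zeroArr) (i + 1),
    hbb _ (by omega) (by omega)] at h1
  omega

/-! ### A lower bound for the number of permutations -/

/-- Moving one unit from any of the positions `2, …, t - 1` of the smallest sequence to a position
`t` gives different sequences of the same weight. -/
theorem tri_le_length {n k : ℕ} (hk : k < triangle n) :
    tri k ≤ 3 * (gen1Gray k n 0 zeroArr).length := by
  classical
  have hN := node_root hk.le
  have hpos : 1 ≤ (gen1Gray k n 0 zeroArr).length := by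
    have := head?_gen1Gray hN (d := 0) (by norm_num)
    rcases h : gen1Gray k n 0 zeroArr with _ | ⟨x, L⟩
    · rw [h] at this; simp at this
    · simp
  rcases Nat.eq_zero_or_pos k with rfl | hk1
  · rw [tri_zero]; omega
  have hn : 2 ≤ n := by
    by_contra h
    have := triangle_mono (show n ≤ 1 by omega)
    simp at this
    omega
  have hI : Inner n k n zeroArr := ⟨hN, hk1, by simp [zeroArr]; omega⟩
  obtain ⟨h1, h2, h3, h4⟩ := hI.weight_split
  have htri := hI.tri_le
  have hl := two_le_tri hk1
  have hF := headSeq_below (d := 0) hN (by norm_num)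
  rw [show headSeq 0 k n zeroArr = firstSeq k n zeroArr from rfl] at hF
  set F := firstSeq k n zeroArr with hFdef
  obtain ⟨t, ht1, ht2, ht3, ht4⟩ : ∃ t, tri k ≤ t ∧ t ≤ n ∧ F t + 1 ≤ t - 1 ∧
      ∀ i < t, F i = i - 1 := by
    have hlow : ∀ i < tri k, F i = i - 1 := fun i hi => by
      rw [hFdef, firstSeq_root hk.le (by omega), hI.minSeq_below hi]
    have htop : F (tri k) = rem k := by
      rw [hFdef, firstSeq_root hk.le htri, minSeq_tri]
    rcases h3.eq_or_lt with h5 | h5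
    · have hlt : tri k < n := by
        refine lt_of_le_of_ne htri fun h => ?_
        have := triangle_eq_pred (show 1 ≤ n by omega)
        rw [h] at h1 h5
        omega
      refine ⟨tri k + 1, by omega, hlt, ?_, fun i hi => ?_⟩
      · rw [hFdef, firstSeq_root hk.le hlt, minSeq_above_tri (by omega)]; omega
      · rcases (Nat.lt_succ_iff.1 hi).eq_or_lt with rfl | hi
        · omega
        · exact hlow i hi
    · exact ⟨tri k, le_rfl, htri, by omega, hlow⟩
  let x : ℕ → ℕ → ℕ := fun i => Function.update (Function.update F i (F i - 1)) t (F t + 1)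
  have hx : ∀ i ∈ Finset.Ico 2 t, x i ∈ (gen1Gray k n 0 zeroArr).toFinset := by
    intro i hi
    rw [Finset.mem_Ico] at hi
    rw [List.mem_toFinset, mem_gen1Gray hN (by norm_num)]
    have hxi : x i i = F i - 1 := by simp [x, show i ≠ t by omega]
    have hxt : x i t = F t + 1 := by simp [x]
    have hxj : ∀ j, j ≠ i → j ≠ t → x i j = F j := fun j h1 h2 => by simp [x, h1, h2]
    have hFi := ht4 i hi.2
    refine ⟨fun j hj => ?_, fun j => ?_, Nat.zero_le _, ?_⟩
    · rw [hxj j (by omega) (by omega), hF.eq_above j hj]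
    · by_cases h5 : j = i
      · subst h5; omega
      by_cases h6 : j = t
      · subst h6; omega
      rw [hxj j h5 h6]
      exact hF.subexcedant j
    · have hb : bump (x i) i 1 = bump F t 1 := by
        funext j
        by_cases h5 : j = i
        · subst h5; rw [bump_self, bump_of_ne (by omega)]; omega
        by_cases h6 : j = t
        · subst h6; rw [bump_self, bump_of_ne h5]; omega
        rw [bump_of_ne h5, bump_of_ne h6, hxj j h5 h6]
      have := congrArg (fun g : ℕ → ℕ => ∑ j ∈ range (n + 1), g j) hb
      rw [sum_bump _ _ (by omega), sum_bump _ _ ht2, hF.sum_eq] at this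
      omega
  have hinj : Set.InjOn x (Finset.Ico 2 t) := by
    intro i hi j hj hij
    simp only [Finset.coe_Ico, Set.mem_Ico] at hi hj
    by_contra hne
    have h5 := congrFun hij i
    simp [x, hne, show i ≠ t by omega] at h5
    have := ht4 i hi.2
    omega
  have := Finset.card_le_card_of_injOn x hx hinj
  rw [Nat.card_Ico, List.toFinset_card_of_nodup (nodup_gen1Gray hN (by norm_num))] at this
  omega

/-! ### Program runs with a time bound -/

/-- `s`, started with local variables `fr` and memory `m`, terminates within `T` steps in a state
that satisfies `Q`. -/
def Runs (s : Stmt) (fr : Frame) (m : Mem) (T : ℕ) (Q : Frame → Mem → Prop) : Prop :=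
  ∃ fr' m' t, Exec s fr m fr' m' t ∧ t ≤ T ∧ Q fr' m'

/-- The number of nodes of an expression, which bounds the cost of its evaluation. -/
def Expr.nodes : Expr → ℕ
  | .lit _ => 1
  | .var _ => 1
  | .size => 1
  | .read _ i => nodes i + 1
  | .bin _ e₁ e₂ => nodes e₁ + nodes e₂ + 1
  | .cond b e₁ e₂ => nodes b + nodes e₁ + nodes e₂ + 1

theorem Expr.cost_le (fr : Frame) (m : Mem) (e : Expr) : e.cost fr m ≤ e.nodes := by
  induction e with
  | lit _ => exact le_rfl
  | var _ => exact le_rfl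
  | size => exact le_rfl
  | read _ i ih => exact Nat.succ_le_succ ih
  | bin _ e₁ e₂ ih₁ ih₂ => simp only [cost, nodes]; omega
  | cond b e₁ e₂ ihb ih₁ ih₂ => simp only [cost, nodes]; split_ifs <;> omega

theorem Runs.mono {s : Stmt} {fr : Frame} {m : Mem} {T T' : ℕ} {Q Q' : Frame → Mem → Prop}
    (h : Runs s fr m T Q) (hT : T ≤ T') (hQ : ∀ fr' m', Q fr' m' → Q' fr' m') :
    Runs s fr m T' Q' := by
  obtain ⟨fr', m', t, h1, h2, h3⟩ := h
  exact ⟨fr', m', t, h1, h2.trans hT, hQ _ _ h3⟩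

theorem Runs.time {s : Stmt} {fr : Frame} {m : Mem} {T T' : ℕ} {Q : Frame → Mem → Prop}
    (h : Runs s fr m T Q) (hT : T ≤ T') : Runs s fr m T' Q :=
  h.mono hT fun _ _ h => h

theorem Runs.skip {fr : Frame} {m : Mem} {Q : Frame → Mem → Prop} (h : Q fr m) :
    Runs .skip fr m 1 Q :=
  ⟨_, _, _, .skip fr m, le_rfl, h⟩

theorem Runs.assign {nm : Var} {e : Expr} {fr : Frame} {m : Mem} {Q : Frame → Mem → Prop}
    (h : Q (Function.update fr nm (e.eval fr m)) m) : Runs (.assign nm e) fr m (e.nodes + 1) Q :=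
  ⟨_, _, _, .assign nm e fr m, Nat.succ_le_succ (e.cost_le fr m), h⟩

theorem Runs.store {a : Arr} {i e : Expr} {fr : Frame} {m : Mem} {Q : Frame → Mem → Prop}
    (h : Q fr (m.write a (i.eval fr m) (e.eval fr m))) :
    Runs (.store a i e) fr m (i.nodes + e.nodes + 1) Q :=
  ⟨_, _, _, .store a i e fr m, by have := i.cost_le fr m; have := e.cost_le fr m; omega, h⟩

theorem Runs.emit {fr : Frame} {m : Mem} {Q : Frame → Mem → Prop} (h : Q fr m.emit) :
    Runs .emit fr m 1 Q :=
  ⟨_, _, _, .emit fr m, le_rfl, h⟩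

theorem Runs.seq {s₁ s₂ : Stmt} {fr : Frame} {m : Mem} {T₁ T₂ : ℕ} {Q : Frame → Mem → Prop}
    (h : Runs s₁ fr m T₁ fun fr' m' => Runs s₂ fr' m' T₂ Q) :
    Runs (.seq s₁ s₂) fr m (T₁ + T₂) Q := by
  obtain ⟨_, _, _, h1, h2, _, _, _, h3, h4, h5⟩ := h
  exact ⟨_, _, _, .seq h1 h3, add_le_add h2 h4, h5⟩

theorem Runs.seq_of {s₁ s₂ : Stmt} {fr : Frame} {m : Mem} {T₁ T₂ : ℕ} {R Q : Frame → Mem → Prop}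
    (h₁ : Runs s₁ fr m T₁ R) (h₂ : ∀ fr' m', R fr' m' → Runs s₂ fr' m' T₂ Q) :
    Runs (.seq s₁ s₂) fr m (T₁ + T₂) Q :=
  .seq (h₁.mono le_rfl h₂)

theorem Runs.ite_true {b : Expr} {s₁ s₂ : Stmt} {fr : Frame} {m : Mem} {T : ℕ}
    {Q : Frame → Mem → Prop} (hb : b.eval fr m ≠ 0) (h : Runs s₁ fr m T Q) :
    Runs (.ite b s₁ s₂) fr m (b.nodes + 1 + T) Q := by
  obtain ⟨_, _, _, h1, h2, h3⟩ := h
  exact ⟨_, _, _, .iteTrue hb h1, by have := b.cost_le fr m; omega, h3⟩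

theorem Runs.ite_false {b : Expr} {s₁ s₂ : Stmt} {fr : Frame} {m : Mem} {T : ℕ}
    {Q : Frame → Mem → Prop} (hb : b.eval fr m = 0) (h : Runs s₂ fr m T Q) :
    Runs (.ite b s₁ s₂) fr m (b.nodes + 1 + T) Q := by
  obtain ⟨_, _, _, h1, h2, h3⟩ := h
  exact ⟨_, _, _, .iteFalse hb h1, by have := b.cost_le fr m; omega, h3⟩

theorem Runs.store_of {a : Arr} {i e : Expr} {fr : Frame} {m : Mem} {y z : ℤ}
    {Q : Frame → Mem → Prop} (hy : i.eval fr m = y) (hz : e.eval fr m = z)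
    (h : Q fr (m.write a y z)) : Runs (.store a i e) fr m (i.nodes + e.nodes + 1) Q :=
  .store (by rwa [hy, hz])

theorem Runs.assign_of {nm : Var} {e : Expr} {fr : Frame} {m : Mem} {z : ℤ}
    {Q : Frame → Mem → Prop} (hz : e.eval fr m = z) (h : Q (Function.update fr nm z) m) :
    Runs (.assign nm e) fr m (e.nodes + 1) Q :=
  .assign (by rwa [hz])

theorem Runs.assign_seq {nm : Var} {e : Expr} {s : Stmt} {fr : Frame} {m : Mem} {T : ℕ} {z : ℤ}
    {Q : Frame → Mem → Prop} (hz : e.eval fr m = z) (h : Runs s (Function.update fr nm z) m T Q) :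
    Runs (.seq (.assign nm e) s) fr m (e.nodes + 1 + T) Q :=
  .seq (.assign (by rwa [hz]))

theorem Runs.store_seq {a : Arr} {i e : Expr} {s : Stmt} {fr : Frame} {m : Mem} {T : ℕ} {y z : ℤ}
    {Q : Frame → Mem → Prop} (hy : i.eval fr m = y) (hz : e.eval fr m = z)
    (h : Runs s fr (m.write a y z) T Q) :
    Runs (.seq (.store a i e) s) fr m (i.nodes + e.nodes + 1 + T) Q :=
  .seq (.store (by rwa [hy, hz]))

theorem Runs.loop_step {b : Expr} {s : Stmt} {fr : Frame} {m : Mem} {T₁ T₂ : ℕ}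
    {Q : Frame → Mem → Prop} (hb : b.eval fr m ≠ 0)
    (h : Runs s fr m T₁ fun fr' m' => Runs (.loop b s) fr' m' T₂ Q) :
    Runs (.loop b s) fr m (b.nodes + 1 + T₁ + T₂) Q := by
  obtain ⟨_, _, _, h1, h2, _, _, _, h3, h4, h5⟩ := h
  exact ⟨_, _, _, .loopStep hb h1 h3, by have := b.cost_le fr m; omega, h5⟩

theorem Runs.loop_end {b : Expr} {s : Stmt} {fr : Frame} {m : Mem}
    {Q : Frame → Mem → Prop} (hb : b.eval fr m = 0) (h : Q fr m) :
    Runs (.loop b s) fr m (b.nodes + 1) Q :=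
  ⟨_, _, _, .loopEnd hb, Nat.succ_le_succ (b.cost_le fr m), h⟩

theorem Runs.call {P : Proc} {args : List Expr} {fr : Frame} {m : Mem} {T : ℕ}
    {Q : Frame → Mem → Prop}
    (h : Runs P.body (bindParams P.params (args.map fun e => e.eval fr m)) m T
      fun _ m' => Q fr m') :
    Runs (.call P args) fr m ((args.map Expr.nodes).sum + 1 + T) Q := by
  obtain ⟨_, _, _, h1, h2, h3⟩ := h
  have h4 : (args.map fun e => e.cost fr m).sum ≤ (args.map Expr.nodes).sum :=
    List.sum_le_sum fun e _ => e.cost_le fr m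
  exact ⟨_, _, _, .call h1, by omega, h3⟩

namespace Expr

variable (fr : Frame) (m : Mem)

@[simp] theorem eval_lit (z : ℤ) : eval fr m (lit z) = z := rfl

@[simp] theorem eval_var (nm : Var) : eval fr m (var nm) = fr nm := rfl

@[simp] theorem eval_size : eval fr m Expr.size = m.n := rfl

@[simp] theorem eval_read (a : Arr) (i : Expr) :
    eval fr m (read a i) = m.arr a (eval fr m i) := rfl

@[simp] theorem eval_cond (b e₁ e₂ : Expr) :
    eval fr m (cond b e₁ e₂) = if eval fr m b ≠ 0 then eval fr m e₁ else eval fr m e₂ := rfl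

@[simp] theorem eval_ofNat (n : ℕ) :
    eval fr m (no_index (OfNat.ofNat n) : Expr) = ((OfNat.ofNat n : ℕ) : ℤ) := rfl

@[simp] theorem eval_add (a b : Expr) :
    eval fr m (a + b) = eval fr m a + eval fr m b := rfl

@[simp] theorem eval_sub (a b : Expr) :
    eval fr m (a - b) = eval fr m a - eval fr m b := rfl

@[simp] theorem eval_mul (a b : Expr) :
    eval fr m (a * b) = eval fr m a * eval fr m b := rfl

@[simp] theorem eval_div (a b : Expr) :
    eval fr m (a / b) = eval fr m a / eval fr m b := rfl

@[simp] theorem eval_mod (a b : Expr) :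
    eval fr m (a % b) = eval fr m a % eval fr m b := rfl

@[simp] theorem eval_le (a b : Expr) :
    eval fr m (le a b) = if eval fr m a ≤ eval fr m b then 1 else 0 := rfl

@[simp] theorem eval_eq (a b : Expr) :
    eval fr m (eq a b) = if eval fr m a = eval fr m b then 1 else 0 := rfl

@[simp] theorem eval_and (a b : Expr) :
    eval fr m (and a b) = if eval fr m a ≠ 0 then eval fr m b else 0 := rfl

@[simp] theorem eval_or (a b : Expr) :
    eval fr m (or a b) = if eval fr m a ≠ 0 then 1 else eval fr m b := rfl

@[simp] theorem nodes_lit (z : ℤ) : nodes (lit z) = 1 := rfl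

@[simp] theorem nodes_var (nm : Var) : nodes (var nm) = 1 := rfl

@[simp] theorem nodes_size : nodes Expr.size = 1 := rfl

@[simp] theorem nodes_read (a : Arr) (i : Expr) :
    nodes (read a i) = nodes i + 1 := rfl

@[simp] theorem nodes_cond (b e₁ e₂ : Expr) :
    nodes (cond b e₁ e₂) = nodes b + nodes e₁ + nodes e₂ + 1 := rfl

@[simp] theorem nodes_ofNat (n : ℕ) : nodes (no_index (OfNat.ofNat n) : Expr) = 1 := rfl

@[simp] theorem nodes_add (a b : Expr) : nodes (a + b) = nodes a + nodes b + 1 := rfl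

@[simp] theorem nodes_sub (a b : Expr) : nodes (a - b) = nodes a + nodes b + 1 := rfl

@[simp] theorem nodes_mul (a b : Expr) : nodes (a * b) = nodes a + nodes b + 1 := rfl

@[simp] theorem nodes_div (a b : Expr) : nodes (a / b) = nodes a + nodes b + 1 := rfl

@[simp] theorem nodes_mod (a b : Expr) : nodes (a % b) = nodes a + nodes b + 1 := rfl

@[simp] theorem nodes_le (a b : Expr) : nodes (le a b) = nodes a + nodes b + 1 := rfl

@[simp] theorem nodes_eq (a b : Expr) : nodes (eq a b) = nodes a + nodes b + 1 := rfl

@[simp] theorem nodes_and (a b : Expr) :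
    nodes (and a b) = nodes a + nodes b + 2 := rfl

@[simp] theorem nodes_or (a b : Expr) : nodes (or a b) = nodes a + nodes b + 2 := by
  simp only [or, nodes]; omega

end Expr

theorem Mem.write_arr (m : Mem) (a b : Arr) (i z : ℤ) :
    (m.write a i z).arr b = if b = a then Function.update (m.arr a) i z else m.arr b := by
  simp only [Mem.write, Function.update_apply]

@[simp] theorem Mem.write_out (m : Mem) (a : Arr) (i z : ℤ) : (m.write a i z).out = m.out := rfl

/-! ### The procedure `transp` -/

/-- The memory `m` stores the array `c`, the sequence `s` and its permutation, and the table of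
`tri` up to `K`. Only the entries `1, …, n` of `s` are stored. -/
structure Rep (n K : ℕ) (c s : ℕ → ℕ) (m : Mem) : Prop where
  size : m.n = n
  tri : ∀ z : ℕ, z ≤ K → m.arr .tri z = tri z
  sigma : m.arr .sigma = permArr (psi (seqOf n s))
  c_eq : ∀ i : ℕ, m.arr .c i = c i
  s_eq : ∀ i : ℕ, 1 ≤ i → i ≤ n → m.arr .s i = s i

theorem permArr_apply {n : ℕ} (π : Perm (Fin n)) (i : Fin n) :
    permArr π ((i : ℕ) + 1 : ℤ) = (π i : ℕ) + 1 := by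
  have := i.2
  unfold permArr seqArr
  rw [dif_pos (by omega)]
  push_cast
  congr 4

theorem permArr_mul_swap {n : ℕ} (π : Perm (Fin n)) (y z : Fin n) :
    permArr (π * swap y z) = Function.update (Function.update (permArr π) ((y : ℕ) + 1)
      (permArr π ((z : ℕ) + 1))) ((z : ℕ) + 1) (permArr π ((y : ℕ) + 1)) := by
  funext w
  by_cases hw : 1 ≤ w ∧ w ≤ n
  · obtain ⟨i, rfl⟩ : ∃ i : Fin n, w = (i : ℕ) + 1 := ⟨⟨w.toNat - 1, by omega⟩, by simp; omega⟩
    have e : ∀ j : Fin n, ((i : ℕ) : ℤ) + 1 = (j : ℕ) + 1 ↔ i = j := fun j => by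
      rw [Fin.ext_iff]; omega
    simp only [Function.update_apply, permArr_apply, e, Perm.mul_apply, Equiv.swap_apply_def]
    split_ifs <;> simp_all
  · have h1 : ∀ π : Perm (Fin n), permArr π w = 0 := fun π => dif_neg hw
    have h2 : ∀ j : Fin n, w ≠ (j : ℕ) + 1 := fun j hj => hw (by have := j.2; omega)
    rw [Function.update_of_ne (h2 z), Function.update_of_ne (h2 y), h1, h1]

theorem phi_cast {j s i : ℕ} (h : s + 1 ≤ j) :
    (phi j s i : ℤ) = if 1 ≤ (i : ℤ) ∧ (i : ℤ) ≤ j - (s + 1) then (j : ℤ) - s - i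
      else if (i : ℤ) ≤ j then 2 * (j : ℤ) - s - i else i := by
  unfold phi
  split_ifs <;> omega

/-- The expression for `φ_j` in the body of `transp`. -/
def phiExpr (t : Expr) : Expr :=
  let j : Expr := Var.j
  let s : Expr → Expr := Expr.read Arr.s
  .cond (.and (.le 1 t) (.le t (j - (s j + 1)))) (j - s j - t) (.cond (.le t j) (2 * j - s j - t) t)

theorem eval_phiExpr {fr : Frame} {m : Mem} {j s i : ℕ} {t : Expr} (hj : fr .j = j)
    (hs : m.arr .s j = s) (h : s + 1 ≤ j) (ht : t.eval fr m = i) :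
    (phiExpr t).eval fr m = phi j s i := by
  rw [phi_cast h]
  simp only [phiExpr, Expr.eval_cond, Expr.eval_and, Expr.eval_le, Expr.eval_sub, Expr.eval_add,
    Expr.eval_mul, Expr.eval_var, Expr.eval_read, Expr.eval_ofNat, hj, hs, ht]
  by_cases h1 : 1 ≤ (i : ℤ) <;> by_cases h2 : (i : ℤ) ≤ j - (s + 1) <;>
    by_cases h3 : (i : ℤ) ≤ j <;> simp [h1, h2, h3]

theorem Rep.of_swap {n K f : ℕ} {c s b : ℕ → ℕ} {m : Mem} {v : ℤ} {y z : Fin n} (h : Rep n K c s m)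
    (hoff : ∀ i, i ≠ f → i ≠ f + 1 → b i = s i) (hf : (b f : ℤ) = s f - v)
    (hf' : (b (f + 1) : ℤ) = s (f + 1) + v) (h1 : 1 ≤ f) (hfn : f + 1 ≤ n)
    (hpsi : psi (seqOf n b) = psi (seqOf n s) * swap y z) {m' : Mem}
    (hm' : m' = (((m.write .sigma ((y : ℕ) + 1) (m.arr .sigma ((z : ℕ) + 1))).write .sigma
      ((z : ℕ) + 1) (m.arr .sigma ((y : ℕ) + 1))).write .s f (s f - v)).write .s (f + 1)
        (s (f + 1) + v)) :
    Rep n K c b m' := by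
  subst hm'
  refine ⟨h.size, fun z hz => ?_, ?_, fun i => ?_, fun i h1 h2 => ?_⟩
  · simpa [Mem.write_arr] using h.tri z hz
  · simp only [Mem.write_arr, if_true, reduceCtorEq, if_false]
    rw [hpsi, permArr_mul_swap, h.sigma]
  · simpa [Mem.write_arr] using h.c_eq i
  · have := h.s_eq i h1 h2
    simp only [Mem.write_arr, if_true, reduceCtorEq, if_false]
    by_cases e1 : i = f + 1
    · subst e1; simp [hf']
    by_cases e2 : i = f
    · subst e2; simp [hf]
    rw [Function.update_of_ne (by omega), Function.update_of_ne (by omega), this, hoff i e2 e1]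

/-- A bound for the number of steps of one activation of `transp`. -/
def transpTime : ℕ := 150

/-- A call of `transp` in either direction performs a step: for `v = -1` the transposition is that
of the opposite move. -/
theorem runs_transp {n K f x : ℕ} {c s b : ℕ → ℕ} {m : Mem} {v : ℤ} (h : Rep n K c s m)
    (hx : x ≤ K) (hstep : Step n v f x s b) :
    Runs Proc.transp.body (bindParams Proc.transp.params [v, f, x]) m transpTime
      fun _ m' => Rep n K c b m' ∧ m'.out = m.out := by
  -- the data needed in both directions
  obtain ⟨h2, hfn, htri, hst, hoff, hf, hf', ⟨y, z, hyz, hy, hz, hpsi⟩⟩ :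
      2 ≤ f ∧ f + 1 ≤ n ∧ tri x < f ∧ s (tri x) ≤ tri x - 1 ∧ (∀ i, i ≠ f → i ≠ f + 1 → b i = s i) ∧
      (b f : ℤ) = s f - v ∧ (b (f + 1) : ℤ) = s (f + 1) + v ∧
      ∃ y z : Fin n, y ≠ z ∧ (y : ℕ) + 1 = phi (tri x) (s (tri x)) (f + 1) ∧
      (z : ℕ) + 1 = phi (tri x) (s (tri x)) (if v = 1 then s f else s f + 1) ∧
      psi (seqOf n b) = psi (seqOf n s) * swap y z := by
    rcases hstep with ⟨rfl, h⟩ | ⟨rfl, h⟩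
    · refine ⟨h.two_le, h.lt, h.tri_lt, ?_, h.eq_off, ?_, ?_, h.psi_eq⟩
      · rw [h.prefix_eq _ h.tri_lt]; exact minSeq_le _ _
      · rw [h.fst]; push_cast; ring
      · rw [h.snd]; push_cast; ring
    · refine ⟨h.two_le, h.lt, h.tri_lt, ?_, fun i h1 h2 => (h.eq_off i h1 h2).symm, ?_, ?_, ?_⟩
      · have hlt := h.tri_lt
        rw [h.eq_off _ hlt.ne (by omega), h.prefix_eq _ hlt]; exact minSeq_le _ _
      · rw [h.fst]; push_cast; ring
      · rw [h.snd]; push_cast; ring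
      · obtain ⟨y, z, hyz, hy, hz, hpsi⟩ := h.psi_eq
        have hlt := h.tri_lt
        rw [← h.eq_off _ hlt.ne (by omega)] at hy hz
        refine ⟨y, z, hyz, hy, ?_, ?_⟩
        · rw [hz, h.fst]; rfl
        · rw [hpsi, mul_assoc, Equiv.swap_mul_self, mul_one]
  have h1 := one_le_tri x
  have hsarr := h.s_eq (tri x) h1 (by omega)
  have hsf := h.s_eq f (by omega) (by omega)
  have hsf' := h.s_eq (f + 1) (by omega) hfn
  push_cast at hsf'
  have hyz' : ((y : ℕ) : ℤ) ≠ (z : ℕ) := fun e => hyz (Fin.ext (by exact_mod_cast e))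
  have hexpr : ∀ {fr : Frame} {t : Expr} {i : ℕ}, fr .j = tri x → t.eval fr m = i →
      (phiExpr t).eval fr m = phi (tri x) (s (tri x)) i := fun hj ht =>
    eval_phiExpr hj hsarr (by omega) ht
  apply Runs.time
  · apply Runs.assign_seq (z := tri x)
    · simp [bindParams, Proc.params, h.tri x hx]
    apply Runs.assign_seq (z := (y : ℕ) + 1)
    · have := hexpr (fr := Function.update (bindParams Proc.transp.params [v, f, x]) .j (tri x))
        (t := Var.f + 1) (i := f + 1) (by simp) (by simp [bindParams, Proc.params])
      rw [← hy] at this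
      exact_mod_cast this
    set fr : Frame := Function.update (Function.update (bindParams Proc.transp.params [v, f, x])
      .j (tri x)) .y ((y : ℕ) + 1) with hfr
    have hfj : fr .j = tri x := by simp [hfr]
    have hff : fr .f = f := by simp [hfr, bindParams, Proc.params]
    have hfv : fr .v = v := by simp [hfr, bindParams, Proc.params]
    have hfy : fr .y = (y : ℕ) + 1 := by simp [hfr]
    apply Runs.seq_of (T₁ := 60)
      (R := fun fr' m' => fr' = Function.update fr .z ((z : ℕ) + 1) ∧ m' = m)
    · by_cases hv : v = 1
      · refine Runs.time (Runs.ite_true (by simp [hfv, hv]) (Runs.assign ⟨?_, rfl⟩)) ?_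
        · have := hexpr (fr := fr) (t := Expr.read Arr.s Var.f) (i := s f) hfj
            (by simp [hff, hsf])
          rw [if_pos hv] at hz
          rw [← hz] at this
          congr 1
        · simp
      · refine Runs.time (Runs.ite_false (by simp [hfv, hv]) (Runs.assign ⟨?_, rfl⟩)) ?_
        · have := hexpr (fr := fr) (t := Expr.read Arr.s Var.f + 1) (i := s f + 1) hfj
            (by simp [hff, hsf])
          rw [if_neg hv] at hz
          rw [← hz] at this
          congr 1
        · simp
    rintro _ m' ⟨rfl, hm'⟩
    rw [hm']
    clear hm' m'
    apply Runs.assign_seq (z := m.arr .sigma ((y : ℕ) + 1))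
    · simp [hfy]
    apply Runs.store_seq (y := (y : ℕ) + 1) (z := m.arr .sigma ((z : ℕ) + 1))
    · simp [hfy]
    · simp
    apply Runs.store_seq (y := (z : ℕ) + 1) (z := m.arr .sigma ((y : ℕ) + 1))
    · simp
    · simp
    apply Runs.store_seq (y := f) (z := s f - v)
    · simp [hff]
    · simp [hff, hfv, Mem.write_arr, hsf]
    refine Runs.store ⟨h.of_swap (f := f) hoff hf hf' (by omega) hfn hpsi ?_, by simp⟩
    simp [hff, hfv, Mem.write_arr, hsf']
  · simp [transpTime]

/-! ### The procedure `Update_Perm` -/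

theorem runs_transp_call {n K f x : ℕ} {c s b : ℕ → ℕ} {fr : Frame} {m : Mem} {v : ℤ}
    {e₁ e₂ e₃ : Expr} (h : Rep n K c s m) (hx : x ≤ K) (hstep : Step n v f x s b)
    (h₁ : e₁.eval fr m = v) (h₂ : e₂.eval fr m = f) (h₃ : e₃.eval fr m = x) :
    Runs (.call .transp [e₁, e₂, e₃]) fr m (e₁.nodes + e₂.nodes + e₃.nodes + transpTime + 1)
      fun fr' m' => fr' = fr ∧ Rep n K c b m' ∧ m'.out = m.out := by
  refine Runs.time (Runs.call (T := transpTime) ?_) ?_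
  · have := runs_transp h hx hstep
    rw [← h₁, ← h₂, ← h₃] at this
    exact this.mono le_rfl fun _ _ h => ⟨rfl, h⟩
  · simp; omega

/-- The test whether the three differences have the given values. -/
def isDiff (b₁ b₂ b₃ : ℤ) : Expr :=
  .and (.eq Var.a1 (.lit b₁)) (.and (.eq Var.a2 (.lit b₂)) (.eq Var.a3 (.lit b₃)))

/-- The test whether the three differences have the given values or the opposite ones. -/
def isDiffUpToSign (b₁ b₂ b₃ : ℤ) : Expr := .or (isDiff b₁ b₂ b₃) (isDiff (-b₁) (-b₂) (-b₃))

theorem eval_isDiff (fr : Frame) (m : Mem) (b₁ b₂ b₃ : ℤ) : (isDiff b₁ b₂ b₃).eval fr m =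
    if fr .a1 = b₁ ∧ fr .a2 = b₂ ∧ fr .a3 = b₃ then 1 else 0 := by
  simp only [isDiff, Expr.eval_and, Expr.eval_eq, Expr.eval_var, Expr.eval_lit]
  by_cases h1 : fr .a1 = b₁ <;> by_cases h2 : fr .a2 = b₂ <;>
    by_cases h3 : fr .a3 = b₃ <;> simp [h1, h2, h3]

theorem eval_isDiffUpToSign (fr : Frame) (m : Mem) (b₁ b₂ b₃ : ℤ) :
    (isDiffUpToSign b₁ b₂ b₃).eval fr m =
      if fr .a1 = b₁ ∧ fr .a2 = b₂ ∧ fr .a3 = b₃ ∨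
        fr .a1 = -b₁ ∧ fr .a2 = -b₂ ∧ fr .a3 = -b₃ then 1 else 0 := by
  simp only [isDiffUpToSign, Expr.eval_or, eval_isDiff]
  by_cases h : fr .a1 = b₁ ∧ fr .a2 = b₂ ∧ fr .a3 = b₃
  · rw [if_pos h, if_pos one_ne_zero, if_pos (.inl h)]
  · rw [if_neg h, if_neg (not_not.2 rfl)]
    simp only [h, false_or]

theorem nodes_isDiff (b₁ b₂ b₃ : ℤ) : (isDiff b₁ b₂ b₃).nodes = 13 := rfl

theorem nodes_isDiffUpToSign (b₁ b₂ b₃ : ℤ) : (isDiffUpToSign b₁ b₂ b₃).nodes = 28 := by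
  simp [isDiffUpToSign, nodes_isDiff]

/-- The last part of the body of `Update_Perm`, which executes the calls of `transp`. -/
def dispatch : Stmt :=
  let x : Expr := Var.x
  let f : Expr := Var.f
  let v : Expr := Var.v
  let s : Expr → Expr := Expr.read Arr.s
  let transp : Expr → Expr → Expr → Stmt := fun t₁ t₂ t₃ => .call Proc.transp [t₁, t₂, t₃]
  .ite (isDiffUpToSign 1 (-1) 0) (transp v f x)
    (.ite (isDiffUpToSign 2 (-2) 0) (.block [transp v f x, transp v f x])
    (.ite (isDiffUpToSign 1 (-2) 1) (.block [transp v f x, transp (0 - v) (f + 1) (x + s f)])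
    (.ite (isDiffUpToSign 1 (-3) 2) (.block [transp v f x, transp (0 - v) (f + 1) (x + s f),
        transp (0 - v) (f + 1) (x + s f)])
    (.ite (isDiffUpToSign 1 1 (-2)) (.block [transp v (f + 1) (x + s f), transp v f x,
        transp v (f + 1) (x + s f)])
    (.ite (isDiff 1 0 (-1)) (.block [transp 1 f x, transp 1 (f + 1) (x + s f)])
    (.ite (isDiff (-1) 0 1) (.block [transp (.lit (-1)) (f + 1) (x + s f),
        transp (.lit (-1)) f x])
    .skip))))))

/-- A bound for the number of steps of one activation of `Update_Perm`. -/
def updateTime : ℕ := 1100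

theorem sum_range_le {a : ℕ → ℕ} {f g : ℕ} (h : f ≤ g) : ∑ i ∈ range f, a i ≤ ∑ i ∈ range g, a i :=
  Finset.sum_le_sum_of_subset (Finset.range_subset_range.2 h)

/-- The distinction by cases in `Update_Perm` selects the calls of `transp` that turn `s` into its
neighbour `b`. -/
theorem runs_dispatch {n K f p x : ℕ} {c s b : ℕ → ℕ} {fr : Frame} {m : Mem} (h : Rep n K c s m)
    (hs : ∀ i, s i ≤ i - 1) (hb : ∀ i, b i ≤ i - 1) (hsK : ∑ i ∈ range (n + 1), s i = K)
    (hbK : ∑ i ∈ range (n + 1), b i = K)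
    (hadj : p = f + 1 ∧ (AdjTwo n f s b ∨ AdjTwo n f b s) ∨
      p = f + 2 ∧ (AdjThree n f s b ∨ AdjThree n f b s))
    (hf : fr .f = f) (hx : fr .x = x) (hxs : x = ∑ i ∈ range f, b i)
    (h1 : fr .a1 = s f - b f) (h2 : fr .a2 = s (f + 1) - b (f + 1))
    (h3 : fr .a3 = s (f + 2) - b (f + 2)) (hv : fr .v = if 1 ≤ fr .a1 then 1 else -1) :
    Runs dispatch fr m 900 fun _ m' => Rep n K c b m' ∧ m'.out = m.out := by
  have hxK : x ≤ K := by
    have hfn : f ≤ n + 1 := by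
      rcases hadj with ⟨_, h | h⟩ | ⟨_, h | h⟩ <;> have := h.lt <;> omega
    rw [hxs, ← hbK]
    exact sum_range_le hfn
  -- one, two or three calls of `transp`
  have one : ∀ {e₁ e₂ e₃ : Expr} {v₁ : ℤ} {f₁ x₁ : ℕ}, x₁ ≤ K → Step n v₁ f₁ x₁ s b →
      e₁.eval fr m = v₁ → e₂.eval fr m = f₁ → e₃.eval fr m = x₁ →
      Runs (.call .transp [e₁, e₂, e₃]) fr m (e₁.nodes + e₂.nodes + e₃.nodes + transpTime + 1)
        fun _ m' => Rep n K c b m' ∧ m'.out = m.out := fun hK hstep h1 h2 h3 =>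
    (runs_transp_call h hK hstep h1 h2 h3).mono le_rfl fun _ _ h => h.2
  have two : ∀ {e₁ e₂ e₃ e₁' e₂' e₃' : Expr} {v₁ v₂ : ℤ} {f₁ x₁ f₂ x₂ : ℕ} {t : ℕ → ℕ},
      x₁ ≤ K → x₂ ≤ K → Step n v₁ f₁ x₁ s t → Step n v₂ f₂ x₂ t b →
      e₁.eval fr m = v₁ → e₂.eval fr m = f₁ → e₃.eval fr m = x₁ →
      (∀ m', Rep n K c t m' → e₁'.eval fr m' = v₂ ∧ e₂'.eval fr m' = f₂ ∧ e₃'.eval fr m' = x₂) →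
      Runs (.block [.call .transp [e₁, e₂, e₃], .call .transp [e₁', e₂', e₃']]) fr m
        ((e₁.nodes + e₂.nodes + e₃.nodes + transpTime + 1) +
          (e₁'.nodes + e₂'.nodes + e₃'.nodes + transpTime + 1))
        fun _ m' => Rep n K c b m' ∧ m'.out = m.out := by
    intro e₁ e₂ e₃ e₁' e₂' e₃' v₁ v₂ f₁ x₁ f₂ x₂ t hK hK' hst hst' h1 h2 h3 he
    refine Runs.seq_of (runs_transp_call h hK hst h1 h2 h3) ?_
    rintro _ m' ⟨rfl, hR, hout⟩
    obtain ⟨h1', h2', h3'⟩ := he m' hR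
    exact (runs_transp_call hR hK' hst' h1' h2' h3').mono le_rfl fun _ _ h =>
      ⟨h.2.1, h.2.2.trans hout⟩
  have three : ∀ {e₁ e₂ e₃ e₁' e₂' e₃' : Expr} {v₁ v₂ : ℤ} {f₁ x₁ f₂ x₂ : ℕ} {t t' : ℕ → ℕ},
      x₁ ≤ K → x₂ ≤ K → Step n v₁ f₁ x₁ s t → Step n v₂ f₂ x₂ t t' → Step n v₂ f₂ x₂ t' b →
      e₁.eval fr m = v₁ → e₂.eval fr m = f₁ → e₃.eval fr m = x₁ →
      (∀ m', Rep n K c t m' → e₁'.eval fr m' = v₂ ∧ e₂'.eval fr m' = f₂ ∧ e₃'.eval fr m' = x₂) →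
      (∀ m', Rep n K c t' m' → e₁'.eval fr m' = v₂ ∧ e₂'.eval fr m' = f₂ ∧ e₃'.eval fr m' = x₂) →
      Runs (.block [.call .transp [e₁, e₂, e₃], .call .transp [e₁', e₂', e₃'],
          .call .transp [e₁', e₂', e₃']]) fr m
        ((e₁.nodes + e₂.nodes + e₃.nodes + transpTime + 1) +
          ((e₁'.nodes + e₂'.nodes + e₃'.nodes + transpTime + 1) +
            (e₁'.nodes + e₂'.nodes + e₃'.nodes + transpTime + 1)))
        fun _ m' => Rep n K c b m' ∧ m'.out = m.out := by
    intro e₁ e₂ e₃ e₁' e₂' e₃' v₁ v₂ f₁ x₁ f₂ x₂ t t' hK hK' hst hst' hst'' h1 h2 h3 he he'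
    refine Runs.seq_of (runs_transp_call h hK hst h1 h2 h3) ?_
    rintro _ m' ⟨rfl, hR, hout⟩
    obtain ⟨h1', h2', h3'⟩ := he m' hR
    refine Runs.seq_of (runs_transp_call hR hK' hst' h1' h2' h3') ?_
    rintro _ m'' ⟨rfl, hR', hout'⟩
    obtain ⟨h1'', h2'', h3''⟩ := he' m'' hR'
    exact (runs_transp_call hR' hK' hst'' h1'' h2'' h3'').mono le_rfl fun _ _ h =>
      ⟨h.2.1, h.2.2.trans (hout'.trans hout)⟩
  rcases hadj with ⟨_, hadj | hadj⟩ | ⟨_, hadj | hadj⟩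
  · have heq := hadj.eq_off (f + 2) (by omega) (by omega)
    have hsum : ∑ i ∈ range f, s i = x := by
      rw [hxs]
      exact Finset.sum_congr rfl fun i hi => hadj.eq_off i (by simp at hi; omega)
        (by simp at hi; omega)
    obtain ⟨d1, d2, y, hy, hst, -⟩ | ⟨d1, d2, y, hy, ⟨hst, hst'⟩, -⟩ := hadj.steps hs
    · obtain rfl : y = x := hy.trans hsum
      have g1 : fr .a1 = 1 := by rw [h1, d1]; push_cast; ring
      have g2 : fr .a2 = -1 := by rw [h2, d2]; push_cast; ring
      have g3 : fr .a3 = 0 := by rw [h3, heq]; ring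
      rw [g1] at hv
      refine Runs.time (Runs.ite_true (by simp [eval_isDiffUpToSign, g1, g2, g3])
        (one hxK hst (by simp [hv]) (by simp [hf]) (by simp [hx]))) ?_
      simp [nodes_isDiffUpToSign, transpTime]
    · obtain rfl : y = x := hy.trans hsum
      have g1 : fr .a1 = 2 := by rw [h1, d1]; push_cast; ring
      have g2 : fr .a2 = -2 := by rw [h2, d2]; push_cast; ring
      have g3 : fr .a3 = 0 := by rw [h3, heq]; ring
      rw [g1] at hv
      refine Runs.time (Runs.ite_false (by simp [eval_isDiffUpToSign, g1, g2, g3])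
        (Runs.ite_true (by simp [eval_isDiffUpToSign, g1, g2, g3])
        (two hxK hxK hst hst' (by simp [hv]) (by simp [hf]) (by simp [hx])
          fun m' _ => ⟨by simp [hv], by simp [hf], by simp [hx]⟩))) ?_
      simp [nodes_isDiffUpToSign, transpTime]
  · have heq := hadj.eq_off (f + 2) (by omega) (by omega)
    obtain ⟨d1, d2, y, hy, -, hst⟩ | ⟨d1, d2, y, hy, -, hst, hst'⟩ := hadj.steps hb
    · obtain rfl : y = x := hy.trans hxs.symm
      have g1 : fr .a1 = -1 := by rw [h1, d1]; push_cast; ring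
      have g2 : fr .a2 = 1 := by rw [h2, d2]; push_cast; ring
      have g3 : fr .a3 = 0 := by rw [h3, heq]; ring
      rw [g1] at hv
      refine Runs.time (Runs.ite_true (by simp [eval_isDiffUpToSign, g1, g2, g3])
        (one hxK hst (by simp [hv]) (by simp [hf]) (by simp [hx]))) ?_
      simp [nodes_isDiffUpToSign, transpTime]
    · obtain rfl : y = x := hy.trans hxs.symm
      have g1 : fr .a1 = -2 := by rw [h1, d1]; push_cast; ring
      have g2 : fr .a2 = 2 := by rw [h2, d2]; push_cast; ring
      have g3 : fr .a3 = 0 := by rw [h3, heq]; ring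
      rw [g1] at hv
      refine Runs.time (Runs.ite_false (by simp [eval_isDiffUpToSign, g1, g2, g3])
        (Runs.ite_true (by simp [eval_isDiffUpToSign, g1, g2, g3])
        (two hxK hxK hst hst' (by simp [hv]) (by simp [hf]) (by simp [hx])
          fun m' _ => ⟨by simp [hv], by simp [hf], by simp [hx]⟩))) ?_
      simp [nodes_isDiffUpToSign, transpTime]
  · have hf2 := hadj.two_le
    have hlt := hadj.lt
    have haf : s f = f - 1 := hadj.prefix_eq f le_rfl
    have hbf := hadj.diff_first
    have hT : triangle f = triangle (f - 1) + (f - 1) := triangle_eq_pred (by omega)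
    have hsum : triangle (f - 1) = x := by
      rw [hxs, ← hadj.sum_eq]
      exact Finset.sum_congr rfl fun i hi => hadj.eq_off i (by simp at hi; omega)
        (by simp at hi; omega) (by simp at hi; omega)
    have hTK : triangle f ≤ K := by
      have h4 := sum_range_le (a := s) (show f + 1 ≤ n + 1 by omega)
      rw [sum_range_succ, hadj.sum_eq] at h4
      omega
    have hmf : ∀ m', Rep n K c (moveUp f s) m' → m'.arr .s f = ((f - 2 : ℕ) : ℤ) := fun m' hR => by
      rw [hR.s_eq f (by omega) (by omega), moveUp_fst]
      congr 1; omega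
    have hbf' : ∀ (t : ℕ → ℕ), t f = f - 2 → ∀ m', Rep n K c t m' →
        m'.arr .s f = ((f - 2 : ℕ) : ℤ) := fun t ht m' hR => by
      rw [hR.s_eq f (by omega) (by omega), ht]
    have g1 : fr .a1 = 1 := by rw [h1]; omega
    rw [g1] at hv
    rw [if_pos le_rfl] at hv
    have mid : moveUp f s f = f - 2 := by rw [moveUp_fst]; omega
    obtain ⟨d1, d2, ⟨hst, hst'⟩, -⟩ | ⟨d1, d2, ⟨hst, hst', hst''⟩, -⟩ | ⟨d1, d2, ⟨hst, hst'⟩, -⟩ :=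
      hadj.steps hs hb
    · have g2 : fr .a2 = -2 := by rw [h2, d1]; push_cast; ring
      have g3 : fr .a3 = 1 := by rw [h3, d2]; push_cast; ring
      refine Runs.time (Runs.ite_false (by simp [eval_isDiffUpToSign, g1, g2, g3])
        (Runs.ite_false (by simp [eval_isDiffUpToSign, g1, g2, g3])
        (Runs.ite_true (by simp [eval_isDiffUpToSign, g1, g2, g3])
        (two (hsum ▸ hxK) (by omega) hst hst' (by simp [hv]) (by simp [hf]) (by simp [hx, hsum])
          fun m' hR => ⟨by simp [hv], by simp [hf], by
            simp [hx, hf, hsum, hbf' _ mid m' hR]⟩)))) ?_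
      simp [nodes_isDiffUpToSign, transpTime]
    · have g2 : fr .a2 = -3 := by rw [h2, d1]; push_cast; ring
      have g3 : fr .a3 = 2 := by rw [h3, d2]; push_cast; ring
      have mid' : moveDown (f + 1) (moveUp f s) f = f - 2 := by
        rw [moveDown_off _ (by omega) (by omega), mid]
      refine Runs.time (Runs.ite_false (by simp [eval_isDiffUpToSign, g1, g2, g3])
        (Runs.ite_false (by simp [eval_isDiffUpToSign, g1, g2, g3])
        (Runs.ite_false (by simp [eval_isDiffUpToSign, g1, g2, g3])
        (Runs.ite_true (by simp [eval_isDiffUpToSign, g1, g2, g3])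
        (three (hsum ▸ hxK) (by omega) hst hst' hst'' (by simp [hv]) (by simp [hf])
          (by simp [hx, hsum])
          (fun m' hR => ⟨by simp [hv], by simp [hf], by simp [hx, hf, hsum, hbf' _ mid m' hR]⟩)
          fun m' hR => ⟨by simp [hv], by simp [hf], by
            simp [hx, hf, hsum, hbf' _ mid' m' hR]⟩))))) ?_
      simp [nodes_isDiffUpToSign, transpTime]
    · have g2 : fr .a2 = 0 := by rw [h2, d1]; ring
      have g3 : fr .a3 = -1 := by rw [h3, d2]; push_cast; ring
      refine Runs.time (Runs.ite_false (by simp [eval_isDiffUpToSign, g1, g2, g3])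
        (Runs.ite_false (by simp [eval_isDiffUpToSign, g1, g2, g3])
        (Runs.ite_false (by simp [eval_isDiffUpToSign, g1, g2, g3])
        (Runs.ite_false (by simp [eval_isDiffUpToSign, g1, g2, g3])
        (Runs.ite_false (by simp [eval_isDiffUpToSign, g1, g2, g3])
        (Runs.ite_true (by simp [eval_isDiff, g1, g2, g3])
        (two (hsum ▸ hxK) (by omega) hst hst' (by simp) (by simp [hf]) (by simp [hx, hsum])
          fun m' hR => ⟨by simp, by simp [hf], by
            simp [hx, hf, hsum, hbf' _ mid m' hR]⟩))))))) ?_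
      simp [nodes_isDiffUpToSign, nodes_isDiff, transpTime]
  · have hf2 := hadj.two_le
    have hlt := hadj.lt
    have hbf : b f = f - 1 := hadj.prefix_eq f le_rfl
    have hsf := hadj.diff_first
    have hT : triangle f = triangle (f - 1) + (f - 1) := triangle_eq_pred (by omega)
    have hsum : triangle (f - 1) = x := by rw [hxs, ← hadj.sum_eq]
    have hTK : triangle f ≤ K := by
      have h4 := sum_range_le (a := b) (show f + 1 ≤ n + 1 by omega)
      rw [sum_range_succ, hadj.sum_eq] at h4
      omega
    have hrd : ∀ (t : ℕ → ℕ) (z : ℕ), t f = z → ∀ m', Rep n K c t m' →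
        m'.arr .s f = (z : ℤ) := fun t z ht m' hR => by
      rw [hR.s_eq f (by omega) (by omega), ht]
    have hxT : ((x : ℕ) : ℤ) + ((f - 1 : ℕ) : ℤ) = (triangle f : ℕ) := by
      rw [hT, hsum]; push_cast; ring
    have g1 : fr .a1 = -1 := by rw [h1]; omega
    rw [g1] at hv
    rw [if_neg (by norm_num)] at hv
    have mid : moveDown f s f = f - 1 := by rw [moveDown_fst]; omega
    obtain ⟨d1, d2, -, hst, hst'⟩ | ⟨d1, d2, -, hst, hst', hst''⟩ | ⟨d1, d2, -, hst, hst'⟩ :=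
      hadj.steps hb hs
    · have g2 : fr .a2 = 2 := by rw [h2, d1]; push_cast; ring
      have g3 : fr .a3 = -1 := by rw [h3, d2]; push_cast; ring
      refine Runs.time (Runs.ite_false (by simp [eval_isDiffUpToSign, g1, g2, g3])
        (Runs.ite_false (by simp [eval_isDiffUpToSign, g1, g2, g3])
        (Runs.ite_true (by simp [eval_isDiffUpToSign, g1, g2, g3])
        (two (hsum ▸ hxK) (by omega) hst hst' (by simp [hv]) (by simp [hf]) (by simp [hx, hsum])
          fun m' hR => ⟨by simp [hv], by simp [hf], by
            simp [hx, hf, hxT, hrd _ _ mid m' hR]⟩)))) ?_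
      simp [nodes_isDiffUpToSign, transpTime]
    · have g2 : fr .a2 = 3 := by rw [h2, d1]; push_cast; ring
      have g3 : fr .a3 = -2 := by rw [h3, d2]; push_cast; ring
      have mid' : moveUp (f + 1) (moveDown f s) f = f - 1 := by
        rw [moveUp_off _ (by omega) (by omega), mid]
      refine Runs.time (Runs.ite_false (by simp [eval_isDiffUpToSign, g1, g2, g3])
        (Runs.ite_false (by simp [eval_isDiffUpToSign, g1, g2, g3])
        (Runs.ite_false (by simp [eval_isDiffUpToSign, g1, g2, g3])
        (Runs.ite_true (by simp [eval_isDiffUpToSign, g1, g2, g3])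
        (three (hsum ▸ hxK) (by omega) hst hst' hst'' (by simp [hv]) (by simp [hf])
          (by simp [hx, hsum])
          (fun m' hR => ⟨by simp [hv], by simp [hf], by simp [hx, hf, hxT, hrd _ _ mid m' hR]⟩)
          fun m' hR => ⟨by simp [hv], by simp [hf], by
            simp [hx, hf, hxT, hrd _ _ mid' m' hR]⟩))))) ?_
      simp [nodes_isDiffUpToSign, transpTime]
    · have g2 : fr .a2 = 0 := by rw [h2, d1]; ring
      have g3 : fr .a3 = 1 := by rw [h3, d2]; push_cast; ring
      have hxs' := hrd _ _ hsf m h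
      refine Runs.time (Runs.ite_false (by simp [eval_isDiffUpToSign, g1, g2, g3])
        (Runs.ite_false (by simp [eval_isDiffUpToSign, g1, g2, g3])
        (Runs.ite_false (by simp [eval_isDiffUpToSign, g1, g2, g3])
        (Runs.ite_false (by simp [eval_isDiffUpToSign, g1, g2, g3])
        (Runs.ite_false (by simp [eval_isDiffUpToSign, g1, g2, g3])
        (Runs.ite_false (by simp [eval_isDiff, g1, g2, g3])
        (Runs.ite_true (by simp [eval_isDiff, g1, g2, g3])
        (two (by omega) (hsum ▸ hxK) hst hst' (by simp) (by simp [hf])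
          (by simp [hx, hf, hsum, hxs'])
          fun m' hR => ⟨by simp, by simp [hf], by simp [hx, hsum]⟩)))))))) ?_
      simp [nodes_isDiffUpToSign, nodes_isDiff, transpTime]

/-- `Update_Perm(p, u)` replaces the current sequence `s` by the sequence `b` that is completed in
the array `c`, provided that `s` and `b` are adjacent with last difference at `p`, and that `c`
already contains the entries of `b` from position `p - 2` on. -/
theorem runs_updatePerm {n K p u : ℕ} {c s b : ℕ → ℕ} {m : Mem} (h : Rep n K c s m)
    (hs : ∀ i, s i ≤ i - 1) (hb : ∀ i, b i ≤ i - 1) (hsK : ∑ i ∈ range (n + 1), s i = K)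
    (hbK : ∑ i ∈ range (n + 1), b i = K) (hadj : Adj n p s b) (hu : u = ∑ i ∈ range (p + 1), b i)
    (hc : ∀ i, p ≤ i + 2 → i ≤ n → c i = b i) :
    Runs Proc.updatePerm.body (bindParams Proc.updatePerm.params [p, u]) m updateTime
      fun _ m' => Rep n K c b m' ∧ m'.out = m.out := by
  have hp3 : 3 ≤ p ∧ p ≤ n := by
    obtain ⟨f, ⟨rfl, h | h⟩ | ⟨rfl, h | h⟩⟩ := hadj <;>
      exact ⟨by have := h.two_le; omega, by have := h.lt; omega⟩
  obtain ⟨hp3, hpn⟩ := hp3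
  obtain ⟨q, rfl⟩ : ∃ q, p = q + 2 := ⟨p - 2, by omega⟩
  obtain ⟨f, hf⟩ := hadj
  -- the position `f` computed by the program
  have hfq : f = if s q = b q then q + 1 else q := by
    obtain ⟨h1, h | h⟩ | ⟨h1, h | h⟩ := hf
    · rw [if_pos (h.eq_off q (by omega) (by omega))]; omega
    · rw [if_pos (h.eq_off q (by omega) (by omega)).symm]; omega
    · obtain rfl : f = q := by omega
      have := h.prefix_eq f le_rfl
      have := h.diff_first
      have := h.two_le
      rw [if_neg (by omega)]
    · obtain rfl : f = q := by omega
      have := h.prefix_eq f le_rfl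
      have := h.diff_first
      have := h.two_le
      rw [if_neg (by omega)]
  have hfn : f + 1 ≤ n ∧ q ≤ f ∧ f ≤ q + 1 ∧ (n < f + 2 → s (f + 2) = b (f + 2)) := by
    obtain ⟨h1, h | h⟩ | ⟨h1, h | h⟩ := hf
    · exact ⟨h.lt, by omega, by omega, fun _ => h.eq_off _ (by omega) (by omega)⟩
    · exact ⟨h.lt, by omega, by omega, fun _ => (h.eq_off _ (by omega) (by omega)).symm⟩
    · exact ⟨by have := h.lt; omega, by omega, by omega, fun _ => by have := h.lt; omega⟩
    · exact ⟨by have := h.lt; omega, by omega, by omega, fun _ => by have := h.lt; omega⟩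
  obtain ⟨hfn, hqf, hfq', hlast⟩ := hfn
  have hcr : ∀ i : ℕ, q ≤ i → i ≤ n → m.arr .c i = b i := fun i h1 h2 => by
    rw [h.c_eq, hc i (by omega) h2]
  have hsr : ∀ i : ℕ, q ≤ i → i ≤ n → m.arr .s i = s i := fun i h1 h2 => h.s_eq i (by omega) h2
  have hx : u = (∑ i ∈ range q, b i) + b q + b (q + 1) + b (q + 2) := by
    rw [hu, sum_range_succ, sum_range_succ, sum_range_succ]
  have e1 : ((q + 2 : ℕ) : ℤ) - 2 = (q : ℕ) := by push_cast; ring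
  have e2 : ((q + 2 : ℕ) : ℤ) - 1 = (q + 1 : ℕ) := by push_cast; ring
  apply Runs.time
  · apply Runs.ite_false
    · simp [bindParams, Proc.params]; omega
    apply Runs.assign_seq (z := ((∑ i ∈ range q, b i) + b q : ℕ))
    · have h1 := hcr (q + 2) (by omega) hpn
      have h2 := hcr (q + 1) (by omega) (by omega)
      rw [← e2] at h2
      simp only [bindParams, Proc.params, Expr.eval_sub, Expr.eval_read, Expr.eval_var,
        Expr.eval_ofNat, Function.update_apply, reduceCtorEq, if_true, if_false]
      rw [show ((OfNat.ofNat 1 : ℕ) : ℤ) = 1 from rfl, h1, h2, hx]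
      push_cast; ring
    set fr : Frame := Function.update (bindParams Proc.updatePerm.params [((q + 2 : ℕ) : ℤ), u]) .x
      ((∑ i ∈ range q, b i) + b q : ℕ) with hfr
    have hfp : fr .p = (q + 2 : ℕ) := by simp [hfr, bindParams, Proc.params]
    have hfx : fr .x = ((∑ i ∈ range q, b i) + b q : ℕ) := by simp [hfr]
    clear_value fr
    apply Runs.seq_of (T₁ := 50) (R := fun fr' m' => m = m' ∧ fr' .f = f ∧
      fr' .x = (∑ i ∈ range f, b i : ℕ))
    · have hsq := hsr q le_rfl (by omega)
      have hcq := hcr q le_rfl (by omega)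
      by_cases hq : s q = b q
      · rw [if_pos hq] at hfq
        refine Runs.time (Runs.ite_true ?_ (Runs.assign ⟨rfl, ?_, ?_⟩)) ?_
        · simp only [Expr.eval_and, Expr.eval_le, Expr.eval_eq, Expr.eval_sub, Expr.eval_read,
            Expr.eval_var, Expr.eval_ofNat, hfp]
          rw [show ((OfNat.ofNat 1 : ℕ) : ℤ) = 1 from rfl,
            show ((OfNat.ofNat 2 : ℕ) : ℤ) = 2 from rfl,
            e1, hsq, hcq, hq]
          rw [if_pos (by omega)]
          simp
        · simp [hfp, hfq]; ring
        · simp [hfx, hfq, sum_range_succ]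
        · simp
      · rw [if_neg hq] at hfq
        refine Runs.time (Runs.ite_false ?_ (Runs.assign_seq (z := (q : ℕ)) ?_ (Runs.assign
          ⟨rfl, ?_, ?_⟩))) ?_
        · simp only [Expr.eval_and, Expr.eval_le, Expr.eval_eq, Expr.eval_sub, Expr.eval_read,
            Expr.eval_var, Expr.eval_ofNat, hfp]
          rw [show ((OfNat.ofNat 1 : ℕ) : ℤ) = 1 from rfl,
            show ((OfNat.ofNat 2 : ℕ) : ℤ) = 2 from rfl,
            e1, hsq, hcq, if_pos (by omega)]
          simp; exact_mod_cast hq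
        · simp [hfp]
        · simp [hfq]
        · simp [hfx, hfq, hcq]
        · simp
    rintro fr' m' ⟨rfl, hff, hfx'⟩
    have hcf := hcr f hqf (by omega)
    have hsf := hsr f hqf (by omega)
    have hcf1 := hcr (f + 1) (by omega) (by omega)
    have hsf1 := hsr (f + 1) (by omega) (by omega)
    push_cast at hcf1 hsf1
    apply Runs.assign_seq (z := s f - b f)
    · simp [hff, hcf, hsf]
    apply Runs.assign_seq (z := s (f + 1) - b (f + 1))
    · simp [hff, hcf1, hsf1]
    apply Runs.seq_of (T₁ := 30) (R := fun fr'' m' => m = m' ∧ fr'' .f = f ∧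
      fr'' .x = (∑ i ∈ range f, b i : ℕ) ∧ fr'' .a1 = s f - b f ∧
      fr'' .a2 = s (f + 1) - b (f + 1) ∧ fr'' .a3 = s (f + 2) - b (f + 2))
    · by_cases hn : n < f + 2
      · refine Runs.time (Runs.ite_true ?_ (Runs.assign ?_)) ?_
        · simp [h.size, hff]; omega
        · simp [hff, hfx', hlast hn]
        · simp
      · have hcf2 := hcr (f + 2) (by omega) (by omega)
        have hsf2 := hsr (f + 2) (by omega) (by omega)
        push_cast at hcf2 hsf2
        refine Runs.time (Runs.ite_false ?_ (Runs.assign ?_)) ?_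
        · simp [h.size, hff]; omega
        · simp [hff, hfx', hcf2, hsf2]
        · simp
    rintro fr₂ m' ⟨rfl, h1, h2, h3, h4, h5⟩
    apply Runs.seq_of (T₁ := 10) (R := fun fr'' m' => m = m' ∧ fr'' .f = f ∧
      fr'' .x = (∑ i ∈ range f, b i : ℕ) ∧ fr'' .a1 = s f - b f ∧
      fr'' .a2 = s (f + 1) - b (f + 1) ∧ fr'' .a3 = s (f + 2) - b (f + 2) ∧
      fr'' .v = if 1 ≤ fr'' .a1 then 1 else -1)
    · by_cases h6 : 1 ≤ fr₂ .a1
      · refine Runs.time (Runs.ite_true (by simp [h6]) (Runs.assign ?_)) ?_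
        · simp [h1, h2, h3, h4, h5]; omega
        · simp
      · refine Runs.time (Runs.ite_false (by simp [h6]) (Runs.assign ?_)) ?_
        · simp [h1, h2, h3, h4, h5]; omega
        · simp
    rintro fr₃ m' ⟨rfl, h1, h2, h3, h4, h5, h6⟩
    exact runs_dispatch h hs hb hsK hbK hf h1 h2 rfl h3 h4 h5 h6
  · simp [updateTime]

/-- For `p = 0` the procedure `Update_Perm` does nothing. -/
theorem runs_updatePerm_zero {u : ℤ} {m : Mem} :
    Runs Proc.updatePerm.body (bindParams Proc.updatePerm.params [0, u]) m updateTime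
      fun _ m' => m' = m := by
  apply Runs.time
  · apply Runs.ite_true
    · simp [bindParams, Proc.params]
    · exact Runs.skip rfl
  · simp [updateTime]

/-! ### The specification of `Gen2_Gray` -/

/-- The printed form of a list of sequences. -/
def outs (n : ℕ) (L : List (ℕ → ℕ)) : List (ℤ → ℤ) := L.map fun a => permArr (psi (seqOf n a))

theorem outs_append (n : ℕ) (L L' : List (ℕ → ℕ)) : outs n (L ++ L') = outs n L ++ outs n L' :=
  List.map_append

/-- `s` is a subexcedant sequence of weight `K`. -/
structure HasWeight (n K : ℕ) (s : ℕ → ℕ) : Prop where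
  subexcedant : ∀ i, s i ≤ i - 1
  sum_eq : ∑ i ∈ range (n + 1), s i = K

theorem Node.hasWeight_headSeq {n K k r d : ℕ} {c : ℕ → ℕ} (h : Node n k r c) (hd : d < 2)
    (hK : k + ∑ i ∈ range (n + 1), c i = K) : HasWeight n K (headSeq d k r c) :=
  ⟨(headSeq_below h hd).subexcedant, (headSeq_below h hd).sum_eq.trans hK⟩

/-- The parameters `p` and `u` describe how the first sequence `b` of a call with parameter `r`
arises from the current sequence `s`: for `p = 0` they are equal, otherwise `p` is the last position
where they differ, and `u` is the sum of the entries of `b` up to position `p`. -/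
def Start (n r p u : ℕ) (s b : ℕ → ℕ) : Prop :=
  p = 0 ∧ s = b ∨ r ≤ p ∧ Adj n p s b ∧ u = ∑ i ∈ range (p + 1), b i

/-- The leaves, the nodes with at least two children, and the nodes of maximal weight. A node
without this property has an only child that has it (`Inner.credit_only_child`), so that the steps
of its activation can be charged to the child. -/
def Bonus (k r : ℕ) (c : ℕ → ℕ) : Prop :=
  k = 0 ∨ tri k < adjust r c ∨ k = triangle (adjust r c)

open Classical in
/-- The number of steps that a call leaves for its parent, if the parent has no other child. -/
noncomputable def credit (k r : ℕ) (c : ℕ → ℕ) : ℕ := if Bonus k r c then 250 else 0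

/-- The parameter that bounds how long `p` can be inherited: calls with `p` at least three larger
stop if the weight is maximal. In direction `0` the first child has position `tri k`, which matters
for the main call, where `p = 0` is inherited from the start. -/
def reach (d k r : ℕ) (c : ℕ → ℕ) : ℕ := if d = 0 then tri k else adjust r c

/-- The call `Gen2_Gray(k, r, d, p, u)` lists the sequences below a node, and its number of steps
is bounded by a multiple of the number of these sequences, up to a correction. The credit `250` covers
the steps of one activation apart from its calls and rounds, and `400` covers these and the credit.
Besides its own steps, a round must leave `1600` and pay up to `3 * 400` for the reach of its call,
which adds up to less than `2950`; then `5000` also covers the output at a leaf. -/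
def Correct (n K k r : ℕ) (c : ℕ → ℕ) : Prop :=
  ∀ d < 2, ∀ (p u : ℕ) (s : ℕ → ℕ) (m : Mem) (T : ℕ), Rep n K c s m → HasWeight n K s →
    Start n r p u s (headSeq d k r c) →
    5000 * (gen1Gray k r d c).length + 400 * (reach d k r c + 3 - p) ≤ T + 2950 + credit k r c →
    Runs Proc.gen2Gray.body (bindParams Proc.gen2Gray.params [(k : ℤ), r, d, p, u]) m T
      fun _ m' => Rep n K c (headSeq (1 - d) k r c) m' ∧
        m'.out = m.out ++ outs n (gen1Gray k r d c)

theorem Node.length_pos {n k r d : ℕ} {c : ℕ → ℕ} (h : Node n k r c) (hd : d < 2) :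
    1 ≤ (gen1Gray k r d c).length := by
  have := head?_gen1Gray h hd
  rcases hL : gen1Gray k r d c with _ | ⟨x, L⟩
  · simp [hL] at this
  · simp

theorem Inner.length_upLoop {n k r : ℕ} {c : ℕ → ℕ} (h : Inner n k r c) (m i d : ℕ) (hd : d < 2)
    (hi : tri k < i) (him : i + m ≤ r + 1) : m ≤ (upLoop k c m i d).length := by
  induction m generalizing i d with
  | zero => exact Nat.zero_le _
  | succ m ih =>
    have h1 := (h.node_high hi (by omega)).length_pos hd
    have h2 := ih (i + 1) ((d + 1) % 2) (by omega) (by omega) (by omega)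
    rw [upLoop, List.length_append]
    omega

theorem Inner.length_downLoop {n k r : ℕ} {c : ℕ → ℕ} (h : Inner n k r c) (m i d : ℕ) (hd : d < 2)
    (hi : tri k + m = i) (hir : i ≤ r) : m ≤ (downLoop k c m i d).length := by
  induction m generalizing i d with
  | zero => exact Nat.zero_le _
  | succ m ih =>
    have h1 := (h.node_high (i := i) (by omega) (by omega)).length_pos hd
    have h2 := ih (i - 1) ((d + 1) % 2) (by omega) (by omega) (by omega)
    rw [downLoop, List.length_append]
    omega

theorem reach_le {n d k r : ℕ} {c : ℕ → ℕ} (h : Node n k r c) (hr : 1 ≤ r) : reach d k r c ≤ r := by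
  have h1 : adjust r c ≤ r := by unfold adjust; split_ifs <;> omega
  unfold reach
  split_ifs
  · exact tri_le hr (by have := h.weight_le; omega)
  · exact h1

theorem Rep.write_c {n K i z : ℕ} {c c' s : ℕ → ℕ} {m : Mem} (h : Rep n K c s m)
    (hi : c' i = z) (hoff : ∀ j, j ≠ i → c' j = c j) : Rep n K c' s (m.write .c i z) := by
  refine ⟨h.size, fun z hz => ?_, ?_, fun j => ?_, fun j h1 h2 => ?_⟩
  · simpa [Mem.write_arr] using h.tri z hz
  · simpa [Mem.write_arr] using h.sigma
  · by_cases hj : j = i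
    · subst hj; simp [Mem.write_arr, hi]
    · simp [Mem.write_arr, hj, hoff j hj, h.c_eq j]
  · simpa [Mem.write_arr] using h.s_eq j h1 h2

theorem Rep.bump {n K : ℕ} {c s : ℕ → ℕ} {m : Mem} (h : Rep n K c s m) (i x : ℕ) :
    Rep n K (bump c i x) s (m.write .c i (c i + x : ℕ)) :=
  h.write_c (bump_self _ _ _) fun _ hj => bump_of_ne hj

theorem Rep.unbump {n K i x : ℕ} {c s : ℕ → ℕ} {m : Mem} (h : Rep n K (MajGray.bump c i x) s m) :
    Rep n K c s (m.write .c i (c i : ℕ)) :=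
  h.write_c rfl fun _ hj => (bump_of_ne hj).symm

theorem runs_gen2Gray_call {n K k r d p u T : ℕ} {c s : ℕ → ℕ} {fr : Frame} {m : Mem}
    {e₁ e₂ e₃ e₄ e₅ : Expr} (h : Correct n K k r c) (hd : d < 2) (hR : Rep n K c s m)
    (hs : HasWeight n K s) (hst : Start n r p u s (headSeq d k r c))
    (hT : 5000 * (gen1Gray k r d c).length + 400 * (reach d k r c + 3 - p) ≤
      T + 2950 + credit k r c)
    (h₁ : e₁.eval fr m = k) (h₂ : e₂.eval fr m = r) (h₃ : e₃.eval fr m = d)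
    (h₄ : e₄.eval fr m = p) (h₅ : e₅.eval fr m = u) :
    Runs (.call .gen2Gray [e₁, e₂, e₃, e₄, e₅]) fr m
      (e₁.nodes + e₂.nodes + e₃.nodes + e₄.nodes + e₅.nodes + 1 + T)
      fun fr' m' => fr = fr' ∧ Rep n K c (headSeq (1 - d) k r c) m' ∧
        m'.out = m.out ++ outs n (gen1Gray k r d c) := by
  refine Runs.time (Runs.call (T := T) ?_) ?_
  · have := h d hd p u s m T hR hs hst hT
    rw [← h₁, ← h₂, ← h₃, ← h₄, ← h₅] at this
    exact this.mono le_rfl fun _ _ h => ⟨rfl, h⟩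
  · simp; omega

/-! ### The loops of `Gen2_Gray` -/

/-- One round of the ascending loop. -/
def upRound : Stmt :=
  let c : Expr → Expr := Expr.read Arr.c
  let i : Expr := Var.i
  let k : Expr := Var.k
  let dir : Expr := Var.dir
  .seq (.block [
    .store Arr.c i (c i + 1),
    .call .gen2Gray [k - 1, i, dir, i, k - 1 + c i],
    .assign Var.dir ((dir + 1) % 2),
    .store Arr.c i (c i - 1)]) (.assign Var.i (Expr.var Var.i + 1))

/-- The ascending loop. Every round has in hand `1600` steps of those that a call saves; they pay
for the activation that contains the loop. -/
theorem runs_upLoop {n K k r : ℕ} {c : ℕ → ℕ} (h : Inner n k r c)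
    (hK : k + ∑ i ∈ range (n + 1), c i = K)
    (ih : ∀ i, tri k < i → i ≤ r → Correct n K (k - 1) i (bump c i 1))
    (m i d : ℕ) (hd : d < 2) (hi : tri k < i) (him : i + m = r + 1) {s : ℕ → ℕ} {mem : Mem}
    {fr : Frame} (hR : Rep n K c s mem) (hs : HasWeight n K s)
    (hadj : 1 ≤ m → Adj n i s (headSeq d (k - 1) i (bump c i 1)))
    (hfk : fr .k = k) (hfr : fr .r = r) (hfi : fr .i = i) (hfd : fr .dir = d) {T : ℕ}
    (hT : 5000 * (upLoop k c m i d).length + 20 ≤ T + 1600 * m) :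
    Runs (.loop (.le (.var .i) (.var .r)) upRound) fr mem T fun _ mem' =>
      Rep n K c ((upLoop k c m i d).getLast?.getD s) mem' ∧
        mem'.out = mem.out ++ outs n (upLoop k c m i d) := by
  induction m generalizing i d s mem fr T with
  | zero =>
    refine Runs.time (Runs.loop_end ?_ ⟨hR, ?_⟩) ?_
    · simp [hfi, hfr]; omega
    · simp [upLoop, outs]
    · simp; omega
  | succ m ihm =>
    have hN := h.node_high hi (by omega)
    have hlen1 := hN.length_pos hd
    have hd' : (d + 1) % 2 < 2 := Nat.mod_lt _ (by norm_num)
    have hlen2 := h.length_upLoop m (i + 1) _ hd' (by omega) (by omega)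
    have hin : i ≤ n := by have := h.le_size; omega
    have hkpos := h.pos
    have hsum : k - 1 + ∑ j ∈ range (n + 1), bump c i 1 j = K := by rw [sum_bump _ _ hin]; omega
    have hreach := reach_le (d := d) hN (by omega)
    have hB := (headSeq_below hN hd).sum_le hN
    rw [upLoop, List.length_append] at hT
    rw [upLoop, outs_append]
    apply Runs.time
    · apply Runs.loop_step
      · simp [hfi, hfr]; omega
      apply Runs.seq
      apply Runs.store_seq (y := i) (z := (c i + 1 : ℕ))
      · simp [hfi]
      · simp [hfi, hR.c_eq]
      apply Runs.seq_of
      · apply runs_gen2Gray_call (ih i hi (by omega)) hd (hR.bump i 1) hs (p := i)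
          (u := k - 1 + (c i + 1))
          (T := 5000 * (gen1Gray (k - 1) i d (bump c i 1)).length + 1200 - 2950)
        · refine Or.inr ⟨le_rfl, hadj (by omega), ?_⟩
          rw [hB, bump_self]
        · omega
        · simp [hfk]; omega
        · simp [hfi]
        · simp [hfd]
        · simp [hfi]
        · simp [hfk, hfi, Mem.write_arr]; omega
      rintro fr' mem' ⟨rfl, hR', hout⟩
      apply Runs.assign_seq (z := ((d + 1) % 2 : ℕ))
      · simp [hfd]
      apply Runs.store_of (y := i) (z := (c i : ℕ))
      · simp [hfi]
      · have := hR'.c_eq i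
        rw [bump_self] at this
        simp [hfi, this]
      apply Runs.assign_of (z := (i + 1 : ℕ))
      · simp [hfi]
      refine (ihm (i + 1) ((d + 1) % 2) hd' (by omega) (by omega) hR'.unbump
        (hN.hasWeight_headSeq (by omega) hsum) ?_ (by simp [hfk]) (by simp [hfr]) (by simp)
        (by simp) (T := 5000 * (upLoop k c m (i + 1) ((d + 1) % 2)).length + 20 - 1600 * m)
        (by omega)).mono le_rfl ?_
      · intro _
        rw [show (d + 1) % 2 = 1 - d by omega]
        exact h.adj_high hi (by omega)
      rintro _ mem'' ⟨h1, h2⟩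
      refine ⟨?_, ?_⟩
      · rw [List.getLast?_append, getLast?_gen1Gray hN hd]
        cases hL : (upLoop k c m (i + 1) ((d + 1) % 2)).getLast? <;> simpa [hL] using h1
      · rw [h2]
        simp [hout]
    · simp
      omega

/-- In direction `1`, the choice of the last two arguments of the call at the position `x`. -/
def chooseArgs (x : Var) : Stmt :=
  let i : Expr := .var x
  let k : Expr := Var.k
  let c : Expr → Expr := Expr.read Arr.c
  .ite (.eq i Var.r)
    (.block [.assign Var.q Var.p, .assign Var.v Var.u])
    (.block [.assign Var.q (i + 1), .assign Var.v (c (i + 1) + k)])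

theorem runs_chooseArgs {n K k r p u i : ℕ} {c s : ℕ → ℕ} {nm : Var} {fr : Frame} {m : Mem}
    (h : Rep n K c s m) (hfk : fr .k = k) (hfr : fr .r = r) (hfp : fr .p = p) (hfu : fr .u = u)
    (hi : fr nm = i) (hnm : nm ≠ .q) :
    Runs (chooseArgs nm) fr m 20 fun fr' m' => m = m' ∧
      fr' = Function.update (Function.update fr .q (if i = r then p else i + 1 : ℕ)) .v
        (if i = r then u else c (i + 1) + k : ℕ) := by
  by_cases hir : i = r
  · subst hir
    apply Runs.time
    · apply Runs.ite_true
      · simp [hi, hfr]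
      · exact Runs.assign_seq (z := p) (by simp [hfp])
          (Runs.assign_of (z := u) (by simp [hfu]) ⟨rfl, by simp⟩)
    · simp
  · have hc := h.c_eq (i + 1)
    push_cast at hc
    apply Runs.time
    · apply Runs.ite_false
      · simp [hi, hfr, hir]
      · exact Runs.assign_seq (z := (i + 1 : ℕ)) (by simp [hi])
          (Runs.assign_of (z := (c (i + 1) + k : ℕ)) (by simp [hi, hnm, hfk, hc])
            ⟨rfl, by simp [hir]⟩)
    · simp

/-- One round of the descending loop. -/
def downRound : Stmt :=
  let c : Expr → Expr := Expr.read Arr.c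
  let i : Expr := Var.i
  let k : Expr := Var.k
  let dir : Expr := Var.dir
  .seq (.block [
    chooseArgs Var.i,
    .store Arr.c i (c i + 1),
    .call .gen2Gray [k - 1, i, dir, Var.q, Var.v],
    .assign Var.dir ((dir + 1) % 2),
    .store Arr.c i (c i - 1)]) (.assign Var.i (Expr.var Var.i - 1))

theorem Inner.sum_headSeq_high {n k r i d : ℕ} {c : ℕ → ℕ} (h : Inner n k r c) (hi : tri k < i)
    (hir : i ≤ r) (hd : d < 2) :
    ∑ j ∈ range (i + 1), headSeq d (k - 1) i (bump c i 1) j = k + c i := by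
  have hN := h.node_high hi hir
  have := (headSeq_below hN hd).sum_le hN
  rw [bump_self] at this
  have := h.pos
  omega

theorem Inner.sum_headSeq_low {n k r d : ℕ} {c : ℕ → ℕ} (h : Inner n k r c) (hd : d < 2) :
    ∑ j ∈ range (tri k + 1), headSeq d (k - rem k) (tri k) (bump c (tri k) (rem k)) j =
      k + c (tri k) := by
  have hN := h.node_low
  have := (headSeq_below hN hd).sum_le hN
  rw [bump_self] at this
  have := h.weight_split
  omega

/-- The descending loop. Only the call at `i = r` inherits the parameter `p` of the activation, and
may have a large reach. -/
theorem runs_downLoop {n K k r p u : ℕ} {c : ℕ → ℕ} (h : Inner n k r c)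
    (hK : k + ∑ i ∈ range (n + 1), c i = K)
    (ih : ∀ i, tri k < i → i ≤ r → Correct n K (k - 1) i (bump c i 1))
    (m i d : ℕ) (hd : d < 2) (hi : tri k + m = i) (hir : i ≤ r) {s : ℕ → ℕ} {mem : Mem}
    {fr : Frame} (hR : Rep n K c s mem) (hs : HasWeight n K s)
    (hadj : 1 ≤ m → Start n i (if i = r then p else i + 1) (if i = r then u else c (i + 1) + k) s
      (headSeq d (k - 1) i (bump c i 1)))
    (hfk : fr .k = k) (hfr : fr .r = r) (hfp : fr .p = p) (hfu : fr .u = u) (hfl : fr .l = tri k)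
    (hfi : fr .i = i) (hfd : fr .dir = d) {T : ℕ}
    (hT : 5000 * (downLoop k c m i d).length + 20 +
      (if i = r ∧ 1 ≤ m then 400 * (r + 3 - p) else 0) ≤ T + 1600 * m) :
    Runs (.loop (.le (.var .l + 1) (.var .i)) downRound) fr mem T fun fr' mem' =>
      (fr' .k = k ∧ fr' .r = r ∧ fr' .p = p ∧ fr' .u = u ∧ fr' .l = tri k ∧ fr' .e = fr .e) ∧
      Rep n K c ((downLoop k c m i d).getLast?.getD s) mem' ∧
        mem'.out = mem.out ++ outs n (downLoop k c m i d) := by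
  induction m generalizing i d s mem fr T with
  | zero =>
    refine Runs.time (Runs.loop_end ?_ ⟨⟨hfk, hfr, hfp, hfu, hfl, rfl⟩, hR, ?_⟩) ?_
    · simp [hfi, hfl]; omega
    · simp [downLoop, outs]
    · simp; omega
  | succ m ihm =>
    have hN := h.node_high (i := i) (by omega) hir
    have hlen1 := hN.length_pos hd
    have hd' : (d + 1) % 2 < 2 := Nat.mod_lt _ (by norm_num)
    have hlen2 := h.length_downLoop m (i - 1) _ hd' (by omega) (by omega)
    have hin : i ≤ n := by have := h.le_size; omega
    have hkpos := h.pos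
    have hsum : k - 1 + ∑ j ∈ range (n + 1), bump c i 1 j = K := by rw [sum_bump _ _ hin]; omega
    have hreach := reach_le (d := d) hN (by omega)
    rw [downLoop, List.length_append] at hT
    simp only [Nat.le_add_left, and_true] at hT
    rw [downLoop, outs_append]
    apply Runs.time
    · apply Runs.loop_step
      · simp [hfi, hfl]; omega
      apply Runs.seq
      apply Runs.seq_of
      · exact runs_chooseArgs hR hfk hfr hfp hfu hfi (by simp)
      rintro fr₁ _ ⟨rfl, hfr₁⟩
      have hk₁ : fr₁ .k = k := by simp [hfr₁, hfk]
      have hr₁ : fr₁ .r = r := by simp [hfr₁, hfr]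
      have hp₁ : fr₁ .p = p := by simp [hfr₁, hfp]
      have hu₁ : fr₁ .u = u := by simp [hfr₁, hfu]
      have hl₁ : fr₁ .l = tri k := by simp [hfr₁, hfl]
      have hi₁ : fr₁ .i = i := by simp [hfr₁, hfi]
      have hd₁ : fr₁ .dir = d := by simp [hfr₁, hfd]
      have he₁ : fr₁ .e = fr .e := by simp [hfr₁]
      have hq₁ : fr₁ .q = (if i = r then p else i + 1 : ℕ) := by rw [hfr₁]; simp
      have hv₁ : fr₁ .v = (if i = r then u else c (i + 1) + k : ℕ) := by rw [hfr₁]; simp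
      clear hfr₁
      apply Runs.store_seq (y := i) (z := (c i + 1 : ℕ))
      · simp [hi₁]
      · simp [hi₁, hR.c_eq]
      apply Runs.seq_of
      · apply runs_gen2Gray_call (ih i (by omega) hir) hd (hR.bump i 1) hs (hadj (by omega))
          (T := 5000 * (gen1Gray (k - 1) i d (bump c i 1)).length + 1200 +
            (if i = r then 400 * (r + 3 - p) else 0) - 2950)
        · split_ifs <;> omega
        · simp [hk₁]; omega
        · simp [hi₁]
        · simp [hd₁]
        · exact hq₁
        · exact hv₁
      rintro _ mem' ⟨rfl, hR', hout⟩
      apply Runs.assign_seq (z := ((d + 1) % 2 : ℕ))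
      · simp [hd₁]
      apply Runs.store_of (y := i) (z := (c i : ℕ))
      · simp [hi₁]
      · have := hR'.c_eq i
        rw [bump_self] at this
        simp [hi₁, this]
      apply Runs.assign_of (z := (i - 1 : ℕ))
      · simp [hi₁]; omega
      have hne : i - 1 ≠ r := by omega
      refine (ihm (i - 1) ((d + 1) % 2) hd' (by omega) (by omega) hR'.unbump
        (hN.hasWeight_headSeq (by omega) hsum) ?_ (by simp [hk₁]) (by simp [hr₁]) (by simp [hp₁])
        (by simp [hu₁]) (by simp [hl₁]) (by simp) (by simp)
        (T := 5000 * (downLoop k c m (i - 1) ((d + 1) % 2)).length + 20 - 1600 * m)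
        (by rw [if_neg (by omega)]; omega)).mono le_rfl ?_
      · intro hm
        rw [if_neg hne, if_neg hne]
        obtain ⟨i, rfl⟩ : ∃ j, i = j + 1 := ⟨i - 1, by omega⟩
        simp only [Nat.add_sub_cancel]
        refine Or.inr ⟨by omega, ?_, ?_⟩
        · rw [show (d + 1) % 2 = 1 - d by omega]
          exact (h.adj_high (by omega) (by omega)).symm
        · have hab := (headSeq_below (h.node_high (i := i) (by omega) (by omega)) hd').eq_above
            (i + 1) (by omega)
          rw [sum_range_succ, h.sum_headSeq_high (by omega) (by omega) hd', hab,
            bump_of_ne (by omega), h.zero_below i (by omega)]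
          omega
      rintro _ mem'' ⟨h0, h1, h2⟩
      refine ⟨by simpa [he₁] using h0, ?_, ?_⟩
      · rw [List.getLast?_append, getLast?_gen1Gray hN hd]
        cases hL : (downLoop k c m (i - 1) ((d + 1) % 2)).getLast? <;> simpa [hL] using h1
      · rw [h2]
        simp [hout]
    · simp
      omega

/-! ### One activation of `Gen2_Gray` -/

theorem Inner.exists_getLast?_downLoop {n k r : ℕ} {c : ℕ → ℕ} (h : Inner n k r c) (m i d : ℕ)
    (hd : d < 2) (hi : tri k + (m + 1) = i) (hir : i ≤ r) :
    ∃ d' < 2, (downLoop k c (m + 1) i d).getLast? =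
      some (headSeq d' (k - 1) (tri k + 1) (bump c (tri k + 1) 1)) := by
  induction m generalizing i d with
  | zero =>
    subst hi
    refine ⟨1 - d, by omega, ?_⟩
    rw [downLoop, downLoop, List.append_nil]
    exact getLast?_gen1Gray (h.node_high (by omega) hir) hd
  | succ m ih =>
    obtain ⟨d', hd', h1⟩ := ih (i - 1) ((d + 1) % 2) (by omega) (by omega) (by omega)
    refine ⟨d', hd', ?_⟩
    rw [downLoop, List.getLast?_append, h1]
    rfl

theorem credit_le (k r : ℕ) (c : ℕ → ℕ) : credit k r c ≤ 250 := by
  unfold credit; split_ifs <;> omega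

theorem Inner.two_le_tri {n k r : ℕ} {c : ℕ → ℕ} (h : Inner n k r c) : 2 ≤ tri k :=
  MajGray.two_le_tri h.pos

/-- The credit of an only child pays for the activation of its parent: either the parent has no
credit of its own to provide, or its weight is maximal and the reach decreases, the parameter `p`
being still too small for the test that would have stopped the recursion. -/
theorem Inner.credit_only_child {n k r d p : ℕ} {c : ℕ → ℕ} (h : Inner n k r c) (hr : tri k = r)
    (hp : ¬ (r + 3 ≤ p ∧ k = triangle r)) :
    400 * (reach d (k - rem k) (tri k) (bump c (tri k) (rem k)) + 3 - p) + credit k r c + 250 ≤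
      400 * (r + 3 - p) + credit (k - rem k) (tri k) (bump c (tri k) (rem k)) := by
  obtain ⟨h1, h2, h3, h4⟩ := h.weight_split
  have h5 := h.two_le
  have h6 := reach_le (d := d) h.node_low (by omega)
  have hw := h.weight_le
  have ht := triangle_eq_pred (show 1 ≤ r by omega)
  rw [h4, hr] at h6 ⊢
  rw [hr] at h1 h3 h4
  have htri : tri (triangle (r - 1)) ≤ r - 1 := MajGray.tri_le (by omega) le_rfl
  have hself : bump c r (rem k) r = c r + rem k := bump_self _ _ _
  have hlow : credit (triangle (r - 1)) r (bump c r (rem k)) = 250 := by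
    unfold credit
    rw [if_pos]
    unfold Bonus adjust
    split_ifs
    · exact .inr (.inr rfl)
    · exact .inr (.inl (by omega))
  by_cases hb : Bonus k r c
  · -- here `k` is the largest possible weight, and the child has a smaller reach
    have hk : k = triangle r := by
      unfold Bonus at hb
      rw [h.adjust_eq] at hb
      have := h.pos
      omega
    have h7 : reach d (triangle (r - 1)) r (bump c r (rem k)) ≤ r - 1 := by
      unfold reach adjust
      split_ifs <;> omega
    have := credit_le k r c
    omega
  · have : credit k r c = 0 := if_neg hb
    omega

theorem Inner.reach_eq {n d k r : ℕ} {c : ℕ → ℕ} (h : Inner n k r c) :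
    reach d k r c = if d = 0 then tri k else r := by
  rw [reach, h.adjust_eq]

/-- The part of the body of `Gen2_Gray` for direction `0`. -/
def upBranch : Stmt :=
  let c : Expr → Expr := Expr.read Arr.c
  let l : Expr := Var.l
  let e : Expr := Var.e
  let k : Expr := Var.k
  let r : Expr := Var.r
  .block [
    .store Arr.c l (c l + e),
    .call .gen2Gray [k - e, l, 0, Var.p, Var.u],
    .store Arr.c l (c l - e),
    .assign Var.dir ((r - l) % 2),
    .seq (.assign Var.i (l + 1)) (.loop (.le (.var .i) (.var .r)) upRound)]

/-- The part of the body of `Gen2_Gray` for direction `1`. -/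
def downBranch : Stmt :=
  let c : Expr → Expr := Expr.read Arr.c
  let l : Expr := Var.l
  let e : Expr := Var.e
  let k : Expr := Var.k
  let r : Expr := Var.r
  .block [
    .assign Var.dir 0,
    .seq (.assign Var.i r) (.loop (.le (.var .l + 1) (.var .i)) downRound),
    chooseArgs Var.l,
    .store Arr.c l (c l + e),
    .call .gen2Gray [k - e, l, 1, Var.q, Var.v],
    .store Arr.c l (c l - e)]

theorem Start.mono {n r r' p u : ℕ} {s b : ℕ → ℕ} (h : Start n r p u s b) (hr : r' ≤ r) :
    Start n r' p u s b :=
  h.imp id fun h => ⟨hr.trans h.1, h.2⟩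

theorem Inner.sum_low {n K k r : ℕ} {c : ℕ → ℕ} (h : Inner n k r c)
    (hK : k + ∑ i ∈ range (n + 1), c i = K) :
    k - rem k + ∑ i ∈ range (n + 1), bump c (tri k) (rem k) i = K := by
  have := h.weight_split
  rw [sum_bump _ _ (h.tri_le.trans h.le_size)]
  omega

theorem runs_upBranch {n K k r p u : ℕ} {c : ℕ → ℕ} (h : Inner n k r c)
    (hK : k + ∑ i ∈ range (n + 1), c i = K)
    (ihl : Correct n K (k - rem k) (tri k) (bump c (tri k) (rem k)))
    (ih : ∀ i, tri k < i → i ≤ r → Correct n K (k - 1) i (bump c i 1))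
    {s : ℕ → ℕ} {m : Mem} {fr : Frame} (hR : Rep n K c s m) (hs : HasWeight n K s)
    (hst : Start n r p u s (headSeq 0 k r c)) (hleaf : ¬ (r + 3 ≤ p ∧ k = triangle r))
    (hfk : fr .k = k) (hfr : fr .r = r) (hfp : fr .p = p) (hfu : fr .u = u) (hfl : fr .l = tri k)
    (hfe : fr .e = rem k) {T : ℕ}
    (hT : 5000 * (gen1Gray k r 0 c).length + 400 * (tri k + 3 - p) ≤ T + 3060 + credit k r c) :
    Runs upBranch fr m T fun _ m' => Rep n K c (headSeq 1 k r c) m' ∧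
      m'.out = m.out ++ outs n (gen1Gray k r 0 c) := by
  obtain ⟨h1, h2, h3, h4⟩ := h.weight_split
  have hN := h.node_low
  have htr := h.tri_le
  have hlen := hN.length_pos (d := 0) (by norm_num)
  have htl := h.two_le_tri
  have hlast := getLast?_gen1Gray h.toNode (d := 0) (by norm_num)
  rw [gen1Gray_up h.pos, h.adjust_eq] at hT hlast ⊢
  rw [List.getLast?_append, getLast?_gen1Gray hN (by norm_num)] at hlast
  rw [List.length_append] at hT
  have hmod : (r - tri k) % 2 < 2 := Nat.mod_lt _ (by norm_num)
  have hlen2 := h.length_upLoop (r - tri k) (tri k + 1) _ hmod (by omega) (by omega)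
  have hreach := reach_le (d := 0) hN (by omega)
  have hcr := credit_le k r c
  have hcr2 := credit_le (k - rem k) (tri k) (bump c (tri k) (rem k))
  have honly := fun hr => h.credit_only_child (d := 0) (p := p) hr hleaf
  apply Runs.time
  · apply Runs.store_seq (y := tri k) (z := (c (tri k) + rem k : ℕ))
    · simp [hfl]
    · simp [hfl, hfe, hR.c_eq]
    apply Runs.seq_of
    · apply runs_gen2Gray_call ihl (d := 0) (p := p) (u := u) (by norm_num) (hR.bump _ _) hs (T :=
        5000 * (gen1Gray (k - rem k) (tri k) 0 (bump c (tri k) (rem k))).length +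
          400 * (reach 0 (k - rem k) (tri k) (bump c (tri k) (rem k)) + 3 - p) - 2950 -
          credit (k - rem k) (tri k) (bump c (tri k) (rem k)))
      · have : headSeq 0 (k - rem k) (tri k) (bump c (tri k) (rem k)) = headSeq 0 k r c :=
          h.firstSeq_low
        rw [this]
        exact hst.mono htr
      · omega
      · simp [hfk, hfe]; omega
      · simp [hfl]
      · simp
      · simp [hfp]
      · simp [hfu]
    rintro _ m' ⟨rfl, hR', hout⟩
    apply Runs.store_seq (y := tri k) (z := (c (tri k) : ℕ))
    · simp [hfl]
    · have := hR'.c_eq (tri k)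
      rw [bump_self] at this
      simp [hfl, hfe, this]
    apply Runs.assign_seq (z := ((r - tri k) % 2 : ℕ))
    · simp [hfr, hfl]; omega
    apply Runs.assign_seq (z := (tri k + 1 : ℕ))
    · simp [hfl]
    refine (runs_upLoop h hK ih (r - tri k) (tri k + 1) _ hmod (by omega) (by omega) hR'.unbump
      (hN.hasWeight_headSeq (by norm_num) (h.sum_low hK)) (fun hm => h.adj_low (by omega))
      (by simp [hfk]) (by simp [hfr]) (by simp) (by simp)
      (T := 5000 * (upLoop k c (r - tri k) (tri k + 1) ((r - tri k) % 2)).length + 20 -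
        1600 * (r - tri k)) (by omega)).mono le_rfl ?_
    rintro _ m'' ⟨h5, h6⟩
    refine ⟨?_, ?_⟩
    · convert h5 using 1
      cases hL : (upLoop k c (r - tri k) (tri k + 1) ((r - tri k) % 2)).getLast? <;>
        rw [hL] at hlast <;> simpa using hlast.symm
    · rw [h6, outs_append]
      simp [hout]
  · simp
    rcases htr.eq_or_lt with hr | hr
    · have := honly hr
      omega
    · omega

theorem runs_downBranch {n K k r p u : ℕ} {c : ℕ → ℕ} (h : Inner n k r c)
    (hK : k + ∑ i ∈ range (n + 1), c i = K)
    (ihl : Correct n K (k - rem k) (tri k) (bump c (tri k) (rem k)))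
    (ih : ∀ i, tri k < i → i ≤ r → Correct n K (k - 1) i (bump c i 1))
    {s : ℕ → ℕ} {m : Mem} {fr : Frame} (hR : Rep n K c s m) (hs : HasWeight n K s)
    (hst : Start n r p u s (headSeq 1 k r c)) (hleaf : ¬ (r + 3 ≤ p ∧ k = triangle r))
    (hfk : fr .k = k) (hfr : fr .r = r) (hfp : fr .p = p) (hfu : fr .u = u) (hfl : fr .l = tri k)
    (hfe : fr .e = rem k) {T : ℕ}
    (hT : 5000 * (gen1Gray k r 1 c).length + 400 * (r + 3 - p) ≤ T + 3060 + credit k r c) :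
    Runs downBranch fr m T fun _ m' => Rep n K c (headSeq 0 k r c) m' ∧
      m'.out = m.out ++ outs n (gen1Gray k r 1 c) := by
  obtain ⟨h1, h2, h3, h4⟩ := h.weight_split
  have hN := h.node_low
  have htr := h.tri_le
  have hlen := hN.length_pos (d := 1) (by norm_num)
  have htl := h.two_le_tri
  have hhead := head?_gen1Gray h.toNode (d := 1) (by norm_num)
  rw [gen1Gray_down h.pos, h.adjust_eq] at hT hhead ⊢
  rw [List.length_append] at hT
  have hlen2 := h.length_downLoop (r - tri k) r 0 (by norm_num) (by omega) le_rfl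
  have hreach := reach_le (d := 1) hN (by omega)
  have hcr := credit_le k r c
  have hcr2 := credit_le (k - rem k) (tri k) (bump c (tri k) (rem k))
  have honly := fun hr => h.credit_only_child (d := 1) (p := p) hr hleaf
  -- the sequence with which the last call begins
  set s' := (downLoop k c (r - tri k) r 0).getLast?.getD s with hs'
  have hstart : HasWeight n K s' ∧ Start n (tri k) (if tri k = r then p else tri k + 1)
      (if tri k = r then u else c (tri k + 1) + k) s'
      (headSeq 1 (k - rem k) (tri k) (bump c (tri k) (rem k))) := by
    rcases htr.eq_or_lt with hr | hr
    · rw [hr, Nat.sub_self, downLoop] at hs' hhead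
      rw [List.nil_append, head?_gen1Gray (hr ▸ hN) (by norm_num)] at hhead
      have hss : s' = s := hs'
      rw [if_pos hr, if_pos hr, hss, hr]
      refine ⟨hs, ?_⟩
      simp only [Option.some.injEq] at hhead
      rw [hhead]
      exact hst
    · obtain ⟨d', hd', hl⟩ := h.exists_getLast?_downLoop (r - tri k - 1) r 0 (by norm_num)
        (by omega) le_rfl
      rw [show r - tri k - 1 + 1 = r - tri k by omega] at hl
      rw [hl, Option.getD_some] at hs'
      have hN' := h.node_high (i := tri k + 1) (by omega) (by omega)
      rw [if_neg hr.ne, if_neg hr.ne, hs']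
      refine ⟨hN'.hasWeight_headSeq hd' ?_, Or.inr ⟨by omega, (h.adj_low hr).symm, ?_⟩⟩
      · rw [sum_bump _ _ hN'.le_size]
        have := h.pos
        omega
      · rw [sum_range_succ, h.sum_headSeq_low (by norm_num),
          (headSeq_below hN (by norm_num)).eq_above _ (by omega), bump_of_ne (by omega),
          h.zero_below _ hr]
        omega
  apply Runs.time
  · apply Runs.assign_seq (z := (0 : ℕ))
    · simp
    apply Runs.seq_of
    · apply Runs.assign_seq (z := r)
      · simp [hfr]
      apply runs_downLoop (p := p) (u := u) h hK ih (r - tri k) r 0 (by norm_num) (by omega) le_rfl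
        hR hs ?_ (by simp [hfk]) (by simp [hfr]) (by simp [hfp]) (by simp [hfu]) (by simp [hfl])
        (by simp) (by simp)
        (T := 5000 * (downLoop k c (r - tri k) r 0).length + 20 +
          (if tri k < r then 400 * (r + 3 - p) else 0) - 1600 * (r - tri k)) ?_
      · intro hm
        rw [if_pos rfl, if_pos rfl]
        have : headSeq 1 k r c = headSeq 0 (k - 1) r (bump c r 1) :=
          h.lastSeq_of_le ((le_triangle_tri k).trans (triangle_mono (by omega)))
        rwa [← this]
      · rcases htr.eq_or_lt with hr | hr
        · rw [if_neg (by omega), if_neg (by omega)]; omega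
        · rw [if_pos ⟨rfl, by omega⟩, if_pos hr]; omega
    rintro fr₁ m' ⟨⟨hk₁, hr₁, hp₁, hu₁, hl₁, he₁⟩, hR', hout⟩
    rw [← hs'] at hR'
    have he₁ : fr₁ .e = rem k := by rw [he₁]; simp [hfe]
    apply Runs.seq_of
    · exact runs_chooseArgs hR' hk₁ hr₁ hp₁ hu₁ hl₁ (by simp)
    rintro fr₂ _ ⟨rfl, hfr₂⟩
    have hk₂ : fr₂ .k = k := by simp [hfr₂, hk₁]
    have hl₂ : fr₂ .l = tri k := by simp [hfr₂, hl₁]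
    have he₂ : fr₂ .e = rem k := by simp [hfr₂, he₁]
    have hq₂ : fr₂ .q = (if tri k = r then p else tri k + 1 : ℕ) := by rw [hfr₂]; simp
    have hv₂ : fr₂ .v = (if tri k = r then u else c (tri k + 1) + k : ℕ) := by rw [hfr₂]; simp
    clear hfr₂
    apply Runs.store_seq (y := tri k) (z := (c (tri k) + rem k : ℕ))
    · simp [hl₂]
    · simp [hl₂, he₂, hR'.c_eq]
    apply Runs.seq_of
    · apply runs_gen2Gray_call ihl (d := 1) (by norm_num) (hR'.bump _ _) hstart.1 hstart.2 (T :=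
        5000 * (gen1Gray (k - rem k) (tri k) 1 (bump c (tri k) (rem k))).length +
          400 * (reach 1 (k - rem k) (tri k) (bump c (tri k) (rem k)) + 3 -
            if tri k = r then p else tri k + 1) - 2950 -
          credit (k - rem k) (tri k) (bump c (tri k) (rem k)))
      · omega
      · simp [hk₂, he₂]; omega
      · simp [hl₂]
      · simp
      · exact hq₂
      · exact hv₂
    rintro _ m'' ⟨rfl, hR'', hout'⟩
    apply Runs.store_of (y := tri k) (z := (c (tri k) : ℕ))
    · simp [hl₂]
    · have := hR''.c_eq (tri k)
      rw [bump_self] at this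
      simp [hl₂, he₂, this]
    refine ⟨?_, ?_⟩
    · have : headSeq 0 (k - rem k) (tri k) (bump c (tri k) (rem k)) = headSeq 0 k r c :=
        h.firstSeq_low
      rw [← this]
      exact hR''.unbump
    · rw [outs_append]
      simp [hout, hout']
  · simp
    rcases htr.eq_or_lt with hr | hr
    · have := honly hr
      simp only [hr, if_true, lt_irrefl, if_false] at *
      omega
    · rw [if_neg hr.ne, if_pos hr]
      omega

/-- The statement that completes an object: `Update_Perm` is run and the permutation is output. -/
def output : Stmt := .seq (.call .updatePerm [Expr.var .p, Expr.var .u]) .emit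

theorem runs_output {n K r p u : ℕ} {c s b : ℕ → ℕ} {fr : Frame} {m : Mem} (h : Rep n K c s m)
    (hs : HasWeight n K s) (hb : HasWeight n K b) (hst : Start n r p u s b)
    (hc : ∀ i, p ≤ i + 2 → i ≤ n → c i = b i) (hfp : fr .p = p) (hfu : fr .u = u) :
    Runs output fr m 1110 fun _ m' => Rep n K c b m' ∧
      m'.out = m.out ++ [permArr (psi (seqOf n b))] := by
  have hupd : Runs Proc.updatePerm.body (bindParams Proc.updatePerm.params [(p : ℤ), (u : ℤ)]) m
      updateTime fun _ m' => Rep n K c b m' ∧ m'.out = m.out := by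
    rcases hst with ⟨rfl, rfl⟩ | ⟨_, hadj, hu⟩
    · refine (runs_updatePerm_zero (u := u)).mono le_rfl ?_
      rintro _ _ rfl
      exact ⟨h, rfl⟩
    · exact runs_updatePerm h hs.subexcedant hb.subexcedant hs.sum_eq hb.sum_eq hadj hu hc
  refine Runs.time (Runs.seq_of (Runs.call (T := updateTime)
    (Q := fun _ m' => Rep n K c b m' ∧ m'.out = m.out) ?_) ?_ (T₂ := 1)) ?_
  · rw [← hfp, ← hfu] at hupd
    exact hupd
  · rintro _ m' ⟨hR, hout⟩
    refine Runs.emit ⟨⟨hR.size, hR.tri, hR.sigma, hR.c_eq, hR.s_eq⟩, ?_⟩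
    rw [Mem.emit, hout, hR.sigma]
  · simp [updateTime]

theorem triangle_cast {r : ℕ} (h : 1 ≤ r) : (r : ℤ) * (r - 1) / 2 = triangle r := by
  unfold triangle
  rw [← Nat.cast_pred h]
  norm_cast

theorem rem_cast {n k r : ℕ} {c : ℕ → ℕ} (h : Inner n k r c) :
    (k : ℤ) - ((tri k : ℤ) - 1) * (tri k - 2) / 2 = rem k := by
  obtain ⟨h1, -⟩ := h.weight_split
  have h2 := h.two_le_tri
  have h3 := triangle_cast (r := tri k - 1) (by omega)
  rw [Nat.cast_pred (by omega)] at h3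
  rw [show (tri k : ℤ) - 2 = tri k - 1 - 1 by ring, h3]
  omega

/-- The part of the body of `Gen2_Gray` that follows the adjustment of `r`. -/
def gen2Rest : Stmt :=
  let k : Expr := Var.k
  let r : Expr := Var.r
  let p : Expr := Var.p
  let l : Expr := Var.l
  .ite (.and (.le 3 (p - r)) (.eq k (r * (r - 1) / 2)))
    output
    (.block [
      .assign Var.l (.read Arr.tri k),
      .assign Var.e (k - (l - 1) * (l - 2) / 2),
      .ite (.eq Var.dir 0) upBranch downBranch])

theorem runs_gen2Rest {n K k r d p u : ℕ} {c : ℕ → ℕ} (h : Inner n k r c) (hd : d < 2)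
    (hK : k + ∑ i ∈ range (n + 1), c i = K)
    (ihl : Correct n K (k - rem k) (tri k) (bump c (tri k) (rem k)))
    (ih : ∀ i, tri k < i → i ≤ r → Correct n K (k - 1) i (bump c i 1))
    {s : ℕ → ℕ} {m : Mem} {fr : Frame} (hR : Rep n K c s m) (hs : HasWeight n K s)
    (hst : Start n r p u s (headSeq d k r c))
    (hfk : fr .k = k) (hfr : fr .r = r) (hfd : fr .dir = d) (hfp : fr .p = p) (hfu : fr .u = u)
    {T : ℕ}
    (hT : 5000 * (gen1Gray k r d c).length + 400 * (reach d k r c + 3 - p) ≤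
      T + 3000 + credit k r c) :
    Runs gen2Rest fr m T fun _ m' => Rep n K c (headSeq (1 - d) k r c) m' ∧
      m'.out = m.out ++ outs n (gen1Gray k r d c) := by
  have htri : triangle r = (r : ℤ) * (r - 1) / 2 :=
    (triangle_cast (by have := h.two_le; omega)).symm
  have htest : ∀ e : Decidable (r + 3 ≤ p ∧ k = triangle r),
      (Expr.and (.le 3 (Expr.var .p - Expr.var .r))
      (.eq Var.k (Expr.var .r * (Expr.var .r - 1) / 2))).eval fr m =
      @ite _ (r + 3 ≤ p ∧ k = triangle r) e 1 0 := by
    intro e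
    have h1 : (3 : ℤ) ≤ p - r ↔ r + 3 ≤ p := by omega
    have h2 : (k : ℤ) = triangle r ↔ k = triangle r := by norm_cast
    have h3 := htri.symm
    by_cases h4 : r + 3 ≤ p <;> by_cases h5 : k = triangle r <;>
      simp [hfk, hfr, hfp, h3, h1, h2, h4, h5]
  by_cases hleaf : r + 3 ≤ p ∧ k = triangle r
  · have hw := h.weight_le
    have hfull : k + c r = triangle r := by omega
    have hcr := credit_le k r c
    have hH : ∀ d < 2, headSeq d k r c = firstSeq k r c := fun d hd =>
      h.eq_firstSeq_of_full hfull (headSeq_below h.toNode hd)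
    have hB := headSeq_below h.toNode hd
    have hW := h.toNode.hasWeight_headSeq hd hK
    rw [h.gen1Gray_of_full hd hfull] at hT ⊢
    rw [hH d hd] at hst hB hW
    rw [hH (1 - d) (by omega)]
    refine Runs.time (Runs.ite_true (by rw [htest inferInstance, if_pos hleaf]; norm_num)
      (runs_output hR hs hW hst (fun i hi _ => (hB.eq_above i (by omega)).symm) hfp hfu)) ?_
    simp at hT ⊢
    omega
  · have hlen := h.length_pos hd
    have hcr := credit_le k r c
    have htriK := hR.tri k (by omega)
    apply Runs.time
    · apply Runs.ite_false
      · rw [htest inferInstance, if_neg hleaf]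
      apply Runs.assign_seq (z := tri k)
      · simp [hfk, htriK]
      apply Runs.assign_seq (z := rem k)
      · simp [hfk, rem_cast h]
      refine Runs.time (T := 5 + (5000 * (gen1Gray k r d c).length + 400 * (reach d k r c + 3 - p)
        - 3060 - credit k r c)) ?_ le_rfl
      rcases (show d = 0 ∨ d = 1 by omega) with rfl | rfl
      · exact Runs.time (Runs.ite_true (by simp [hfd])
          (runs_upBranch h hK ihl ih hR hs hst hleaf (by simp [hfk]) (by simp [hfr])
          (by simp [hfp]) (by simp [hfu]) (by simp) (by simp) (T := 5000 * (gen1Gray k r 0 c).length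
          + 400 * (reach 0 k r c + 3 - p) - 3060 - credit k r c)
          (by rw [h.reach_eq, if_pos rfl]; omega))) (by simp)
      · exact Runs.time (Runs.ite_false (by simp [hfd])
          (runs_downBranch h hK ihl ih hR hs hst hleaf (by simp [hfk]) (by simp [hfr])
          (by simp [hfp]) (by simp [hfu]) (by simp) (by simp) (T := 5000 * (gen1Gray k r 1 c).length
          + 400 * (reach 1 k r c + 3 - p) - 3060 - credit k r c)
          (by rw [h.reach_eq, if_neg (by norm_num)]; omega))) (by simp)
    · simp
      omega

/-- The procedure `Gen2_Gray` is correct, by induction on the weight `k`. -/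
theorem correct {n K k r : ℕ} {c : ℕ → ℕ} (h : Node n k r c)
    (hK : k + ∑ i ∈ range (n + 1), c i = K) : Correct n K k r c := by
  induction k using Nat.strong_induction_on generalizing r c with
  | _ k ih =>
    intro d hd p u s m T hR hs hst hT
    set fr := bindParams Proc.gen2Gray.params [(k : ℤ), r, d, p, u] with hfr
    have hfk : fr .k = k := by simp [hfr, bindParams, Proc.params]
    have hfr' : fr .r = r := by simp [hfr, bindParams, Proc.params]
    have hfd : fr .dir = d := by simp [hfr, bindParams, Proc.params]
    have hfp : fr .p = p := by simp [hfr, bindParams, Proc.params]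
    have hfu : fr .u = u := by simp [hfr, bindParams, Proc.params]
    clear_value fr
    have hlen := h.length_pos hd
    have hcr := credit_le k r c
    rcases Nat.eq_zero_or_pos k with rfl | hk
    · have hH : ∀ d < 2, headSeq d 0 r c = c := fun d hd => by
        have := headSeq_below h hd
        rw [← mem_gen1Gray h hd, gen1Gray_zero] at this
        simpa using this
      have hW := h.hasWeight_headSeq hd hK
      rw [gen1Gray_zero] at hT ⊢
      rw [hH d hd] at hst hW
      rw [hH (1 - d) (by omega)]
      refine Runs.time (Runs.ite_true (by simp [hfk])
        (runs_output hR hs hW hst (fun i _ _ => rfl) hfp hfu)) ?_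
      simp at hT ⊢
      omega
    · have h' := h.inner_adjust hk
      have hadj : adjust r c ≤ r := by unfold adjust; split_ifs <;> omega
      have h2 := h'.two_le
      have hsplit := h'.weight_split
      have hcredit : credit k (adjust r c) c = credit k r c := by
        unfold credit Bonus; rw [h'.adjust_eq]
      have hreach : reach d k (adjust r c) c = reach d k r c := by
        unfold reach; rw [h'.adjust_eq]
      rw [h'.gen1Gray_adjust hd, ← hcredit, ← hreach] at hT
      rw [h'.gen1Gray_adjust hd, ← h.headSeq_adjust h']
      rw [← h.headSeq_adjust h'] at hst
      apply Runs.time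
      · apply Runs.ite_false
        · simp [hfk]; omega
        apply Runs.seq_of (T₁ := 20) (R := fun fr' m' => m = m' ∧
          fr' = Function.update fr .r (adjust r c : ℕ))
        · by_cases hc : c r = r - 1
          · refine Runs.time (Runs.ite_true ?_ (Runs.assign_of (z := (r - 1 : ℕ)) ?_ ⟨rfl, ?_⟩)) ?_
            · simp [hfr', hR.c_eq]; omega
            · simp [hfr']; omega
            · rw [adjust, if_pos hc]
            · simp
          · refine Runs.time (Runs.ite_false ?_ (Runs.skip ⟨rfl, ?_⟩)) ?_
            · simp [hfr', hR.c_eq]; omega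
            · rw [adjust, if_neg hc, ← hfr', Function.update_eq_self]
            · simp
        rintro _ _ ⟨rfl, rfl⟩
        exact runs_gen2Rest (d := d) (p := p) (u := u) h' hd hK
          (ih _ (by omega) h'.node_low (h'.sum_low hK))
          (fun i hi hir => ih _ (by omega) (h'.node_high hi hir) (by
            rw [sum_bump _ _ (hir.trans h'.le_size)]; omega))
          hR hs (hst.mono hadj) (by simp [hfk]) (by simp) (by simp [hfd]) (by simp [hfp])
          (by simp [hfu]) (T := 5000 * (gen1Gray k (adjust r c) d c).length +
            400 * (reach d k (adjust r c) c + 3 - p) - 3000 - credit k (adjust r c) c) (by omega)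
      · simp
        rw [h'.gen1Gray_adjust hd] at hlen
        omega

/-! ### The main call -/

theorem rep_init (n k : ℕ) :
    Rep n k zeroArr (firstSeq k n zeroArr) (initMem n k (seqOf n (firstSeq k n zeroArr))) := by
  refine ⟨rfl, fun z hz => ?_, rfl, fun i => rfl, fun i h1 h2 => ?_⟩
  · change (if _ then _ else _) = _
    rw [if_pos (by omega)]
    simp
  · change seqArr _ _ = _
    rw [seqArr, dif_pos (by omega)]
    simp [seqOf, Nat.sub_add_cancel h1]

end MajGray

theorem mainTheorem2 :
    (∀ n k : ℕ, k ≤ n * (n - 1) / 2 →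
      Set.BijOn (MajGray.psi (n := n)) (MajGray.S k n)
        {π : Equiv.Perm (Fin n) | MajGray.maj π = k} ∧
      (MajGray.grayList k n).Nodup ∧
      (∀ c : Fin n → ℕ, c ∈ MajGray.grayList k n ↔ c ∈ MajGray.S k n) ∧
      (MajGray.permList k n).Nodup ∧
      (∀ π : Equiv.Perm (Fin n), π ∈ MajGray.permList k n ↔ MajGray.maj π = k) ∧
      (MajGray.permList k n).IsChain (MajGray.DifferByAtMost 3)) ∧
    ∃ C : ℕ, ∀ n k : ℕ, k ≤ n * (n - 1) / 2 →
      ∃ a : Fin n → ℕ, MajGray.IsColexLeast k n a ∧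
        ∃ (fr : MajGray.Frame) (m : MajGray.Mem) (t : ℕ),
          MajGray.Exec (MajGray.mainCall n k) (fun _ => 0) (MajGray.initMem n k a) fr m t ∧
          m.out = (MajGray.permList k n).map MajGray.permArr ∧
          (k < n * (n - 1) / 2 →
            t ≤ C * Nat.card {π : Equiv.Perm (Fin n) // MajGray.maj π = k}) ∧
          t ≤ C * (Nat.card {π : Equiv.Perm (Fin n) // MajGray.maj π = k} + n) := by
  open MajGray in
  -- `8000` covers `5000` steps per output, `400 * tri k`, which is at most `1200` times the number
  -- of outputs, and a constant
  refine ⟨fun n k hk => ⟨psi_bijOn n k, nodup_grayList hk, mem_grayList hk, nodup_permList hk,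
    mem_permList hk, isChain_permList hk⟩, 8000, fun n k hk => ?_⟩
  have hN := node_root hk
  have hK : k + ∑ i ∈ Finset.range (n + 1), zeroArr i = k := by simp [zeroArr]
  have hlen := hN.length_pos (d := 0) (by norm_num)
  have htri : tri k ≤ n + 1 := by
    rcases Nat.eq_zero_or_pos n with rfl | hn
    · obtain rfl : k = 0 := by simpa using hk
      rw [tri_zero]
    · exact (tri_le hn hk).trans (by omega)
  have hcr := credit_le k n zeroArr
  have hrun := runs_gen2Gray_call (fr := fun _ => 0) (p := 0) (u := 0)
    (e₁ := .lit k) (e₂ := .lit n) (e₃ := .lit 0) (e₄ := .lit 0) (e₅ := .lit 0) (correct hN hK)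
    (d := 0) (by norm_num) (rep_init n k)
    (hN.hasWeight_headSeq (d := 0) (by norm_num) hK) (Or.inl ⟨rfl, rfl⟩)
    (T := 5000 * (gen1Gray k n 0 zeroArr).length + 400 * (tri k + 3))
    (by simp [reach]; omega) rfl rfl rfl rfl rfl
  obtain ⟨fr, m, t, hexec, ht, -, -, hout⟩ := hrun
  refine ⟨_, isColexLeast_firstSeq hk, fr, m, t, hexec, ?_, fun hlt => ?_, ?_⟩
  · rw [hout, permList_eq, List.map_map]
    rfl
  · rw [card_eq_length hk]
    have := tri_le_length hlt
    simp at ht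
    omega
  · rw [card_eq_length hk]
    simp at ht
    omega
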